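/- Let $\Lambda>0$ and $0<3m<1/\sqrt{\Lambda}$. Let $r_{\mathcal H}<r_{\mathcal C}$ be the two positive roots and $-|\bar r_{\mathcal C}|$ the negative root of $r-2m-\tfrac{\Lambda}{3}r^3$, and set $$\kappa=\tfrac12\,\tfrac{\Lambda}{3}\,\frac{(r_{\mathcal C}-r_{\mathcal H})(r_{\mathcal C}+|\bar r_{\mathcal C}|)}{r_{\mathcal C}},\quad \alpha=\frac{r_{\mathcal H}}{r_{\mathcal C}}\,\frac{r_{\mathcal C}+|\bar r_{\mathcal C}|}{r_{\mathcal H}+|\bar r_{\mathcal C}|},\quad \beta=\frac{|\bar r_{\mathcal C}|}{r_{\mathcal C}}\,\frac{r_{\mathcal C}-r_{\mathcal H}}{r_{\mathcal H}+|\bar r_{\mathcal C}|},\quad h(r)=\frac{r-r_{\mathcal C}}{(r-r_{\mathcal H})^{\alpha}(r+|\bar r_{\mathcal C}|)^{\beta}}.$$ Consider the Schwarzschild–de Sitter metric $g=-\Omega^2\,du\,dv+r^2\mathring\gamma$ on $\{(u,v):uv<1\}\times\mathbb S^2$, where $\mathring\gamma$ is the round metric of the unit sphere, $r=r(u,v)>r_{\mathcal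 H}$ is given by $uv=h(r)$, and $$\Omega^2=\frac4r\,\frac3\Lambda\,\frac{r_{\mathcal C}^2}{(r_{\mathcal C}-r_{\mathcal H})^2(r_{\mathcal C}+|\bar r_{\mathcal C}|)^2}\,(r-r_{\mathcal H})^{1+\alpha}(r+|\bar r_{\mathcal C}|)^{1+\beta}.$$ Let $\mathcal C^+=\{v=0,\ u>0\}$ be the cosmological horizon (to the future of the bifurcation sphere), let $T=\kappa(u\partial_u-v\partial_v)$, and let $\tau$ be the function of $u$ on $\mathcal C^+$ with $T\cdot\tau=1$ and $\tau=\tau_0$ on a chosen sphere $u=u_0>0$. Write $u(\tau)=u_0e^{\kappa(\tau-\tau_0)}$. For $\sigma>(2/r_{\mathcal C})^2\,2/\kappa$ let $Y$ be the spherically symmetric vector field $Y=Y^u\partial_u+Y^v\partial_v$ near $\mathcal C^+$ with $$Y|_{\mathcal C^+}=\frac{2}{\partial_v r}\,\partial_v,\qquad \nabla_YY=-\sigma(Y+T),\qquad [T,Y]=0,$$ and put $N=T+Y$. For a function $\psi$ let $$T_{\mu\nu}[\psi]=\partial_\mu\psi\,\partial_\nu\psi-\tfrac12 g_{\mu\nu}\,\partial^\lambda\psi\,\partial_\lambda\psi,\qquad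 J^X_\mu[\psi]=T_{\mu\nu}[\psi]X^\nu,\qquad K^N[\psi]=\tfrac12(\mathcal L_Ng)^{\mu\nu}T_{\mu\nu}[\psi].$$ A function $\psi$ on an open set $U$ is called a finite energy solution of $\Box_g\psi=0$ on $U$ if it is a limit of classical ($C^2$) solutions $\psi_j$ on $U$ in the sense that, on each compact subset of $U$, $\psi_j\to\psi$ in $L^2$ and the first derivatives of the $\psi_j$ form a Cauchy sequence in $L^2$. A flux of $\psi$ through a hypersurface segment is the limit of the fluxes of $\psi_j$, for every such approximating sequence. **Proposition.** There is a constant $b>0$, depending only on $\Lambda$ and $m$, such that for every $\sigma>(2/r_{\mathcal C})^2\,2/\kappa$ there are $r_1,r_2$ with $r_{\mathcal H}<r_1<r_{\mathcal C}<r_2$, depending only on $\Lambda,m,\sigma$, for which a smooth field $Y$ as above exists on $\{u>0,\ r_1<r<r_2\}$ and the following holds for every $r_0\in(r_{\mathcal C},r_2)$. (i) On $\{u>0,\ v\ge0,\ r\le r_0\}$ the field $N$ is timelike and future directed and $K^N[\psi]\ge0$ for all $\psi$. Moreover there is a constant $C$ with $J^M[\psi]\cdot n\le C\,J^N[\psi]\cdot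 n$ on $\{u>0,\ v>0,\ r=r_0\}$ for all $\psi$, where $n$ is the future unit normal of $\{r=r_0\}$ and $M=-\frac1r\phi^2\operatorname{grad}r$ with $\phi=(\Lambda r^2/3+2m/r-1)^{-1/2}$. (ii) Let $u_0>0$, $\tau_0\in\mathbb R$, and let $\psi$ be a finite energy solution on an open set $U\subseteq\{uv<1\}\times\mathbb S^2$ that contains $\{u>u_0,\ v\ge0,\ r\le r_0\}$. For $\tau>\tau_0$ let $\mathrm C'_\tau=\{u=u(\tau),\ v\ge0,\ r\le r_0\}$ be the truncated outgoing null cone from the sphere $\tau$ of $\mathcal C^+$. Then the flux $$f(\tau)=\int_{\mathrm C'_\tau}{}^*J^N[\psi]$$ exists and is finite for all $\tau>\tau_0$. There is a locally integrable incoming energy flux density $g$ along $\mathcal C^+$, that is, with $\mathcal C^+_{\tau_1,\tau_2}$ the segment $\tau_1\le\tau<\tau_2$ of $\mathcal C^+$, $$\int_{\mathcal C^+_{\tau_1,\tau_2}}{}^*J^N[\psi]=\int_{\tau_1}^{\tau_2}g(\tau)\,d\tau\qquad(\tau_0<\tau_1<\tau_2),$$ and for every such $g$ $$f(\tau_2)\le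 f(\tau_1)\,e^{-b(\tau_2-\tau_1)}+\int_{\tau_1}^{\tau_2}g(\tau)\,e^{-b(\tau_2-\tau)}\,d\tau\qquad\text{for all }\tau_2>\tau_1>\tau_0 .$$ Here the fluxes have the nonnegative densities $(J^N\cdot\partial_v)\,r^2\,dv\,d\mathring\gamma$ on $\mathrm C'_\tau$ and $(J^N\cdot\partial_u)\,r^2\,du\,d\mathring\gamma$ on $\mathcal C^+$. -/

import Mathlib

open MeasureTheory Filter Topology Set

namespace SchwarzschildDeSitter

noncomputable section

/-! ### Horizon radii, surface gravity and double null coordinates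

All objects depend on the cosmological constant `Λ` and the mass `m`; they are used for
`0 < Λ` and `0 < 3 m < 1 / √Λ`. -/

/-- The cubic `r - 2 m - Λ r ^ 3 / 3 = r (1 - 2 m / r - Λ r ^ 2 / 3)`. -/
def horizonCubic (Λ m r : ℝ) : ℝ := r - 2 * m - Λ * r ^ 3 / 3

/-- The radius of the event horizon: the smaller positive root of the cubic. -/
def rH (Λ m : ℝ) : ℝ := sInf {r : ℝ | 0 < r ∧ horizonCubic Λ m r = 0}

/-- The radius of the cosmological horizon: the larger positive root of the cubic. -/
def rC (Λ m : ℝ) : ℝ := sSup {r : ℝ | 0 < r ∧ horizonCubic Λ m r = 0}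

/-- The absolute value of the negative root of the cubic. -/
def rNeg (Λ m : ℝ) : ℝ := |sInf {r : ℝ | horizonCubic Λ m r = 0}|

/-- The surface gravity of the cosmological horizon. -/
def kappa (Λ m : ℝ) : ℝ :=
  1 / 2 * (Λ / 3) * ((rC Λ m - rH Λ m) * (rC Λ m + rNeg Λ m) / rC Λ m)

def expH (Λ m : ℝ) : ℝ := rH Λ m / rC Λ m * ((rC Λ m + rNeg Λ m) / (rH Λ m + rNeg Λ m))

def expNeg (Λ m : ℝ) : ℝ := rNeg Λ m / rC Λ m * ((rC Λ m - rH Λ m) / (rNeg Λ m + rH Λ m))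

/-- The increasing bijection from `(rH, ∞)` onto `(-∞, 1)` that expresses the product `u v` of the
double null coordinates through the area radius. -/
def uvOfRadius (Λ m r : ℝ) : ℝ :=
  (r - rC Λ m) / ((r - rH Λ m) ^ expH Λ m * (r + rNeg Λ m) ^ expNeg Λ m)

/-- The area radius `r(u, v) > rH` on the chart `{u v < 1}`, implicitly given by
`u v = uvOfRadius r`. The point of the `(u, v)` plane is a pair. -/
def radius (Λ m : ℝ) (q : ℝ × ℝ) : ℝ :=
  Function.invFunOn (uvOfRadius Λ m) (Ioi (rH Λ m)) (q.1 * q.2)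

/-- The conformal factor `Ω ^ 2` of the metric `g = - Ω ^ 2 du dv + r ^ 2 g_{S ^ 2}`. -/
def omegaSq (Λ m : ℝ) (q : ℝ × ℝ) : ℝ :=
  4 / radius Λ m q * (3 / Λ) *
    (rC Λ m ^ 2 / ((rC Λ m - rH Λ m) ^ 2 * (rC Λ m + rNeg Λ m) ^ 2)) *
    ((radius Λ m q - rH Λ m) ^ (1 + expH Λ m) * (radius Λ m q + rNeg Λ m) ^ (1 + expNeg Λ m))

/-! ### The spacetime chart -/

/-- The unit sphere of Euclidean three-space. -/
abbrev S2 : Type := Metric.sphere (0 : EuclideanSpace ℝ (Fin 3)) 1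

/-- Points `(u, v, x)`; the spacetime chart is the part with `u v < 1`. It covers the expanding
region `0 < u v < 1`, `0 < u`, the static regions `u v < 0`, and the cosmological horizons. -/
abbrev Point : Type := ℝ × ℝ × S2

/-- The spacetime chart. -/
def chart : Set Point := {p | p.1 * p.2.1 < 1}

/-- The standard (area) measure of the unit sphere. -/
def sphereMeasure : Measure S2 := (volume : Measure (EuclideanSpace ℝ (Fin 3))).toSphere

/-- The measure `du dv dω`. On compact subsets of the chart it is comparable to the volume
`(Ω ^ 2 / 2) r ^ 2 du dv dω` of the metric. -/
def chartMeasure : Measure Point :=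
  (volume : Measure ℝ).prod ((volume : Measure ℝ).prod sphereMeasure)

/-- The projection to the `(u, v)` plane. -/
def toQ (p : Point) : ℝ × ℝ := (p.1, p.2.1)

/-! ### Calculus on the chart -/

/-- The extension `y ↦ φ (y / |y|)` of a function on the unit sphere, constant along rays. -/
def radialExt (φ : S2 → ℝ) (y : EuclideanSpace ℝ (Fin 3)) : ℝ :=
  if h : y ≠ 0 then φ ⟨‖y‖⁻¹ • y, by simp [norm_smul, h]⟩ else 0

/-- `∂ψ/∂u`. -/
def dU (ψ : Point → ℝ) (p : Point) : ℝ := deriv (fun s => ψ (s, p.2.1, p.2.2)) p.1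

/-- `∂ψ/∂v`. -/
def dV (ψ : Point → ℝ) (p : Point) : ℝ := deriv (fun s => ψ (p.1, s, p.2.2)) p.2.1

/-- `|∇ψ| ^ 2` for the gradient of the unit sphere: the squared length of the Euclidean gradient of
the extension that is constant along rays. -/
def sphereGradSq (ψ : Point → ℝ) (p : Point) : ℝ :=
  ‖fderiv ℝ (radialExt fun x => ψ (p.1, p.2.1, x)) (p.2.2 : EuclideanSpace ℝ (Fin 3))‖ ^ 2

open scoped Laplacian in
/-- The Laplace-Beltrami operator of the unit sphere: the Euclidean Laplacian of the extension that
is constant along rays. -/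
def sphereLaplacian (ψ : Point → ℝ) (p : Point) : ℝ :=
  Δ (radialExt fun x => ψ (p.1, p.2.1, x)) (p.2.2 : EuclideanSpace ℝ (Fin 3))

/-- `ψ` is twice continuously differentiable at each point of `U`. -/
def IsC2On (U : Set Point) (ψ : Point → ℝ) : Prop :=
  ∀ p ∈ U, ContDiffAt ℝ 2
    (fun z : ℝ × ℝ × EuclideanSpace ℝ (Fin 3) => radialExt (fun x => ψ (z.1, z.2.1, x)) z.2.2)
    (p.1, p.2.1, (p.2.2 : EuclideanSpace ℝ (Fin 3)))

/-- The wave operator of `g = - Ω ^ 2 du dv + r ^ 2 g_{S ^ 2}`, that is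
`|g|^{-1/2} ∂_μ (|g|^{1/2} g^{μν} ∂_ν ψ)` with volume density `(Ω ^ 2 / 2) r ^ 2` and
`g^{uv} = - 2 / Ω ^ 2`. -/
def box (Λ m : ℝ) (ψ : Point → ℝ) (p : Point) : ℝ :=
  -(2 / (omegaSq Λ m (toQ p) * radius Λ m (toQ p) ^ 2)) *
      (dU (fun q => radius Λ m (toQ q) ^ 2 * dV ψ q) p +
        dV (fun q => radius Λ m (toQ q) ^ 2 * dU ψ q) p) +
    sphereLaplacian ψ p / radius Λ m (toQ p) ^ 2

/-! ### Vector fields tangent to the `(u, v)` plane, energy currents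

All vector fields needed here are spherically symmetric and of the form `X^u ∂_u + X^v ∂_v`, with
components depending on `(u, v)` only; they are maps `ℝ × ℝ → ℝ × ℝ`. -/

/-- The metric on vectors `X^u ∂_u + X^v ∂_v`. -/
def gQ (Λ m : ℝ) (q X Z : ℝ × ℝ) : ℝ := -(omegaSq Λ m q / 2) * (X.1 * Z.2 + X.2 * Z.1)

/-- The Levi-Civita derivative `∇_X Z`. The only Christoffel symbols that enter are
`Γ^u_{uu} = ∂_u log Ω ^ 2` and `Γ^v_{vv} = ∂_v log Ω ^ 2`. -/
def covDeriv (Λ m : ℝ) (X Z : ℝ × ℝ → ℝ × ℝ) (q : ℝ × ℝ) : ℝ × ℝ :=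
  fderiv ℝ Z q (X q) +
    (fderiv ℝ (fun q => Real.log (omegaSq Λ m q)) q (1, 0) * (X q).1 * (Z q).1,
     fderiv ℝ (fun q => Real.log (omegaSq Λ m q)) q (0, 1) * (X q).2 * (Z q).2)

/-- `g^{-1}(dψ, dψ)`. -/
def gradSq (Λ m : ℝ) (ψ : Point → ℝ) (p : Point) : ℝ :=
  -(4 / omegaSq Λ m (toQ p)) * (dU ψ p * dV ψ p) + sphereGradSq ψ p / radius Λ m (toQ p) ^ 2

/-- The energy momentum tensor
`T(X, Z) = (X ψ) (Z ψ) - (1 / 2) g(X, Z) g^{-1}(dψ, dψ)`, for vectors `X`, `Z` in the `(u, v)`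
directions. It is the contraction `J^X · Z` of the energy current of the multiplier `X`. -/
def stress (Λ m : ℝ) (ψ : Point → ℝ) (p : Point) (X Z : ℝ × ℝ) : ℝ :=
  (X.1 * dU ψ p + X.2 * dV ψ p) * (Z.1 * dU ψ p + Z.2 * dV ψ p) -
    1 / 2 * gQ Λ m (toQ p) X Z * gradSq Λ m ψ p

/-- The deformation tensor `(1 / 2) L_N g` on constant vectors `X`, `Z` in the `(u, v)`
directions. -/
def deformation (Λ m : ℝ) (N : ℝ × ℝ → ℝ × ℝ) (q X Z : ℝ × ℝ) : ℝ :=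
  1 / 2 * (fderiv ℝ (fun q => gQ Λ m q X Z) q (N q) +
    gQ Λ m q (fderiv ℝ N q X) Z + gQ Λ m q X (fderiv ℝ N q Z))

/-- `K^N[ψ]`, the full contraction of the deformation tensor of `N` with the energy momentum
tensor of `ψ`. Here `(g^{uv}) ^ 2 = 4 / Ω ^ 4`; the part of the deformation tensor tangent to the
spheres is `(1 / 2) N(r ^ 2) g_{S ^ 2}`, and the trace of the energy momentum tensor over the
sphere of radius `r` is `|∇ψ| ^ 2 / r ^ 2 - g^{-1}(dψ, dψ)`. -/
def bulk (Λ m : ℝ) (N : ℝ × ℝ → ℝ × ℝ) (ψ : Point → ℝ) (p : Point) : ℝ :=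
  4 / omegaSq Λ m (toQ p) ^ 2 *
      (deformation Λ m N (toQ p) (0, 1) (0, 1) * stress Λ m ψ p (1, 0) (1, 0) +
        2 * (deformation Λ m N (toQ p) (1, 0) (0, 1) * stress Λ m ψ p (1, 0) (0, 1)) +
        deformation Λ m N (toQ p) (1, 0) (1, 0) * stress Λ m ψ p (0, 1) (0, 1)) +
    1 / 2 * fderiv ℝ (fun q => radius Λ m q ^ 2) (toQ p) (N (toQ p)) /
        radius Λ m (toQ p) ^ 2 *
      (sphereGradSq ψ p / radius Λ m (toQ p) ^ 2 - gradSq Λ m ψ p)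

/-- The Killing vector field `T = κ (u ∂_u - v ∂_v)`. -/
def killingT (Λ m : ℝ) (q : ℝ × ℝ) : ℝ × ℝ := (kappa Λ m * q.1, -(kappa Λ m * q.2))

/-- The lapse function of the level sets of the area radius in the expanding region. -/
def lapse (Λ m r : ℝ) : ℝ := 1 / √(Λ * r ^ 2 / 3 + 2 * m / r - 1)

/-- `V = - grad r = κ (u ∂_u + v ∂_v)`. -/
def gradR (Λ m : ℝ) (q : ℝ × ℝ) : ℝ × ℝ := (kappa Λ m * q.1, kappa Λ m * q.2)

/-- The unit normal `n = φ V` of the level sets of the area radius, `φ` being the lapse. -/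
def unitNormal (Λ m : ℝ) (q : ℝ × ℝ) : ℝ × ℝ := lapse Λ m (radius Λ m q) • gradR Λ m q

/-- The vector field `M = (1 / r) ∂_r`, with `∂_r = φ ^ 2 V`. -/
def fieldM (Λ m : ℝ) (q : ℝ × ℝ) : ℝ × ℝ :=
  (1 / radius Λ m q * lapse Λ m (radius Λ m q) ^ 2) • gradR Λ m q

/-! ### The redshift vector field -/

/-- `Y` is the redshift vector field on `{0 < u, r₁ < r < r₂}`: on the horizon `v = 0` it is
`(2 / ∂_v r) ∂_v`, it is extended off the horizon by `∇_Y Y = - σ (Y + T)`, and it is Lie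
transported by `T`. -/
structure IsRedshiftField (Λ m σ r₁ r₂ : ℝ) (Y : ℝ × ℝ → ℝ × ℝ) : Prop where
  smooth : ContDiffOn ℝ (⊤ : ℕ∞) Y
    {q | 0 < q.1 ∧ q.1 * q.2 < 1 ∧ r₁ < radius Λ m q ∧ radius Λ m q < r₂}
  on_horizon : ∀ u : ℝ, 0 < u → Y (u, 0) = (0, 2 / fderiv ℝ (radius Λ m) (u, 0) (0, 1))
  extension : ∀ q : ℝ × ℝ, 0 < q.1 → q.1 * q.2 < 1 → r₁ < radius Λ m q → radius Λ m q < r₂ →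
    covDeriv Λ m Y Y q = -σ • (Y q + killingT Λ m q)
  invariant : ∀ q : ℝ × ℝ, 0 < q.1 → q.1 * q.2 < 1 → r₁ < radius Λ m q → radius Λ m q < r₂ →
    VectorField.lieBracket ℝ (killingT Λ m) Y q = 0

/-- The multiplier `N = T + Y`. -/
def fieldN (Λ m : ℝ) (Y : ℝ × ℝ → ℝ × ℝ) (q : ℝ × ℝ) : ℝ × ℝ := killingT Λ m q + Y q

/-- The part `{0 < u, 0 ≤ v, r ≤ r₀}` of the closed expanding region near the horizon `v = 0`. -/
def redshiftRegion (Λ m r₀ : ℝ) : Set Point :=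
  {p | 0 < p.1 ∧ 0 ≤ p.2.1 ∧ p.1 * p.2.1 < 1 ∧ radius Λ m (toQ p) ≤ r₀}

/-- The radius `r₀` is admissible for the redshift field `Y`: up to `r₀` the multiplier `N = T + Y`
is timelike and future directed and has `K^N[ψ] ≥ 0`, and on the hypersurface `r = r₀` the energy
density of `M` is bounded by that of `N`, uniformly. -/
structure IsRedshiftRadius (Λ m : ℝ) (Y : ℝ × ℝ → ℝ × ℝ) (r₀ : ℝ) : Prop where
  gt_rC : rC Λ m < r₀
  timelike : ∀ p ∈ redshiftRegion Λ m r₀,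
    gQ Λ m (toQ p) (fieldN Λ m Y (toQ p)) (fieldN Λ m Y (toQ p)) < 0 ∧
      0 < (fieldN Λ m Y (toQ p)).1 ∧ 0 < (fieldN Λ m Y (toQ p)).2
  bulk_nonneg : ∀ ψ : Point → ℝ, ∀ p ∈ redshiftRegion Λ m r₀,
    0 ≤ bulk Λ m (fieldN Λ m Y) ψ p
  energy_le : ∃ C : ℝ, ∀ ψ : Point → ℝ, ∀ p ∈ redshiftRegion Λ m r₀, radius Λ m (toQ p) = r₀ →
    stress Λ m ψ p (fieldM Λ m (toQ p)) (unitNormal Λ m (toQ p)) ≤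
      C * stress Λ m ψ p (fieldN Λ m Y (toQ p)) (unitNormal Λ m (toQ p))

/-! ### The time function on the horizon and the energy fluxes -/

/-- The value of `u` on the sphere `τ` of the horizon `v = 0`, where the function `τ` satisfies
`T · τ = 1`, that is `du/dτ = κ u`, and equals `τ₀` on the sphere `u = u₀`. -/
def horizonU (Λ m u₀ τ₀ τ : ℝ) : ℝ := u₀ * Real.exp (kappa Λ m * (τ - τ₀))

theorem horizonU_base (Λ m u₀ τ₀ : ℝ) : horizonU Λ m u₀ τ₀ τ₀ = u₀ := by
  simp [horizonU]

theorem hasDerivAt_horizonU (Λ m u₀ τ₀ τ : ℝ) :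
    HasDerivAt (horizonU Λ m u₀ τ₀) (kappa Λ m * horizonU Λ m u₀ τ₀ τ) τ := by
  have h : HasDerivAt (fun t : ℝ => kappa Λ m * (t - τ₀)) (kappa Λ m) τ := by
    simpa using ((hasDerivAt_id τ).sub_const τ₀).const_mul (kappa Λ m)
  exact ((h.exp).const_mul u₀).congr_deriv (by unfold horizonU; ring)

/-- The flux of `*J^N[ψ]` through the segment `r ≤ r₀`, that is `0 ≤ v ≤ uvOfRadius r₀ / u`, of the
outgoing null hypersurface from the sphere `u` of the horizon. Contracting the volume form
`(Ω ^ 2 / 2) r ^ 2 du dv dω` with the vector dual to `J^N` leaves `(J^N · ∂_v) r ^ 2 dv dω`, up to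
the orientation, which makes the flux nonnegative. -/
def coneFlux (Λ m : ℝ) (N : ℝ × ℝ → ℝ × ℝ) (r₀ u : ℝ) (ψ : Point → ℝ) : ℝ :=
  ∫ v in (0 : ℝ)..(uvOfRadius Λ m r₀ / u), ∫ x : S2,
    stress Λ m ψ (u, v, x) (N (u, v)) (0, 1) * radius Λ m (u, v) ^ 2 ∂sphereMeasure

/-- The flux of `*J^N[ψ]` through the segment of the horizon `v = 0` between the spheres `u₁` and
`u₂`, likewise with density `(J^N · ∂_u) r ^ 2 du dω`. -/
def horizonFlux (Λ m : ℝ) (N : ℝ × ℝ → ℝ × ℝ) (u₁ u₂ : ℝ) (ψ : Point → ℝ) : ℝ :=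
  ∫ u in u₁..u₂, ∫ x : S2,
    stress Λ m ψ (u, 0, x) (N (u, 0)) (1, 0) * radius Λ m (u, 0) ^ 2 ∂sphereMeasure

/-! ### Finite energy solutions -/

/-- Classical solutions of the wave equation on the open set `U`. -/
def IsClassicalSolution (Λ m : ℝ) (U : Set Point) (ψ : Point → ℝ) : Prop :=
  IsC2On U ψ ∧ ∀ p ∈ U, box Λ m ψ p = 0

/-- The (coordinate) energy density `(∂_u φ) ^ 2 + (∂_v φ) ^ 2 + |∇φ| ^ 2`. -/
def energyDensity (φ : Point → ℝ) (p : Point) : ℝ :=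
  dU φ p ^ 2 + dV φ p ^ 2 + sphereGradSq φ p

/-- The classical solutions `s 0, s 1, …` converge to `ψ` locally in energy: in `L ^ 2(K)`, and with
first derivatives that form a Cauchy sequence in `L ^ 2(K)`, for each compact `K ⊆ U`. -/
structure Approximates (Λ m : ℝ) (U : Set Point) (ψ : Point → ℝ) (s : ℕ → Point → ℝ) : Prop where
  solution : ∀ j, IsClassicalSolution Λ m U (s j)
  tendsto : ∀ K ⊆ U, IsCompact K →
    Tendsto (fun j => ∫⁻ p in K, ENNReal.ofReal ((s j p - ψ p) ^ 2) ∂chartMeasure) atTop (𝓝 0)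
  cauchy : ∀ K ⊆ U, IsCompact K →
    Tendsto (fun j : ℕ × ℕ =>
      ∫⁻ p in K, ENNReal.ofReal (energyDensity (fun q => s j.1 q - s j.2 q) p) ∂chartMeasure)
      atTop (𝓝 0)

/-- Solutions of the wave equation on `U` of locally finite energy: limits of classical solutions,
locally in the energy norm. -/
def IsFiniteEnergySolution (Λ m : ℝ) (U : Set Point) (ψ : Point → ℝ) : Prop :=
  AEStronglyMeasurable ψ (chartMeasure.restrict U) ∧ ∃ s, Approximates Λ m U ψ s

/-- `F` is the value on the finite energy solution `ψ` of a flux `Φ` that is given on classical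
solutions: the limit of `Φ` along each sequence of classical solutions that approximates `ψ`. -/
def HasFlux (Λ m : ℝ) (U : Set Point) (ψ : Point → ℝ) (Φ : (Point → ℝ) → ℝ) (F : ℝ) : Prop :=
  ∀ s, Approximates Λ m U ψ s → Tendsto (fun j => Φ (s j)) atTop (𝓝 F)

/-- `g` is the flux density of `*J^N[ψ]` along the horizon `v = 0` to the future of `τ₀`: the flux
through the segment `τ₁ ≤ τ < τ₂` is the integral of `g` over `(τ₁, τ₂)`. -/
def IsFluxDensity (Λ m : ℝ) (U : Set Point) (N : ℝ × ℝ → ℝ × ℝ) (u₀ τ₀ : ℝ) (ψ : Point → ℝ)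
    (g : ℝ → ℝ) : Prop :=
  ∀ τ₁ τ₂ : ℝ, τ₀ < τ₁ → τ₁ < τ₂ → IntervalIntegrable g volume τ₁ τ₂ ∧
    HasFlux Λ m U ψ
      (horizonFlux Λ m N (horizonU Λ m u₀ τ₀ τ₁) (horizonU Λ m u₀ τ₀ τ₂))
      (∫ τ in τ₁..τ₂, g τ)

end

end SchwarzschildDeSitter

open SchwarzschildDeSitter

/-! The geometry near the horizon depends on `w = u v` alone. The fields that commute with `T` have
the form `u A(w) ∂_u + u⁻¹ B(w) ∂_v`, and `Ω²` is `2 / κ` times `dr/dw` (`omegaSq_eq`). The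
conditions on `Y = u a(w) ∂_u + u⁻¹ c(w) ∂_v` thus become a system of ordinary differential
equations in `w`, whose leading coefficient `w a + c` is positive at the horizon `w = 0`. It has a
smooth solution near `w = 0` (`exists_isRedshiftProfile`, `isRedshiftField_of_profile`).

For `N = T + Y` one has `A = κ + a`, `B = c - κ w`, and the bulk term is a quadratic form in `u ∂_u
ψ`, `u⁻¹ ∂_v ψ` plus a multiple of `|∇ψ|²`, again with coefficients in `w` only
(`bulk_profileField`). At `w = 0`, domination of `b` times the energy density on outgoing cones
amounts to `4 κ² / r_C² < (κ - b) κ² σ` and `b ≤ σ`. If `b ≤ κ / 2`, the first follows from exactly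
the assumed lower bound `8 / (r_C² κ) < σ`; if also `b ≤ 8 / (r_C² κ)`, so does the second. Such a
`b` does not involve `σ`. The inequalities are strict, so they persist for small `|w|`
(`exists_coercive_profile`).

For a classical solution the divergence of the energy current is taken after integration over the
spheres (`exists_divergence`); the angular derivatives are moved by the divergence theorem on the
sphere, which needs no more than `C²`. In the coordinates `(τ, w)` the region between two cones is a
rectangle. The current weighted by `e^{bτ}` has nonpositive divergence there, and its flux through
`r = r₀` has a favourable sign. This gives the exponentially weighted inequality
(`IsRedshiftProfile.energy_le`).

For finite energy solutions the inequality is passed to the limit. Weighting the current with a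
function that vanishes on the future edges of a rectangle bounds the fluxes through the past edges
by the energy inside (`exists_trace_bound`). Two sequences approximating the same solution become
close in energy: their difference tends to zero in `L²` and is Cauchy in energy, and the gradient is
closable by Green's formula (`tendsto_cutoff_energy`). Hence flux densities, being quadratic,
converge in `L¹` to limits independent of the sequence, and any flux density `g` agrees almost
everywhere with the limit on the horizon (`IsFluxDensity.ae_eq_rate_limit`). -/

namespace SchwarzschildDeSitter

/-! ### The horizon radii -/

/-- The three roots of the cubic are real, distinct and correctly ordered. -/
structure Subextremal (Λ m : ℝ) : Prop where
  lambda_pos : 0 < Λ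
  rH_pos : 0 < rH Λ m
  rH_lt_rC : rH Λ m < rC Λ m
  rNeg_pos : 0 < rNeg Λ m

theorem continuous_horizonCubic (Λ m : ℝ) : Continuous (horizonCubic Λ m) := by
  unfold horizonCubic; fun_prop

/-- With `s = 1 / √Λ` the cubic equals `-2m` at `0`, `2s/3 - 2m > 0` at `s`, and is negative at
`2s`. This locates one root in `(0, s)` and one in `(s, 2s)`. The cubic has no quadratic term, so
its roots sum to zero and the third is negative. -/
theorem subextremal_of_lt {Λ m : ℝ} (hΛ : 0 < Λ) (hm : 0 < m) (hsub : 3 * m < 1 / √Λ) :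
    Subextremal Λ m := by
  set s := 1 / √Λ with hs
  have hs0 : 0 < s := by positivity
  have hs2 : Λ * s ^ 2 = 1 := by
    rw [hs, div_pow, Real.sq_sqrt hΛ.le]; field_simp
  have f0 : horizonCubic Λ m 0 < 0 := by unfold horizonCubic; nlinarith
  have fs : 0 < horizonCubic Λ m s := by
    have : horizonCubic Λ m s = s - 2 * m - Λ * s ^ 2 * s / 3 := by unfold horizonCubic; ring
    rw [this, hs2]; linarith
  have f2 : horizonCubic Λ m (2 * s) < 0 := by
    have : horizonCubic Λ m (2 * s) = 2 * s - 2 * m - Λ * s ^ 2 * (8 * s) / 3 := by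
      unfold horizonCubic; ring
    rw [this, hs2]; linarith
  obtain ⟨a, ⟨ha0, has⟩, fa⟩ : ∃ a ∈ Ioo 0 s, horizonCubic Λ m a = 0 := by
    have := intermediate_value_Ioo hs0.le (continuous_horizonCubic Λ m).continuousOn
    exact this ⟨f0, fs⟩
  obtain ⟨c, ⟨hsc, -⟩, fc⟩ : ∃ c ∈ Ioo s (2 * s), horizonCubic Λ m c = 0 := by
    have := intermediate_value_Ioo' (by linarith) (continuous_horizonCubic Λ m).continuousOn
      (a := s) (b := 2 * s)
    exact this ⟨f2, fs⟩
  have hac : a < c := has.trans hsc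
  -- The difference of the two root equations, divided by `c - a`. It makes the third factor of the
  -- cubic `r + (a + c)`.
  have e1 : Λ * (a ^ 2 + a * c + c ^ 2) = 3 := by
    have : (c - a) * (Λ * (a ^ 2 + a * c + c ^ 2) - 3) = 0 := by
      unfold horizonCubic at fa fc; linear_combination 3 * fa - 3 * fc
    rcases mul_eq_zero.1 this with h | h <;> linarith
  have fact : ∀ r, 3 * horizonCubic Λ m r = -Λ * ((r - a) * (r - c) * (r + (a + c))) := by
    intro r
    unfold horizonCubic at fa ⊢
    linear_combination 3 * fa + (a - r) * e1
  have zero_iff : ∀ r, horizonCubic Λ m r = 0 ↔ r = a ∨ r = c ∨ r = -(a + c) := by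
    intro r
    have h := fact r
    constructor
    · intro h0
      rw [h0, mul_zero, eq_comm, mul_eq_zero, mul_eq_zero, mul_eq_zero] at h
      rcases h with h | (h | h) | h
      · linarith
      · left; linarith
      · right; left; linarith
      · right; right; linarith
    · rintro (rfl | rfl | rfl) <;> simpa using h
  have pos_set : {r : ℝ | 0 < r ∧ horizonCubic Λ m r = 0} = {a, c} := by
    ext r
    simp only [mem_ofPred_eq, zero_iff, mem_insert_iff, mem_singleton_iff]
    constructor
    · rintro ⟨h, h1 | h1 | h1⟩
      · exact Or.inl h1
      · exact Or.inr h1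
      · linarith
    · rintro (rfl | rfl)
      · exact ⟨ha0, Or.inl rfl⟩
      · exact ⟨ha0.trans hac, Or.inr (Or.inl rfl)⟩
  have hH : rH Λ m = a := by
    rw [rH, pos_set, csInf_pair]; exact inf_eq_left.2 hac.le
  have hC : rC Λ m = c := by
    rw [rC, pos_set, csSup_pair]; exact sup_eq_right.2 hac.le
  have hN : sInf {r : ℝ | horizonCubic Λ m r = 0} = -(a + c) := by
    apply IsLeast.csInf_eq
    refine ⟨(zero_iff _).2 (Or.inr (Or.inr rfl)), fun r hr => ?_⟩
    rcases (zero_iff r).1 hr with h | h | h <;> linarith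
  refine ⟨hΛ, hH ▸ ha0, by rw [hH, hC]; exact hac, ?_⟩
  rw [rNeg, hN, abs_pos]
  linarith

namespace Subextremal

variable {Λ m : ℝ} (hS : Subextremal Λ m)
include hS

theorem rC_pos : 0 < rC Λ m := hS.rH_pos.trans hS.rH_lt_rC

theorem kappa_pos : 0 < kappa Λ m := by
  have h1 := hS.lambda_pos; have h2 := hS.rC_pos; have h3 := hS.rNeg_pos
  have h4 : 0 < rC Λ m - rH Λ m := sub_pos.2 hS.rH_lt_rC
  unfold kappa; positivity

theorem expH_pos : 0 < expH Λ m := by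
  have h2 := hS.rC_pos; have h3 := hS.rNeg_pos; have h1 := hS.rH_pos
  unfold expH; positivity

theorem expNeg_pos : 0 < expNeg Λ m := by
  have h2 := hS.rC_pos; have h3 := hS.rNeg_pos; have h1 := hS.rH_pos
  have h4 : 0 < rC Λ m - rH Λ m := sub_pos.2 hS.rH_lt_rC
  unfold expNeg; positivity

/-- This makes numerator and denominator of `uvOfRadius` grow at the same rate, so that `r = ∞`
corresponds to `u v = 1`. -/
theorem expH_add_expNeg : expH Λ m + expNeg Λ m = 1 := by
  have h2 := hS.rC_pos; have h3 := hS.rNeg_pos; have h1 := hS.rH_pos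
  have : rH Λ m + rNeg Λ m ≠ 0 := by positivity
  have : rNeg Λ m + rH Λ m ≠ 0 := by positivity
  unfold expH expNeg; field_simp; ring

end Subextremal

/-! ### The area radius as a function of `u v` -/

noncomputable section

/-- The derivative of `uvOfRadius`. -/
def uvDeriv (Λ m r : ℝ) : ℝ :=
  (rC Λ m - rH Λ m) * (rC Λ m + rNeg Λ m) / rC Λ m * r /
    ((r - rH Λ m) ^ (1 + expH Λ m) * (r + rNeg Λ m) ^ (1 + expNeg Λ m))

/-- The inverse function of `uvOfRadius`. -/
def areaRadius (Λ m w : ℝ) : ℝ := Function.invFunOn (uvOfRadius Λ m) (Ioi (rH Λ m)) w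

theorem radius_eq (Λ m : ℝ) (q : ℝ × ℝ) : radius Λ m q = areaRadius Λ m (q.1 * q.2) := rfl

end

namespace Subextremal

variable {Λ m : ℝ} (hS : Subextremal Λ m)
include hS

theorem uvDeriv_pos {r : ℝ} (hr : rH Λ m < r) : 0 < uvDeriv Λ m r := by
  have h2 := hS.rC_pos; have h3 := hS.rNeg_pos; have h1 := hS.rH_pos
  have h4 : 0 < rC Λ m - rH Λ m := sub_pos.2 hS.rH_lt_rC
  have h5 : 0 < r - rH Λ m := sub_pos.2 hr
  have h6 : 0 < r := h1.trans hr
  unfold uvDeriv; positivity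

theorem contDiffAt_uvOfRadius {r : ℝ} (hr : rH Λ m < r) {n : WithTop ℕ∞} :
    ContDiffAt ℝ n (uvOfRadius Λ m) r := by
  have h3 := hS.rNeg_pos; have h1 := hS.rH_pos
  have h5 : 0 < r - rH Λ m := sub_pos.2 hr
  have h6 : 0 < r + rNeg Λ m := by linarith
  unfold uvOfRadius
  refine ContDiffAt.div (by fun_prop) (ContDiffAt.mul ?_ ?_) (by positivity)
  · exact ContDiffAt.rpow_const_of_ne (by fun_prop) h5.ne'
  · exact ContDiffAt.rpow_const_of_ne (by fun_prop) h6.ne'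

/-- The exponents are the partial fraction coefficients for which the logarithmic derivative, over
the common denominator, has a numerator that is a constant multiple of `r`: its quadratic and
constant terms cancel. Monotonicity of `uvOfRadius` is then visible from the sign. -/
theorem hasDerivAt_uvOfRadius {r : ℝ} (hr : rH Λ m < r) :
    HasDerivAt (uvOfRadius Λ m) (uvDeriv Λ m r) r := by
  have h2 := hS.rC_pos; have h3 := hS.rNeg_pos; have h1 := hS.rH_pos
  have h5 : 0 < r - rH Λ m := sub_pos.2 hr
  have h6 : 0 < r + rNeg Λ m := by linarith
  have d1 : HasDerivAt (fun r => (r - rH Λ m) ^ expH Λ m)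
      (1 * expH Λ m * (r - rH Λ m) ^ (expH Λ m - 1)) r :=
    ((hasDerivAt_id r).sub_const _).rpow_const (Or.inl h5.ne')
  have d2 : HasDerivAt (fun r => (r + rNeg Λ m) ^ expNeg Λ m)
      (1 * expNeg Λ m * (r + rNeg Λ m) ^ (expNeg Λ m - 1)) r :=
    ((hasDerivAt_id r).add_const _).rpow_const (Or.inl h6.ne')
  have d := ((hasDerivAt_id r).sub_const (rC Λ m)).div (d1.mul d2)
    (mul_pos (Real.rpow_pos_of_pos h5 _) (Real.rpow_pos_of_pos h6 _)).ne'
  refine d.congr_deriv ?_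
  rw [uvDeriv, Real.rpow_sub_one h5.ne', Real.rpow_sub_one h6.ne', Real.rpow_one_add' h5.le
    (by have := hS.expH_pos; positivity), Real.rpow_one_add' h6.le
    (by have := hS.expNeg_pos; positivity)]
  have p1 : 0 < (r - rH Λ m) ^ expH Λ m := by positivity
  have p2 : 0 < (r + rNeg Λ m) ^ expNeg Λ m := by positivity
  simp only [Pi.mul_apply, id]
  generalize (r - rH Λ m) ^ expH Λ m = P at *
  generalize (r + rNeg Λ m) ^ expNeg Λ m = Q at *
  have h7 : rH Λ m + rNeg Λ m ≠ 0 := by positivity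
  have h8 : rNeg Λ m + rH Λ m ≠ 0 := by positivity
  unfold expH expNeg
  have h5' := h5.ne'
  have h6' := h6.ne'
  field_simp
  ring

theorem continuousOn_uvOfRadius : ContinuousOn (uvOfRadius Λ m) (Ioi (rH Λ m)) := fun _ hr =>
  (hS.hasDerivAt_uvOfRadius hr).continuousAt.continuousWithinAt

theorem strictMonoOn_uvOfRadius : StrictMonoOn (uvOfRadius Λ m) (Ioi (rH Λ m)) := by
  refine strictMonoOn_of_deriv_pos (convex_Ioi _) hS.continuousOn_uvOfRadius fun r hr => ?_
  rw [interior_Ioi] at hr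
  rw [(hS.hasDerivAt_uvOfRadius hr).deriv]
  exact hS.uvDeriv_pos hr

omit hS in
theorem uvOfRadius_rC : uvOfRadius Λ m (rC Λ m) = 0 := by simp [uvOfRadius]

/-- Since the exponents sum to `1`, the factor `r - rC` can be split into the same two powers. This
gives a product of powers of quotients that each tend to `1`. -/
theorem tendsto_uvOfRadius_atTop : Tendsto (uvOfRadius Λ m) atTop (𝓝 1) := by
  have key : ∀ a b : ℝ, Tendsto (fun r : ℝ => (r + a) / (r + b)) atTop (𝓝 1) := by
    intro a b
    have h : Tendsto (fun r : ℝ => 1 + (a - b) / (r + b)) atTop (𝓝 (1 + 0)) :=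
      tendsto_const_nhds.add (tendsto_const_nhds.div_atTop (tendsto_atTop_add_const_right _ _ tendsto_id))
    rw [add_zero] at h
    refine h.congr' ?_
    filter_upwards [eventually_gt_atTop (-b)] with r hr
    have : r + b ≠ 0 := by linarith
    field_simp; ring
  have t1 := (key (-rC Λ m) (-rH Λ m)).rpow_const (p := expH Λ m) (Or.inl one_ne_zero)
  have t2 := (key (-rC Λ m) (rNeg Λ m)).rpow_const (p := expNeg Λ m) (Or.inl one_ne_zero)
  have t := t1.mul t2
  simp only [Real.one_rpow, mul_one] at t
  refine t.congr' ?_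
  filter_upwards [eventually_gt_atTop (rC Λ m)] with r hr
  have h3 := hS.rNeg_pos; have h1 := hS.rH_pos; have h2 := hS.rH_lt_rC
  have p0 : 0 < r + -rC Λ m := by linarith
  have p1 : 0 < r + -rH Λ m := by linarith
  have p2 : 0 < r + rNeg Λ m := by linarith
  rw [Real.div_rpow p0.le p1.le, Real.div_rpow p0.le p2.le, div_mul_div_comm, ← Real.rpow_add p0,
    hS.expH_add_expNeg, Real.rpow_one]
  rfl

theorem tendsto_uvOfRadius_rH : Tendsto (uvOfRadius Λ m) (𝓝[>] (rH Λ m)) atBot := by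
  have h3 := hS.rNeg_pos; have h1 := hS.rH_pos; have h2 := hS.rH_lt_rC
  have p : 0 < rH Λ m + rNeg Λ m := by positivity
  have t1 : Tendsto (fun r => (r - rC Λ m) / (r + rNeg Λ m) ^ expNeg Λ m) (𝓝[>] (rH Λ m))
      (𝓝 ((rH Λ m - rC Λ m) / (rH Λ m + rNeg Λ m) ^ expNeg Λ m)) := by
    have : ContinuousAt (fun r => (r - rC Λ m) / (r + rNeg Λ m) ^ expNeg Λ m) (rH Λ m) := by
      refine ContinuousAt.div (by fun_prop) ?_ (by positivity)
      exact ContinuousAt.rpow_const (by fun_prop) (Or.inl p.ne')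
    exact this.tendsto.mono_left nhdsWithin_le_nhds
  have t2 : Tendsto (fun r => ((r - rH Λ m) ^ expH Λ m)⁻¹) (𝓝[>] (rH Λ m)) atTop := by
    refine Tendsto.inv_tendsto_nhdsGT_zero ?_
    refine tendsto_nhdsWithin_iff.2 ⟨?_, ?_⟩
    · have : ContinuousAt (fun r => (r - rH Λ m) ^ expH Λ m) (rH Λ m) :=
        ContinuousAt.rpow_const (by fun_prop) (Or.inr hS.expH_pos.le)
      have h := this.tendsto.mono_left (nhdsWithin_le_nhds (s := Ioi (rH Λ m)))
      simpa [Real.zero_rpow hS.expH_pos.ne'] using h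
    · filter_upwards [self_mem_nhdsWithin] with r hr
      have : 0 < r - rH Λ m := sub_pos.2 hr
      exact Real.rpow_pos_of_pos this _
  have t := t1.neg_mul_atTop (div_neg_of_neg_of_pos (by linarith) (by positivity)) t2
  refine t.congr fun r => ?_
  unfold uvOfRadius
  rw [div_mul_eq_mul_div, mul_comm (_ ^ expH Λ m), ← div_div, div_eq_mul_inv (_ / _),
    div_mul_eq_mul_div]

theorem exists_uvOfRadius_eq {w : ℝ} (hw : w < 1) : ∃ r ∈ Ioi (rH Λ m), uvOfRadius Λ m r = w := by
  obtain ⟨a, ha, ha'⟩ : ∃ a, rH Λ m < a ∧ uvOfRadius Λ m a < w := by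
    have := (hS.tendsto_uvOfRadius_rH.eventually_lt_atBot w).and self_mem_nhdsWithin
    obtain ⟨a, h1, h2⟩ := this.exists
    exact ⟨a, h2, h1⟩
  obtain ⟨b, hb, hb'⟩ : ∃ b, rH Λ m < b ∧ w < uvOfRadius Λ m b := by
    have := (hS.tendsto_uvOfRadius_atTop.eventually (lt_mem_nhds hw)).and
      (eventually_gt_atTop (rH Λ m))
    obtain ⟨a, h1, h2⟩ := this.exists
    exact ⟨a, h2, h1⟩
  have := isPreconnected_Ioi.intermediate_value (show a ∈ Ioi (rH Λ m) from ha)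
    (show b ∈ Ioi (rH Λ m) from hb) hS.continuousOn_uvOfRadius
  exact this ⟨ha'.le, hb'.le⟩

theorem rH_lt_areaRadius {w : ℝ} (hw : w < 1) : rH Λ m < areaRadius Λ m w :=
  Function.invFunOn_mem (hS.exists_uvOfRadius_eq hw)

theorem uvOfRadius_areaRadius {w : ℝ} (hw : w < 1) : uvOfRadius Λ m (areaRadius Λ m w) = w :=
  Function.invFunOn_eq (hS.exists_uvOfRadius_eq hw)

theorem areaRadius_pos {w : ℝ} (hw : w < 1) : 0 < areaRadius Λ m w :=
  hS.rH_pos.trans (hS.rH_lt_areaRadius hw)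

theorem areaRadius_uvOfRadius {r : ℝ} (hr : rH Λ m < r) :
    areaRadius Λ m (uvOfRadius Λ m r) = r :=
  have h : ∃ r' ∈ Ioi (rH Λ m), uvOfRadius Λ m r' = uvOfRadius Λ m r := ⟨r, hr, rfl⟩
  hS.strictMonoOn_uvOfRadius.injOn (Function.invFunOn_mem h) hr (Function.invFunOn_eq h)

theorem areaRadius_zero : areaRadius Λ m 0 = rC Λ m := by
  rw [← uvOfRadius_rC, hS.areaRadius_uvOfRadius hS.rH_lt_rC]

theorem strictMonoOn_areaRadius : StrictMonoOn (areaRadius Λ m) (Iio 1) := fun a ha b hb hab => by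
  rw [← hS.strictMonoOn_uvOfRadius.lt_iff_lt (hS.rH_lt_areaRadius ha) (hS.rH_lt_areaRadius hb),
    hS.uvOfRadius_areaRadius ha, hS.uvOfRadius_areaRadius hb]
  exact hab

/-- The inverse function theorem supplies a smooth local inverse. Near `w` its values stay above
`rH`, where `uvOfRadius` is injective, so it coincides with `areaRadius`. -/
theorem contDiffAt_areaRadius {w : ℝ} (hw : w < 1) : ContDiffAt ℝ (⊤ : ℕ∞) (areaRadius Λ m) w := by
  have hr := hS.rH_lt_areaRadius hw
  set r := areaRadius Λ m w with hrdef
  have hc := hS.contDiffAt_uvOfRadius hr (n := ((⊤ : ℕ∞) : WithTop ℕ∞))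
  have hd' := hS.hasDerivAt_uvOfRadius hr
  have hpos := (hS.uvDeriv_pos hr).ne'
  have hd : HasFDerivAt (uvOfRadius Λ m)
      (ContinuousLinearEquiv.unitsEquivAut ℝ (Units.mk0 _ hpos) : ℝ →L[ℝ] ℝ) r := by
    refine hd'.hasFDerivAt.congr_fderiv ?_
    ext; simp
  have hn : ((⊤ : ℕ∞) : WithTop ℕ∞) ≠ 0 := by simp
  set e := hc.toOpenPartialHomeomorph _ hd hn with he
  have hsm := hc.to_localInverse hd hn
  rw [hS.uvOfRadius_areaRadius hw] at hsm
  refine hsm.congr_of_eventuallyEq ?_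
  have himg := ContDiffAt.image_mem_toOpenPartialHomeomorph_target hc hd hn
  rw [hS.uvOfRadius_areaRadius hw] at himg
  have hg0 : hc.localInverse hd hn w = r := by
    have := hc.localInverse_apply_image hd hn
    rwa [hS.uvOfRadius_areaRadius hw] at this
  have h1 : ∀ᶠ w' in 𝓝 w, uvOfRadius Λ m (hc.localInverse hd hn w') = w' := by
    filter_upwards [e.open_target.mem_nhds himg] with w' hw'
    exact e.right_inv hw'
  have h2 : ∀ᶠ w' in 𝓝 w, rH Λ m < hc.localInverse hd hn w' :=
    hsm.continuousAt.eventually (by rw [hg0]; exact lt_mem_nhds hr)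
  filter_upwards [h1, h2] with w' e1 e2
  rw [← hS.areaRadius_uvOfRadius e2, e1]

theorem hasDerivAt_areaRadius {w : ℝ} (hw : w < 1) :
    HasDerivAt (areaRadius Λ m) (uvDeriv Λ m (areaRadius Λ m w))⁻¹ w := by
  refine HasDerivAt.of_local_left_inverse (f := uvOfRadius Λ m)
    (hS.contDiffAt_areaRadius hw).continuousAt (hS.hasDerivAt_uvOfRadius (hS.rH_lt_areaRadius hw))
    (hS.uvDeriv_pos (hS.rH_lt_areaRadius hw)).ne' ?_
  filter_upwards [gt_mem_nhds hw] with w' hw'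
  exact hS.uvOfRadius_areaRadius hw'

theorem deriv_areaRadius_pos {w : ℝ} (hw : w < 1) : 0 < deriv (areaRadius Λ m) w := by
  rw [(hS.hasDerivAt_areaRadius hw).deriv]
  exact inv_pos.2 (hS.uvDeriv_pos (hS.rH_lt_areaRadius hw))

/-- The powers in `Ω²` are those of `1 / uvDeriv`. Every metric coefficient, and the Christoffel
symbols with it, is thereby expressed through `areaRadius` and its derivatives at `u v`. -/
theorem omegaSq_eq {q : ℝ × ℝ} (hq : q.1 * q.2 < 1) :
    omegaSq Λ m q = 2 / kappa Λ m * deriv (areaRadius Λ m) (q.1 * q.2) := by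
  rw [(hS.hasDerivAt_areaRadius hq).deriv, omegaSq, radius_eq]
  have h1 := hS.rH_lt_areaRadius hq
  set r := areaRadius Λ m (q.1 * q.2)
  have p0 := hS.lambda_pos; have p1 := hS.rH_pos; have p2 := hS.rC_pos; have p3 := hS.rNeg_pos
  have p4 : rC Λ m - rH Λ m ≠ 0 := (sub_pos.2 hS.rH_lt_rC).ne'
  have p5 : 0 < r - rH Λ m := sub_pos.2 h1
  have p6 : r ≠ 0 := by linarith
  have p7 : 0 < r + rNeg Λ m := by linarith
  have p8 : 0 < (r - rH Λ m) ^ (1 + expH Λ m) := by positivity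
  have p9 : 0 < (r + rNeg Λ m) ^ (1 + expNeg Λ m) := by positivity
  have p10 : rC Λ m + rNeg Λ m ≠ 0 := by positivity
  unfold uvDeriv kappa
  field_simp
  norm_num

theorem omegaSq_pos {q : ℝ × ℝ} (hq : q.1 * q.2 < 1) : 0 < omegaSq Λ m q := by
  rw [hS.omegaSq_eq hq]
  have := hS.kappa_pos; have := hS.deriv_areaRadius_pos hq
  positivity

end Subextremal
end SchwarzschildDeSitter

namespace SchwarzschildDeSitter

/-! ### Smooth solutions of autonomous differential equations -/

/-- Picard–Lindelöf gives a differentiable curve; its smoothness follows by bootstrapping in the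
equation as long as the curve stays where the field is smooth. -/
theorem exists_contDiffOn_integralCurve {E : Type*} [NormedAddCommGroup E] [NormedSpace ℝ E]
    [CompleteSpace E] {F : E → E} {u : Set E} (hu : IsOpen u) {x₀ : E} (hx : x₀ ∈ u)
    (hF : ContDiffOn ℝ (⊤ : ℕ∞) F u) :
    ∃ α : ℝ → E, α 0 = x₀ ∧ ∃ ε > 0, (∀ t ∈ Ioo (-ε) ε, α t ∈ u ∧ HasDerivAt α (F (α t)) t) ∧
      ContDiffOn ℝ (⊤ : ℕ∞) α (Ioo (-ε) ε) := by
  have h1 : ContDiffAt ℝ 1 F x₀ := (hF.contDiffAt (hu.mem_nhds hx)).of_le (by norm_cast)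
  obtain ⟨α, hα0, ε, hε, hα⟩ :=
    h1.exists_forall_mem_closedBall_exists_eq_forall_mem_Ioo_hasDerivAt₀ 0
  simp only [zero_sub, zero_add] at hα
  have hc : ContinuousAt α 0 := (hα 0 ⟨by linarith, hε⟩).continuousAt
  obtain ⟨η, hη, hηu⟩ := Metric.eventually_nhds_iff.1
    (hc.eventually (by rw [hα0]; exact hu.mem_nhds hx))
  -- Halving leaves a closed interval on which the curve both solves the equation and remains in
  -- `u`; the regularity theorem is stated on closed intervals.
  set d := min ε η / 2 with hd
  have hd0 : 0 < d := by positivity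
  have hdε : d < ε := by have := min_le_left ε η; linarith
  have hdη : d < η := by have := min_le_right ε η; linarith
  have hmem : ∀ t ∈ Icc (-d) d, α t ∈ u := fun t ht => hηu (by
    rw [Real.dist_eq, sub_zero]; exact (abs_le.2 ht).trans_lt hdη)
  have hder : ∀ t ∈ Icc (-d) d, HasDerivAt α (F (α t)) t := fun t ht =>
    hα t ⟨by linarith [ht.1], by linarith [ht.2]⟩
  refine ⟨α, hα0, d, hd0, fun t ht => ⟨hmem t (Ioo_subset_Icc_self ht),
    hder t (Ioo_subset_Icc_self ht)⟩, ?_⟩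
  have := ODE.contDiffOn_enat_Icc_of_hasDerivWithinAt (f := fun _ => F) (n := ⊤) (u := u)
    (tmin := -d) (tmax := d) (α := α) (hF.comp contDiffOn_snd fun p hp => hp.2)
    (fun t ht => (hder t ht).hasDerivWithinAt) hmem
  exact this.mono Ioo_subset_Icc_self

/-! ### The redshift field as a solution of an ordinary differential equation in `w = u v` -/

noncomputable section

/-- The logarithmic derivative of the conformal factor, as a function of `u v`. -/
def logDerivOmega (Λ m w : ℝ) : ℝ := deriv (deriv (areaRadius Λ m)) w / deriv (areaRadius Λ m) w

/-- The vector field `u A(u v) ∂_u + u⁻¹ B(u v) ∂_v`; these are the fields that commute with `T`. -/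
def profileField (A B : ℝ → ℝ) (q : ℝ × ℝ) : ℝ × ℝ := (q.1 * A (q.1 * q.2), B (q.1 * q.2) / q.1)

/-- The functions `a`, `c` are the components of a redshift vector field `profileField a c`. -/
structure IsRedshiftProfile (Λ m σ δ : ℝ) (a c : ℝ → ℝ) : Prop where
  smooth_fst : ContDiffOn ℝ (⊤ : ℕ∞) a (Ioo (-δ) δ)
  smooth_snd : ContDiffOn ℝ (⊤ : ℕ∞) c (Ioo (-δ) δ)
  fst_zero : a 0 = 0
  snd_zero : c 0 = 2 / deriv (areaRadius Λ m) 0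
  eq_fst : ∀ w ∈ Ioo (-δ) δ, deriv a w * (w * a w + c w) =
    -σ * (a w + kappa Λ m) - a w ^ 2 - w * logDerivOmega Λ m w * a w ^ 2
  eq_snd : ∀ w ∈ Ioo (-δ) δ, deriv c w * (w * a w + c w) =
    -σ * (c w - kappa Λ m * w) + c w * a w - logDerivOmega Λ m w * c w ^ 2

end

namespace Subextremal

variable {Λ m : ℝ} (hS : Subextremal Λ m)
include hS

theorem contDiffOn_areaRadius : ContDiffOn ℝ (⊤ : ℕ∞) (areaRadius Λ m) (Iio 1) := fun _ hw =>
  (hS.contDiffAt_areaRadius hw).contDiffWithinAt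

theorem contDiffOn_deriv_areaRadius :
    ContDiffOn ℝ (⊤ : ℕ∞) (deriv (areaRadius Λ m)) (Iio 1) :=
  hS.contDiffOn_areaRadius.deriv_of_isOpen isOpen_Iio (by simp)

theorem contDiffOn_logDerivOmega : ContDiffOn ℝ (⊤ : ℕ∞) (logDerivOmega Λ m) (Iio 1) :=
  (hS.contDiffOn_deriv_areaRadius.deriv_of_isOpen isOpen_Iio (by simp)).div
    hS.contDiffOn_deriv_areaRadius fun _ hw => (hS.deriv_areaRadius_pos hw).ne'

/-- The derivatives enter only through the factor `w a + c`, which at `w = 0` equals `c 0 = 2 /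
(dr/dw) > 0`. Where it is positive one may divide by it and obtain a smooth explicit system;
adjoining `w` as a first coordinate makes it autonomous. -/
theorem exists_isRedshiftProfile (σ : ℝ) :
    ∃ δ, 0 < δ ∧ δ < 1 ∧ ∃ a c, IsRedshiftProfile Λ m σ δ a c := by
  set u : Set (ℝ × ℝ × ℝ) := {z | z.1 < 1 ∧ 0 < z.1 * z.2.1 + z.2.2} with hudef
  have hu : IsOpen u := by
    have h1 : IsOpen {z : ℝ × ℝ × ℝ | z.1 < 1} := isOpen_lt (by fun_prop) (by fun_prop)
    have h2 : IsOpen {z : ℝ × ℝ × ℝ | 0 < z.1 * z.2.1 + z.2.2} :=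
      isOpen_lt (by fun_prop) (by fun_prop)
    exact h1.inter h2
  set F : ℝ × ℝ × ℝ → ℝ × ℝ × ℝ := fun z => (1,
    (-σ * (z.2.1 + kappa Λ m) - z.2.1 ^ 2 - z.1 * logDerivOmega Λ m z.1 * z.2.1 ^ 2) /
      (z.1 * z.2.1 + z.2.2),
    (-σ * (z.2.2 - kappa Λ m * z.1) + z.2.2 * z.2.1 - logDerivOmega Λ m z.1 * z.2.2 ^ 2) /
      (z.1 * z.2.1 + z.2.2)) with hFdef
  have hl : ContDiffOn ℝ (⊤ : ℕ∞) (fun z : ℝ × ℝ × ℝ => logDerivOmega Λ m z.1) u :=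
    hS.contDiffOn_logDerivOmega.comp contDiffOn_fst fun z hz => hz.1
  have hF : ContDiffOn ℝ (⊤ : ℕ∞) F u := by
    refine contDiffOn_const.prodMk (ContDiffOn.prodMk ?_ ?_)
    · exact ContDiffOn.div (by fun_prop) (by fun_prop) fun z hz => hz.2.ne'
    · exact ContDiffOn.div (by fun_prop) (by fun_prop) fun z hz => hz.2.ne'
  have hR := hS.deriv_areaRadius_pos (w := 0) one_pos
  have hx : ((0 : ℝ), (0 : ℝ), 2 / deriv (areaRadius Λ m) 0) ∈ u := by
    refine ⟨one_pos, ?_⟩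
    simp only [zero_mul, zero_add]; positivity
  obtain ⟨α, hα0, ε, hε, hα, hsm⟩ := exists_contDiffOn_integralCurve hu hx hF
  set δ := min ε (1 / 2) with hδ
  have hδ0 : 0 < δ := by positivity
  have hδε : δ ≤ ε := min_le_left _ _
  have hsub : Ioo (-δ) δ ⊆ Ioo (-ε) ε := Ioo_subset_Ioo (by linarith) hδε
  -- The adjoined coordinate has derivative `1` and vanishes at `0`, so it is the curve parameter
  -- itself.
  have hfst : ∀ t ∈ Ioo (-ε) ε, (α t).1 = t := by
    have hd : ∀ t ∈ Ioo (-ε) ε, HasDerivAt (fun t => (α t).1 - t) 0 t := fun t ht => by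
      have h1 : HasDerivAt (fun t => (α t).1) 1 t := 
        (ContinuousLinearMap.fst ℝ ℝ (ℝ × ℝ)).hasFDerivAt.comp_hasDerivAt t (hα t ht).2
      simpa using h1.fun_sub (hasDerivAt_id' t)
    intro t ht
    have h := (convex_Ioo (-ε) ε).is_const_of_fderivWithin_eq_zero (𝕜 := ℝ)
      (f := fun t => (α t).1 - t) (fun t ht => (hd t ht).differentiableAt.differentiableWithinAt)
      (fun t ht => by
        rw [fderivWithin_of_isOpen isOpen_Ioo ht, (hd t ht).hasFDerivAt.fderiv]; ext; simp)
      ht (show (0 : ℝ) ∈ Ioo (-ε) ε from ⟨by linarith, hε⟩)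
    simp only [hα0, sub_zero] at h
    linarith
  refine ⟨δ, hδ0, (min_le_right _ _).trans_lt (by norm_num), fun t => (α t).2.1,
    fun t => (α t).2.2, ⟨?_, ?_, by simp [hα0], by simp [hα0], ?_, ?_⟩⟩
  · exact (contDiff_fst.comp contDiff_snd).comp_contDiffOn (hsm.mono hsub)
  · exact (contDiff_snd.comp contDiff_snd).comp_contDiffOn (hsm.mono hsub)
  · intro w hw
    obtain ⟨h1, h2⟩ := hα w (hsub hw)
    have h4 : HasDerivAt (fun t => (α t).2.1) (F (α w)).2.1 w :=
      ((ContinuousLinearMap.fst ℝ ℝ ℝ).comp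
        (ContinuousLinearMap.snd ℝ ℝ (ℝ × ℝ))).hasFDerivAt.comp_hasDerivAt w h2
    rw [h4.deriv]
    have h3 := h1.2
    simp only [hFdef]
    rw [hfst w (hsub hw)] at h3 ⊢
    exact div_mul_cancel₀ _ h3.ne'
  · intro w hw
    obtain ⟨h1, h2⟩ := hα w (hsub hw)
    have h4 : HasDerivAt (fun t => (α t).2.2) (F (α w)).2.2 w :=
      ((ContinuousLinearMap.snd ℝ ℝ ℝ).comp
        (ContinuousLinearMap.snd ℝ ℝ (ℝ × ℝ))).hasFDerivAt.comp_hasDerivAt w h2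
    rw [h4.deriv]
    have h3 := h1.2
    simp only [hFdef]
    rw [hfst w (hsub hw)] at h3 ⊢
    exact div_mul_cancel₀ _ h3.ne'

end Subextremal

/-! ### Calculus of the fields that commute with `T` -/

theorem hasFDerivAt_mul_pair (q : ℝ × ℝ) : HasFDerivAt (fun q : ℝ × ℝ => q.1 * q.2)
    (q.1 • ContinuousLinearMap.snd ℝ ℝ ℝ + q.2 • ContinuousLinearMap.fst ℝ ℝ ℝ) q :=
  hasFDerivAt_fst.mul hasFDerivAt_snd

theorem hasFDerivAt_comp_mul_pair {f : ℝ → ℝ} {f' : ℝ} {q : ℝ × ℝ}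
    (hf : HasDerivAt f f' (q.1 * q.2)) : HasFDerivAt (fun q : ℝ × ℝ => f (q.1 * q.2))
    (f' • (q.1 • ContinuousLinearMap.snd ℝ ℝ ℝ + q.2 • ContinuousLinearMap.fst ℝ ℝ ℝ)) q :=
  hf.comp_hasFDerivAt q (hasFDerivAt_mul_pair q)

theorem fderiv_profileField {A B : ℝ → ℝ} {A' B' : ℝ} {q : ℝ × ℝ} (hq : q.1 ≠ 0)
    (hA : HasDerivAt A A' (q.1 * q.2)) (hB : HasDerivAt B B' (q.1 * q.2)) (X : ℝ × ℝ) :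
    fderiv ℝ (profileField A B) q X =
      (X.1 * A (q.1 * q.2) + q.1 * (A' * (q.1 * X.2 + q.2 * X.1)),
        B' * (q.1 * X.2 + q.2 * X.1) / q.1 - B (q.1 * q.2) * X.1 / q.1 ^ 2) := by
  have h1 := hasFDerivAt_comp_mul_pair hA
  have h2 := hasFDerivAt_comp_mul_pair hB
  have hi : HasFDerivAt (fun q : ℝ × ℝ => q.1⁻¹) (-(q.1 ^ 2)⁻¹ • ContinuousLinearMap.fst ℝ ℝ ℝ) q :=
    (hasDerivAt_inv hq).comp_hasFDerivAt q hasFDerivAt_fst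
  have h := ((hasFDerivAt_fst (p := q)).mul h1).prodMk (h2.mul hi)
  have : HasFDerivAt (profileField A B) _ q := h
  rw [this.fderiv]
  ext <;> simp <;> field_simp <;> ring

theorem killingT_eq_profileField {Λ m : ℝ} {q : ℝ × ℝ} (hq : q.1 ≠ 0) :
    killingT Λ m q = profileField (fun _ => kappa Λ m) (fun w => -(kappa Λ m * w)) q := by
  ext
  · simp [killingT, profileField, mul_comm]
  · simp only [killingT, profileField]; field_simp

theorem fieldN_profileField {Λ m : ℝ} {a c : ℝ → ℝ} {q : ℝ × ℝ} (hq : q.1 ≠ 0) :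
    fieldN Λ m (profileField a c) q =
      profileField (fun w => kappa Λ m + a w) (fun w => c w - kappa Λ m * w) q := by
  ext
  · simp [fieldN, killingT, profileField]; ring
  · simp only [fieldN, killingT, profileField, Prod.snd_add]; field_simp; ring

theorem fieldN_profileField_eventuallyEq {Λ m : ℝ} {a c : ℝ → ℝ} {q : ℝ × ℝ} (hq : q.1 ≠ 0) :
    fieldN Λ m (profileField a c) =ᶠ[𝓝 q]
      profileField (fun w => kappa Λ m + a w) (fun w => c w - kappa Λ m * w) := by
  filter_upwards [(continuous_fst.continuousAt (x := q)).eventually_ne hq] with q' hq'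
  exact fieldN_profileField hq'

theorem eventually_mul_lt_one {q : ℝ × ℝ} (hq : q.1 * q.2 < 1) :
    ∀ᶠ q' : ℝ × ℝ in 𝓝 q, q'.1 * q'.2 < 1 :=
  (continuous_fst.mul continuous_snd).continuousAt.eventually (gt_mem_nhds hq)

namespace Subextremal

variable {Λ m : ℝ} (hS : Subextremal Λ m)
include hS

theorem hasDerivAt_deriv_areaRadius {w : ℝ} (hw : w < 1) :
    HasDerivAt (deriv (areaRadius Λ m)) (deriv (deriv (areaRadius Λ m)) w) w :=
  ((hS.contDiffOn_deriv_areaRadius.contDiffAt (isOpen_Iio.mem_nhds hw)).differentiableAt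
    (by simp)).hasDerivAt

theorem hasDerivAt_areaRadius' {w : ℝ} (hw : w < 1) :
    HasDerivAt (areaRadius Λ m) (deriv (areaRadius Λ m) w) w :=
  (hS.hasDerivAt_areaRadius hw).differentiableAt.hasDerivAt

theorem hasFDerivAt_omegaSq {q : ℝ × ℝ} (hq : q.1 * q.2 < 1) :
    HasFDerivAt (omegaSq Λ m) ((omegaSq Λ m q * logDerivOmega Λ m (q.1 * q.2)) •
      (q.1 • ContinuousLinearMap.snd ℝ ℝ ℝ + q.2 • ContinuousLinearMap.fst ℝ ℝ ℝ)) q := by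
  have h := (hasFDerivAt_comp_mul_pair (hS.hasDerivAt_deriv_areaRadius hq)).const_mul
    (2 / kappa Λ m)
  have h2 : HasFDerivAt (omegaSq Λ m) _ q := h.congr_of_eventuallyEq
    (by filter_upwards [eventually_mul_lt_one hq] with q' hq' using hS.omegaSq_eq hq')
  refine h2.congr_fderiv ?_
  rw [hS.omegaSq_eq hq, smul_smul, logDerivOmega]
  congr 1
  have := (hS.deriv_areaRadius_pos hq).ne'
  field_simp

theorem fderiv_log_omegaSq {q : ℝ × ℝ} (hq : q.1 * q.2 < 1) (X : ℝ × ℝ) :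
    fderiv ℝ (fun q => Real.log (omegaSq Λ m q)) q X =
      logDerivOmega Λ m (q.1 * q.2) * (q.1 * X.2 + q.2 * X.1) := by
  rw [((hS.hasFDerivAt_omegaSq hq).log (hS.omegaSq_pos hq).ne').fderiv]
  have := (hS.omegaSq_pos hq).ne'
  simp; field_simp

theorem hasFDerivAt_radius {q : ℝ × ℝ} (hq : q.1 * q.2 < 1) :
    HasFDerivAt (radius Λ m) (deriv (areaRadius Λ m) (q.1 * q.2) •
      (q.1 • ContinuousLinearMap.snd ℝ ℝ ℝ + q.2 • ContinuousLinearMap.fst ℝ ℝ ℝ)) q :=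
  hasFDerivAt_comp_mul_pair (hS.hasDerivAt_areaRadius' hq)

theorem radius_pos {q : ℝ × ℝ} (hq : q.1 * q.2 < 1) : 0 < radius Λ m q := hS.areaRadius_pos hq

theorem radius_lt_iff {q : ℝ × ℝ} (hq : q.1 * q.2 < 1) {w : ℝ} (hw : w < 1) :
    radius Λ m q < areaRadius Λ m w ↔ q.1 * q.2 < w :=
  hS.strictMonoOn_areaRadius.lt_iff_lt hq hw

theorem lt_radius_iff {q : ℝ × ℝ} (hq : q.1 * q.2 < 1) {w : ℝ} (hw : w < 1) :
    areaRadius Λ m w < radius Λ m q ↔ w < q.1 * q.2 :=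
  hS.strictMonoOn_areaRadius.lt_iff_lt hw hq

/-- On functions of `u v` the field `Y` acts as `(w a + c) d/dw`. The components of `∇_Y Y`, after
removing the factors `u` and `u⁻¹`, are therefore the left sides of the profile equations together
with the Christoffel terms `logDerivOmega`. Commutation with `T` is automatic for this form of
field. -/
theorem isRedshiftField_of_profile {σ δ : ℝ} {a c : ℝ → ℝ} (hδ : 0 < δ) (hδ1 : δ < 1)
    (h : IsRedshiftProfile Λ m σ δ a c) :
    IsRedshiftField Λ m σ (areaRadius Λ m (-δ)) (areaRadius Λ m δ) (profileField a c) := by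
  have key : ∀ q : ℝ × ℝ, q.1 * q.2 < 1 → areaRadius Λ m (-δ) < radius Λ m q →
      radius Λ m q < areaRadius Λ m δ → q.1 * q.2 ∈ Ioo (-δ) δ := fun q hq h1 h2 =>
    ⟨(hS.lt_radius_iff hq (by linarith)).1 h1, (hS.radius_lt_iff hq hδ1).1 h2⟩
  have da : ∀ w ∈ Ioo (-δ) δ, HasDerivAt a (deriv a w) w := fun w hw =>
    ((h.smooth_fst.contDiffAt (isOpen_Ioo.mem_nhds hw)).differentiableAt (by simp)).hasDerivAt
  have dc : ∀ w ∈ Ioo (-δ) δ, HasDerivAt c (deriv c w) w := fun w hw =>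
    ((h.smooth_snd.contDiffAt (isOpen_Ioo.mem_nhds hw)).differentiableAt (by simp)).hasDerivAt
  refine ⟨?_, ?_, ?_, ?_⟩
  · have hmap : MapsTo (fun q : ℝ × ℝ => q.1 * q.2)
        {q | 0 < q.1 ∧ q.1 * q.2 < 1 ∧ areaRadius Λ m (-δ) < radius Λ m q ∧
          radius Λ m q < areaRadius Λ m δ} (Ioo (-δ) δ) :=
      fun q hq => key q hq.2.1 hq.2.2.1 hq.2.2.2
    have ha := h.smooth_fst.comp (contDiff_fst.mul contDiff_snd).contDiffOn hmap
    have hc := h.smooth_snd.comp (contDiff_fst.mul contDiff_snd).contDiffOn hmap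
    exact (contDiffOn_fst.mul ha).prodMk (hc.div contDiffOn_fst fun q hq => hq.1.ne')
  · intro u hu
    rw [(hS.hasFDerivAt_radius (q := (u, 0)) (by simp)).fderiv]
    simp only [profileField, mul_zero, h.fst_zero, h.snd_zero]
    ext
    · simp
    · simp [div_div]
  · intro q hu hq h1 h2
    have hw := key q hq h1 h2
    rw [covDeriv, fderiv_profileField hu.ne' (da _ hw) (dc _ hw), hS.fderiv_log_omegaSq hq,
      hS.fderiv_log_omegaSq hq]
    have e1 := h.eq_fst _ hw
    have e2 := h.eq_snd _ hw
    have hu' := hu.ne'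
    ext
    · simp only [profileField, killingT, Prod.fst_add, Prod.smul_fst, smul_eq_mul]
      generalize logDerivOmega Λ m (q.1 * q.2) = l at *
      field_simp
      linear_combination e1
    · simp only [profileField, killingT, Prod.snd_add, Prod.smul_snd, smul_eq_mul]
      generalize logDerivOmega Λ m (q.1 * q.2) = l at *
      field_simp
      linear_combination q.1 * e2
  · intro q hu hq h1 h2
    have hw := key q hq h1 h2
    have hT : fderiv ℝ (killingT Λ m) q = fderiv ℝ
        (profileField (fun _ => kappa Λ m) (fun w => -(kappa Λ m * w))) q := by
      apply Filter.EventuallyEq.fderiv_eq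
      filter_upwards [(continuous_fst.continuousAt (x := q)).eventually_ne hu.ne'] with q' hq'
      exact killingT_eq_profileField hq'
    rw [VectorField.lieBracket, hT, fderiv_profileField hu.ne' (da _ hw) (dc _ hw),
      fderiv_profileField hu.ne' (hasDerivAt_const _ _)
        (((hasDerivAt_id' _).const_mul (kappa Λ m)).fun_neg)]
    have hu' := hu.ne'
    ext
    · simp [profileField, killingT]; ring
    · simp [profileField, killingT]; field_simp; ring

/-! ### The bulk term -/

/-- Agreement of `N` with a profile field is required only near the point: `fieldN` of a profile
field has this form only away from `u = 0`. -/
theorem deformation_profileField {A B : ℝ → ℝ} {A' B' : ℝ} {N : ℝ × ℝ → ℝ × ℝ} {q : ℝ × ℝ}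
    (hu : q.1 ≠ 0) (hq : q.1 * q.2 < 1) (hN : N =ᶠ[𝓝 q] profileField A B)
    (hA : HasDerivAt A A' (q.1 * q.2)) (hB : HasDerivAt B B' (q.1 * q.2)) (X Z : ℝ × ℝ) :
    deformation Λ m N q X Z = -(omegaSq Λ m q / 4) *
      ((logDerivOmega Λ m (q.1 * q.2) * (q.1 * q.2 * A (q.1 * q.2) + B (q.1 * q.2)) +
          A (q.1 * q.2) + q.1 * q.2 * A' + B') * (X.1 * Z.2 + X.2 * Z.1) +
        2 * q.1 ^ 2 * A' * X.2 * Z.2 +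
        2 * (q.1 * q.2 * B' - B (q.1 * q.2)) / q.1 ^ 2 * X.1 * Z.1) := by
  have hg' : (fun q => gQ Λ m q X Z) =
      fun q => omegaSq Λ m q * (-(X.1 * Z.2 + X.2 * Z.1) / 2) := by
    funext q; unfold gQ; ring
  have hg := (hS.hasFDerivAt_omegaSq hq).mul_const (-(X.1 * Z.2 + X.2 * Z.1) / 2)
  rw [← hg'] at hg
  rw [deformation, hg.fderiv, hN.fderiv_eq, fderiv_profileField hu hA hB,
    fderiv_profileField hu hA hB, hN.self_of_nhds]
  simp [gQ, profileField]
  field_simp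
  ring

/-- In the rescaled derivatives `u ∂_u ψ` and `u⁻¹ ∂_v ψ` the powers of `u` disappear, as they must
for a field that commutes with `T`. Positivity becomes a question about functions of `w`. -/
theorem bulk_profileField {A B : ℝ → ℝ} {A' B' : ℝ} {N : ℝ × ℝ → ℝ × ℝ} {p : Point}
    (hu : p.1 ≠ 0) (hq : p.1 * p.2.1 < 1) (hN : N =ᶠ[𝓝 (toQ p)] profileField A B)
    (hA : HasDerivAt A A' (p.1 * p.2.1)) (hB : HasDerivAt B B' (p.1 * p.2.1)) (ψ : Point → ℝ) :
    bulk Λ m N ψ p =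
      2 / omegaSq Λ m (toQ p) * (-A' * (p.1 * dU ψ p) ^ 2 +
        (B (p.1 * p.2.1) - p.1 * p.2.1 * B') * (dV ψ p / p.1) ^ 2 +
        2 * (p.1 * p.2.1 * A (p.1 * p.2.1) + B (p.1 * p.2.1)) *
          (deriv (areaRadius Λ m) (p.1 * p.2.1) / areaRadius Λ m (p.1 * p.2.1)) *
          ((p.1 * dU ψ p) * (dV ψ p / p.1))) -
      1 / 2 * (logDerivOmega Λ m (p.1 * p.2.1) *
          (p.1 * p.2.1 * A (p.1 * p.2.1) + B (p.1 * p.2.1)) +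
          A (p.1 * p.2.1) + p.1 * p.2.1 * A' + B') *
        (sphereGradSq ψ p / areaRadius Λ m (p.1 * p.2.1) ^ 2) := by
  have hr : HasFDerivAt (fun q => radius Λ m q ^ 2) _ (toQ p) :=
    (hS.hasFDerivAt_radius (q := toQ p) hq).pow 2
  have hO := (hS.omegaSq_pos (q := toQ p) hq).ne'
  have hR := (hS.areaRadius_pos hq).ne'
  rw [bulk, hr.fderiv, hS.deformation_profileField (q := toQ p) hu hq hN hA hB,
    hS.deformation_profileField (q := toQ p) hu hq hN hA hB,
    hS.deformation_profileField (q := toQ p) hu hq hN hA hB, hN.self_of_nhds]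
  simp only [stress, gQ, gradSq, radius_eq]
  generalize omegaSq Λ m (toQ p) = O at *
  simp [profileField, toQ]
  generalize areaRadius Λ m (p.1 * p.2.1) = R at *
  generalize logDerivOmega Λ m (p.1 * p.2.1) = l at *
  generalize deriv (areaRadius Λ m) (p.1 * p.2.1) = R' at *
  field_simp
  ring

end Subextremal

/-! ### Coercivity near the horizon -/

/-- The decay rate of the redshift estimate. -/
noncomputable def decayRate (Λ m : ℝ) : ℝ := min (kappa Λ m / 2) (8 / (rC Λ m ^ 2 * kappa Λ m))

/-- Where `u v = w`, the multiplier `u A ∂_u + u⁻¹ B ∂_v` is timelike and its bulk term dominates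
`b` times its energy density on outgoing cones. Here `A'`, `B'` are the derivatives of `A`, `B`. -/
structure IsCoerciveAt (Λ m b w A B A' B' : ℝ) : Prop where
  fst_pos : 0 < A
  snd_pos : 0 < B
  quadratic : ∀ x y : ℝ, b * (B * y ^ 2) ≤ kappa Λ m * (-A' * x ^ 2 + (B - w * B') * y ^ 2 +
    2 * (w * A + B) * (deriv (areaRadius Λ m) w / areaRadius Λ m w) * (x * y))
  angular : b * A ≤ -kappa Λ m * (logDerivOmega Λ m w * (w * A + B) + A + w * A' + B')

/-- Multiply by `q` and complete the square. -/
theorem quadratic_nonneg {p q s : ℝ} (hq : 0 < q) (h : s ^ 2 ≤ p * q) (x y : ℝ) :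
    0 ≤ q * x ^ 2 + p * y ^ 2 + 2 * s * (x * y) := by
  have : 0 ≤ q * (q * x ^ 2 + p * y ^ 2 + 2 * s * (x * y)) := by
    nlinarith [sq_nonneg (q * x + s * y), mul_nonneg (sub_nonneg.2 h) (sq_nonneg y)]
  exact nonneg_of_mul_nonneg_right this hq

namespace Subextremal

variable {Λ m : ℝ} (hS : Subextremal Λ m)
include hS

theorem decayRate_pos : 0 < decayRate Λ m := by
  have := hS.kappa_pos; have := hS.rC_pos
  unfold decayRate; positivity

/-- All conditions hold strictly at `w = 0`, where the differential equations determine `a'` and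
`c'` algebraically, and all quantities involved are continuous; so they hold on a neighbourhood. The
functions `q`, `p`, `2 s` are the coefficients of `x²`, `y²`, `x y` after subtraction of `b B y²`.
-/
theorem exists_coercive_profile {σ : ℝ} (hσ : (2 / rC Λ m) ^ 2 * (2 / kappa Λ m) < σ) :
    ∃ δ, 0 < δ ∧ δ < 1 ∧ ∃ a c, IsRedshiftProfile Λ m σ δ a c ∧ ∀ w ∈ Ioo (-δ) δ,
      IsCoerciveAt Λ m (decayRate Λ m) w (kappa Λ m + a w) (c w - kappa Λ m * w) (deriv a w)
        (deriv c w - kappa Λ m) := by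
  obtain ⟨δ, hδ, hδ1, a, c, h⟩ := hS.exists_isRedshiftProfile σ
  have hk := hS.kappa_pos
  have hr := hS.rC_pos
  have hb1 : decayRate Λ m ≤ kappa Λ m / 2 := min_le_left _ _
  have hb2 : decayRate Λ m ≤ 8 / (rC Λ m ^ 2 * kappa Λ m) := min_le_right _ _
  have hσ' : 8 / (rC Λ m ^ 2 * kappa Λ m) < σ := by
    refine lt_of_eq_of_lt ?_ hσ
    field_simp; norm_num
  have hb := hS.decayRate_pos
  set b := decayRate Λ m
  set k := kappa Λ m
  have hσ0 : 0 < σ := lt_trans (by positivity) hσ'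
  have m0 : (0 : ℝ) ∈ Ioo (-δ) δ := ⟨by linarith, hδ⟩
  have nh : Ioo (-δ) δ ∈ 𝓝 (0 : ℝ) := isOpen_Ioo.mem_nhds m0
  have nh1 : Iio (1 : ℝ) ∈ 𝓝 (0 : ℝ) := isOpen_Iio.mem_nhds (by simp)
  have ca : ContinuousAt a 0 := (h.smooth_fst.continuousOn).continuousAt nh
  have cc : ContinuousAt c 0 := (h.smooth_snd.continuousOn).continuousAt nh
  have ca' : ContinuousAt (deriv a) 0 :=
    (h.smooth_fst.continuousOn_deriv_of_isOpen isOpen_Ioo (by simp)).continuousAt nh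
  have cc' : ContinuousAt (deriv c) 0 :=
    (h.smooth_snd.continuousOn_deriv_of_isOpen isOpen_Ioo (by simp)).continuousAt nh
  have cl : ContinuousAt (logDerivOmega Λ m) 0 :=
    hS.contDiffOn_logDerivOmega.continuousOn.continuousAt nh1
  have cr : ContinuousAt (areaRadius Λ m) 0 :=
    hS.contDiffOn_areaRadius.continuousOn.continuousAt nh1
  have cr' : ContinuousAt (deriv (areaRadius Λ m)) 0 :=
    hS.contDiffOn_deriv_areaRadius.continuousOn.continuousAt nh1
  have hr0 := hS.areaRadius_zero
  have hR : 0 < deriv (areaRadius Λ m) 0 := hS.deriv_areaRadius_pos one_pos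
  have ha0 := h.fst_zero
  have hc0 := h.snd_zero
  have hc0p : 0 < c 0 := by rw [hc0]; positivity
  -- At `w = 0` with `a 0 = 0` the profile equations lose all terms except these.
  have e1 : deriv a 0 = -σ * k / c 0 := by
    have := h.eq_fst 0 m0
    rw [ha0] at this
    rw [eq_div_iff hc0p.ne']; linear_combination this
  have e2 : deriv c 0 = -σ - logDerivOmega Λ m 0 * c 0 := by
    have := h.eq_snd 0 m0
    rw [ha0] at this
    apply mul_right_cancel₀ hc0p.ne'; linear_combination this
  set p : ℝ → ℝ := fun w =>
    k * (c w - k * w - w * (deriv c w - k)) - b * (c w - k * w) with hp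
  set q : ℝ → ℝ := fun w => -k * deriv a w with hq
  set s : ℝ → ℝ := fun w => k * (w * (k + a w) + (c w - k * w)) *
    (deriv (areaRadius Λ m) w / areaRadius Λ m w) with hs
  have E1 : ∀ᶠ w in 𝓝 (0 : ℝ), 0 < k + a w :=
    (continuousAt_const.add ca).eventually (lt_mem_nhds (by simpa [ha0] using hk))
  have E2 : ∀ᶠ w in 𝓝 (0 : ℝ), 0 < c w - k * w := by
    have : ContinuousAt (fun w => c w - k * w) 0 := by fun_prop
    exact this.eventually (lt_mem_nhds (by simpa using hc0p))
  have E3 : ∀ᶠ w in 𝓝 (0 : ℝ), 0 < q w := by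
    have : ContinuousAt q 0 := by fun_prop
    refine this.eventually (lt_mem_nhds ?_)
    have : q 0 = k * (σ * k / c 0) := by simp only [hq, e1]; ring
    rw [this]; positivity
  have E4 : ∀ᶠ w in 𝓝 (0 : ℝ), s w ^ 2 < p w * q w := by
    have h1 : ContinuousAt (fun w => s w ^ 2) 0 := by
      have h0 : ContinuousAt (fun w => deriv (areaRadius Λ m) w / areaRadius Λ m w) 0 :=
        ContinuousAt.div₀ cr' cr (by rw [hr0]; exact hr.ne')
      have h3 : ContinuousAt (fun w => k * (w * (k + a w) + (c w - k * w))) 0 := by fun_prop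
      exact (h3.mul h0).pow 2
    have h2 : ContinuousAt (fun w => p w * q w) 0 := by fun_prop
    refine h1.eventually_lt h2 ?_
    have f1 : s 0 = 2 * k / rC Λ m := by
      simp only [hs, ha0, hc0, hr0]; field_simp; ring
    have f2 : p 0 * q 0 = (k - b) * (k ^ 2 * σ) := by
      simp only [hp, hq, e1]; field_simp; ring
    rw [f1, f2]
    -- The only place where the full strength of the bound on `σ` is used: with `k - b ≥ k / 2` the
    -- discriminant condition is precisely `8 / (rC² k) < σ`.
    calc (2 * k / rC Λ m) ^ 2 = k / 2 * (k ^ 2 * (8 / (rC Λ m ^ 2 * k))) := by field_simp; norm_num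
      _ < k / 2 * (k ^ 2 * σ) := by gcongr
      _ ≤ (k - b) * (k ^ 2 * σ) := by gcongr; linarith
  -- At `w = 0` the `logDerivOmega` terms and the two copies of `k` cancel on the right, which
  -- leaves `b k < σ k`.
  have E5 : ∀ᶠ w in 𝓝 (0 : ℝ), b * (k + a w) < -k * (logDerivOmega Λ m w *
      (w * (k + a w) + (c w - k * w)) + (k + a w) + w * deriv a w + (deriv c w - k)) := by
    refine ContinuousAt.eventually_lt (by fun_prop) (by fun_prop) ?_
    rw [ha0, e2]
    have : b * k < σ * k := by gcongr; linarith
    linarith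
  obtain ⟨η, hη, hall⟩ := Metric.eventually_nhds_iff.1 (E1.and (E2.and (E3.and (E4.and E5))))
  refine ⟨min δ η, by positivity, (min_le_left _ _).trans_lt hδ1, a, c, ?_, ?_⟩
  · have hsub : Ioo (-min δ η) (min δ η) ⊆ Ioo (-δ) δ :=
      Ioo_subset_Ioo (neg_le_neg (min_le_left _ _)) (min_le_left _ _)
    exact ⟨h.smooth_fst.mono hsub, h.smooth_snd.mono hsub, ha0, hc0,
      fun w hw => h.eq_fst w (hsub hw), fun w hw => h.eq_snd w (hsub hw)⟩
  · intro w hw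
    obtain ⟨h1, h2, h3, h4, h5⟩ := hall (y := w) (by
      rw [Real.dist_eq, sub_zero]
      exact (abs_lt.2 hw).trans_le (min_le_right _ _))
    refine ⟨h1, h2, fun x y => ?_, h5.le⟩
    have := quadratic_nonneg h3 h4.le x y
    simp only [hp, hq, hs] at this
    linarith

end Subextremal

/-! ### Admissible radii -/

/-- The mixed term `∂_u ψ ∂_v ψ` cancels, so for future directed arguments the energy density is a
sum of squares with nonnegative coefficients: the dominant energy condition in explicit form. -/
theorem stress_scaled (Λ m : ℝ) (ψ : Point → ℝ) (p : Point) (hu : p.1 ≠ 0)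
    (hO : omegaSq Λ m (toQ p) ≠ 0) (X₁ X₂ Z₁ Z₂ : ℝ) :
    stress Λ m ψ p (p.1 * X₁, X₂ / p.1) (p.1 * Z₁, Z₂ / p.1) =
      X₁ * Z₁ * (p.1 * dU ψ p) ^ 2 + X₂ * Z₂ * (dV ψ p / p.1) ^ 2 +
        (X₁ * Z₂ + X₂ * Z₁) *
          (omegaSq Λ m (toQ p) / 4 * (sphereGradSq ψ p / radius Λ m (toQ p) ^ 2)) := by
  simp only [stress, gQ, gradSq]
  generalize sphereGradSq ψ p / radius Λ m (toQ p) ^ 2 = S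
  field_simp
  ring

theorem sphereGradSq_nonneg (ψ : Point → ℝ) (p : Point) : 0 ≤ sphereGradSq ψ p := sq_nonneg _

/-- Both coercivity inequalities have a nonnegative left side, so the quadratic part and the angular
part of the bulk term are nonnegative separately. -/
theorem IsCoerciveAt.bulk_nonneg {Λ m b : ℝ} (hS : Subextremal Λ m) (hb : 0 < b) {A B : ℝ → ℝ}
    {A' B' : ℝ} {N : ℝ × ℝ → ℝ × ℝ} {p : Point} (hu : p.1 ≠ 0) (hq : p.1 * p.2.1 < 1)
    (hN : N =ᶠ[𝓝 (toQ p)] profileField A B) (hA : HasDerivAt A A' (p.1 * p.2.1))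
    (hB : HasDerivAt B B' (p.1 * p.2.1))
    (h : IsCoerciveAt Λ m b (p.1 * p.2.1) (A (p.1 * p.2.1)) (B (p.1 * p.2.1)) A' B')
    (ψ : Point → ℝ) : 0 ≤ bulk Λ m N ψ p := by
  rw [hS.bulk_profileField hu hq hN hA hB ψ]
  have hk := hS.kappa_pos
  have h1 := h.quadratic (p.1 * dU ψ p) (dV ψ p / p.1)
  have h2 := h.angular
  have hO := hS.omegaSq_pos (q := toQ p) hq
  have p1 := h.fst_pos
  have p2 := h.snd_pos
  have q1 : 0 ≤ b * (B (p.1 * p.2.1) * (dV ψ p / p.1) ^ 2) := by positivity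
  have q2 : 0 < b * A (p.1 * p.2.1) := by positivity
  have r1 := nonneg_of_mul_nonneg_right (q1.trans h1) hk
  have r2 := nonneg_of_mul_nonneg_right
    (q2.le.trans (h2.trans_eq (neg_mul_comm (kappa Λ m) _))) hk
  have hS0 := sphereGradSq_nonneg ψ p
  refine sub_nonneg.2 (le_trans ?_ (mul_nonneg (by positivity) r1))
  have : 0 ≤ sphereGradSq ψ p / areaRadius Λ m (p.1 * p.2.1) ^ 2 := by positivity
  nlinarith [mul_nonneg r2 this]

theorem Subextremal.isRedshiftRadius {Λ m σ δ b r₀ : ℝ} (hS : Subextremal Λ m) {a c : ℝ → ℝ}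
    (hδ1 : δ < 1) (h : IsRedshiftProfile Λ m σ δ a c) (hb : 0 < b)
    (hc : ∀ w ∈ Ioo (-δ) δ, IsCoerciveAt Λ m b w (kappa Λ m + a w) (c w - kappa Λ m * w)
      (deriv a w) (deriv c w - kappa Λ m))
    (hr : rC Λ m < r₀) (hr' : r₀ < areaRadius Λ m δ) :
    IsRedshiftRadius Λ m (profileField a c) r₀ := by
  have key : ∀ p ∈ redshiftRegion Λ m r₀, p.1 * p.2.1 ∈ Ioo (-δ) δ := fun p hp => by
    have h1 := (hS.radius_lt_iff (q := toQ p) hp.2.2.1 hδ1).1 (hp.2.2.2.trans_lt hr')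
    have h2 : 0 ≤ p.1 * p.2.1 := mul_nonneg hp.1.le hp.2.1
    exact ⟨by simp only [toQ] at h1; linarith, h1⟩
  have da : ∀ w ∈ Ioo (-δ) δ, HasDerivAt a (deriv a w) w := fun w hw =>
    ((h.smooth_fst.contDiffAt (isOpen_Ioo.mem_nhds hw)).differentiableAt (by simp)).hasDerivAt
  have dc : ∀ w ∈ Ioo (-δ) δ, HasDerivAt c (deriv c w) w := fun w hw =>
    ((h.smooth_snd.contDiffAt (isOpen_Ioo.mem_nhds hw)).differentiableAt (by simp)).hasDerivAt
  refine ⟨hr, fun p hp => ?_, fun ψ p hp => ?_, ?_⟩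
  · have hw := hc _ (key p hp)
    have hO := hS.omegaSq_pos (q := toQ p) hp.2.2.1
    rw [fieldN_profileField (q := toQ p) hp.1.ne']
    have h1 : 0 < (profileField (fun w => kappa Λ m + a w) (fun w => c w - kappa Λ m * w)
        (toQ p)).1 := mul_pos hp.1 hw.fst_pos
    have h2 : 0 < (profileField (fun w => kappa Λ m + a w) (fun w => c w - kappa Λ m * w)
        (toQ p)).2 := div_pos hw.snd_pos hp.1
    refine ⟨?_, h1, h2⟩
    unfold gQ
    have := mul_pos hO (mul_pos h1 h2)
    linarith
  · have hw := hc _ (key p hp)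
    exact hw.bulk_nonneg hS hb hp.1.ne' hp.2.2.1
      (fieldN_profileField_eventuallyEq (q := toQ p) hp.1.ne')
      ((da _ (key p hp)).const_add _)
      ((dc _ (key p hp)).sub (((hasDerivAt_id' _).const_mul (kappa Λ m)).congr_deriv (mul_one _))) ψ
  · have hrH : rH Λ m < r₀ := hS.rH_lt_rC.trans hr
    set w := uvOfRadius Λ m r₀ with hwdef
    have hk := hS.kappa_pos
    set k := kappa Λ m with hk'
    set φ := lapse Λ m r₀ with hφ
    have hφ0 : 0 ≤ φ := by unfold φ lapse; positivity
    have hr0 : 0 < r₀ := hS.rC_pos.trans hr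
    -- On `r = r₀` the components of `M` are proportional to `1` and `w`, those of `N` to `A` and
    -- `B`. The sum `1 / A + w / B` makes both components of `C N - M` nonnegative, so its energy
    -- density is nonnegative. Invariance under `T` makes the constant uniform.
    refine ⟨1 / r₀ * φ ^ 2 * k * (1 / (k + a w) + w / (c w - k * w)), fun ψ p hp hpr => ?_⟩
    have hpw : p.1 * p.2.1 = w := by
      rw [hwdef, ← hpr, radius_eq]
      exact (hS.uvOfRadius_areaRadius hp.2.2.1).symm
    have hw0 : 0 ≤ w := hpw ▸ mul_nonneg hp.1.le hp.2.1
    have hco := hc _ (key p hp)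
    rw [hpw] at hco
    have hA := hco.fst_pos
    have hB := hco.snd_pos
    have hu := hp.1.ne'
    have hO := hS.omegaSq_pos (q := toQ p) hp.2.2.1
    have eM : fieldM Λ m (toQ p) =
        (p.1 * (1 / r₀ * φ ^ 2 * k), (1 / r₀ * φ ^ 2 * k * w) / p.1) := by
      rw [fieldM, hpr, gradR, ← hpw]
      ext
      · simp [toQ, φ, k]; ring
      · simp [toQ, φ, k]; field_simp
    have en : unitNormal Λ m (toQ p) = (p.1 * (φ * k), (φ * k * w) / p.1) := by
      rw [unitNormal, hpr, gradR, ← hpw]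
      ext
      · simp [toQ, φ, k]; ring
      · simp [toQ, φ, k]; field_simp
    have eN : fieldN Λ m (profileField a c) (toQ p) =
        (p.1 * (k + a w), (c w - k * w) / p.1) := by
      rw [fieldN_profileField (q := toQ p) hu]
      simp [profileField, toQ, hpw, k]
    rw [eM, en, eN, stress_scaled _ _ _ _ hu hO.ne', stress_scaled _ _ _ _ hu hO.ne']
    have hSn := sphereGradSq_nonneg ψ p
    set S := omegaSq Λ m (toQ p) / 4 * (sphereGradSq ψ p / radius Λ m (toQ p) ^ 2) with hSdef
    have hS0 : 0 ≤ S := by positivity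
    set x := (p.1 * dU ψ p) ^ 2
    have hx : 0 ≤ x := sq_nonneg _
    set y := (dV ψ p / p.1) ^ 2
    have hy : 0 ≤ y := sq_nonneg _
    generalize k + a w = A at *
    generalize c w - k * w = B at *
    have hd : 1 / r₀ * φ ^ 2 * k * (1 / A + w / B) *
          (A * (φ * k) * x + B * (φ * k * w) * y + (A * (φ * k * w) + B * (φ * k)) * S) -
        (1 / r₀ * φ ^ 2 * k * (φ * k) * x + 1 / r₀ * φ ^ 2 * k * w * (φ * k * w) * y +
          (1 / r₀ * φ ^ 2 * k * (φ * k * w) + 1 / r₀ * φ ^ 2 * k * w * (φ * k)) * S) =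
        1 / r₀ * φ ^ 3 * k ^ 2 * (w * A / B * x + B * w / A * y +
          (w ^ 2 * A / B + B / A) * S) := by
      field_simp; ring
    have : 0 ≤ 1 / r₀ * φ ^ 3 * k ^ 2 * (w * A / B * x + B * w / A * y +
          (w ^ 2 * A / B + B / A) * S) := by positivity
    linarith

end SchwarzschildDeSitter

namespace SchwarzschildDeSitter

/-! ### Integration by parts on the sphere -/

noncomputable section

/-- Euclidean three-space. -/
abbrev E3 : Type := EuclideanSpace ℝ (Fin 3)

/-- The standard basis of Euclidean three-space. -/
def stdE (i : Fin 3) : E3 := EuclideanSpace.single i 1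

instance : IsFiniteMeasure sphereMeasure := by unfold sphereMeasure; infer_instance

end

/-- Polar coordinates. The radial integral is left unevaluated: two integrals with the same `β` will
be compared, one of them positive, which shows that this factor is not zero. -/
theorem integral_of_homogeneous {β : ℝ → ℝ} {H : E3 → ℝ} {k : S2 → ℝ}
    (h : ∀ (x : S2) (r : ℝ), 0 < r → H (r • (x : E3)) = k x * β r) :
    ∫ y, H y = (∫ x, k x ∂sphereMeasure) *
      ∫ r : Ioi (0 : ℝ), β r ∂(Measure.volumeIoiPow (Module.finrank ℝ E3 - 1)) :=
  calc
    ∫ y, H y = ∫ y : ({(0)}ᶜ : Set E3), H y.1 ∂((volume : Measure E3).comap (↑)) := by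
      rw [integral_subtype_comap (measurableSet_singleton _).compl fun y => H y,
        restrict_compl_singleton]
    _ = ∫ z : S2 × Ioi (0 : ℝ), k z.1 * β z.2 ∂((volume : Measure E3).toSphere.prod
          (.volumeIoiPow (Module.finrank ℝ E3 - 1))) := by
      rw [← (volume : Measure E3).measurePreserving_homeomorphUnitSphereProd.integral_comp
        (Homeomorph.measurableEmbedding _)]
      congr 1
      ext y
      have hy : 0 < ‖y.1‖ := norm_pos_iff.2 y.2
      rw [← h _ _ (homeomorphUnitSphereProd E3 y).2.2]
      congr 1
      rw [homeomorphUnitSphereProd_apply_fst_coe, homeomorphUnitSphereProd_apply_snd_coe,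
        smul_smul, mul_inv_cancel₀ hy.ne', one_smul]
    _ = _ := integral_prod_mul (μ := (volume : Measure E3).toSphere) k fun r : Ioi (0 : ℝ) => β r

theorem fderiv_apply_smul_of_homogeneous {G : E3 → ℝ} {c : ℝ} (hc : c ≠ 0) {n : ℤ}
    (hG : ∀ y, G (c • y) = c ^ n * G y) (y v : E3) :
    fderiv ℝ G (c • y) v = c ^ (n - 1) * fderiv ℝ G y v := by
  have h1 := fderiv_comp_smul (𝕜 := ℝ) (f := G) (x := y) c
  have h2 : (fun y => G (c • y)) = c ^ n • G := funext hG
  rw [h2, fderiv_const_smul_field] at h1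
  have h3 := congrArg (fun L : E3 →L[ℝ] ℝ => L v) h1
  simp only [Pi.smul_apply, smul_apply, smul_eq_mul] at h3
  rw [zpow_sub_one₀ hc]
  field_simp
  linarith

/-- The divergence theorem on the sphere, for `φ ∇χ`, in terms of functions that are constant along
rays. -/
theorem integral_sphere_mul_laplacian {F G : E3 → ℝ} (hF : ∀ c : ℝ, 0 < c → ∀ y, F (c • y) = F y)
    (hG : ∀ c : ℝ, 0 < c → ∀ y, G (c • y) = G y) (hFc : ContDiffOn ℝ 1 F {0}ᶜ)
    (hGc : ContDiffOn ℝ 2 G {0}ᶜ) :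
    ∫ x : S2, (F x * (∑ i, fderiv ℝ (fun y => fderiv ℝ G y (stdE i)) x (stdE i)) +
      ∑ i, fderiv ℝ F x (stdE i) * fderiv ℝ G x (stdE i)) ∂sphereMeasure = 0 := by
  have hopen : IsOpen ({0}ᶜ : Set E3) := isOpen_compl_singleton
  set g : Fin 3 → E3 → ℝ := fun i y => fderiv ℝ G y (stdE i) with hg
  have hgc : ∀ i, ContDiffOn ℝ 1 (g i) {0}ᶜ := fun i =>
    (hGc.fderiv_of_isOpen hopen (by norm_num)).clm_apply contDiffOn_const
  -- A bump in the variable `|y|²`, centred at `1`. The resulting `ζ` is a radial cutoff that equals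
  -- `1` on the unit sphere and vanishes near the origin and near infinity.
  set β : ContDiffBump (1 : ℝ) := ⟨1 / 4, 1 / 2, by norm_num, by norm_num⟩
  set ζ : E3 → ℝ := fun y => β (‖y‖ ^ 2) with hζ
  have hζc : ContDiff ℝ 1 ζ := β.contDiff.comp (contDiff_norm_sq ℝ)
  set K : Set E3 := {y | ‖y‖ ^ 2 ∈ Icc (1 / 2 : ℝ) (3 / 2)} with hK
  have hKc : IsCompact K := by
    refine (isCompact_closedBall (0 : E3) 2).of_isClosed_subset
      (isClosed_Icc.preimage (by fun_prop)) fun y hy => ?_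
    rw [mem_closedBall_zero_iff]
    nlinarith [hy.2, norm_nonneg y]
  have hK0 : K ⊆ {0}ᶜ := by
    intro y hy h0
    rw [mem_singleton_iff.1 h0] at hy
    have := hy.1
    norm_num at this
  have hsupp : ∀ y, y ∉ K → ζ y = 0 := by
    intro y hy
    apply β.zero_of_le_dist
    rw [Real.dist_eq]
    simp only [hK, mem_ofPred_eq, mem_Icc, not_and_or, not_le] at hy
    change (1 / 2 : ℝ) ≤ _
    rcases hy with h | h
    · rw [abs_of_nonpos (by linarith)]; linarith
    · rw [abs_of_nonneg (by linarith)]; linarith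
  have hz0 : ∀ y, y ∉ K → ζ =ᶠ[𝓝 y] fun _ => 0 := fun y hy => by
    filter_upwards [hKc.isClosed.isOpen_compl.mem_nhds hy] with z hz using hsupp z hz
  have hext : ∀ (a : E3 → ℝ) (n : WithTop ℕ∞), n ≤ 1 → ContDiffOn ℝ n a {0}ᶜ →
      ContDiff ℝ n fun y => ζ y * a y := by
    intro a n hn ha
    rw [contDiff_iff_contDiffAt]
    intro y
    by_cases hy : y ∈ K
    · exact (hζc.of_le hn).contDiffAt.mul (ha.contDiffAt (hopen.mem_nhds (hK0 hy)))
    · refine (contDiffAt_const (c := (0 : ℝ))).congr_of_eventuallyEq ?_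
      filter_upwards [hz0 y hy] with z hz
      rw [hz, zero_mul]
  have hint : ∀ a : E3 → ℝ, ContinuousOn a {0}ᶜ → Integrable fun y => ζ y * a y := by
    intro a ha
    have h1 : Continuous fun y => ζ y * a y :=
      (hext a 0 (by norm_num) (contDiffOn_zero.2 ha)).continuous
    refine h1.integrable_of_hasCompactSupport (HasCompactSupport.intro hKc fun y hy => ?_)
    simp only [hsupp y hy, zero_mul]
  have hdF : ∀ y ∈ ({0}ᶜ : Set E3), DifferentiableAt ℝ F y := fun y hy =>
    (hFc.contDiffAt (hopen.mem_nhds hy)).differentiableAt (by norm_num)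
  have hfg : ∀ i, ContinuousOn (fun y => fderiv ℝ (g i) y (stdE i)) {0}ᶜ := fun i =>
    ((hgc i).continuousOn_fderiv_of_isOpen hopen le_rfl).clm_apply continuousOn_const
  have hfF : ∀ i, ContinuousOn (fun y => fderiv ℝ F y (stdE i)) {0}ᶜ := fun i =>
    (hFc.continuousOn_fderiv_of_isOpen hopen le_rfl).clm_apply continuousOn_const
  have hfζF : ∀ i y, fderiv ℝ (fun y => ζ y * F y) y (stdE i) =
      fderiv ℝ ζ y (stdE i) * F y + ζ y * fderiv ℝ F y (stdE i) := by
    intro i y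
    by_cases hy : y ∈ K
    · rw [fderiv_fun_mul (hζc.differentiable (by norm_num) y) (hdF y (hK0 hy))]
      simp only [add_apply, smul_apply, smul_eq_mul]
      ring
    · have e1 : (fun y => ζ y * F y) =ᶠ[𝓝 y] fun _ => 0 := by
        filter_upwards [hz0 y hy] with z hz
        rw [hz, zero_mul]
      rw [e1.fderiv_eq, (hz0 y hy).fderiv_eq, hsupp y hy]
      simp
  -- The gradient of `ζ` is radial, and `G` has no radial derivative because it is constant along
  -- rays. Hence the cutoff contributes nothing to the integration by parts in space.
  have hrad : ∀ y, ∑ i, fderiv ℝ ζ y (stdE i) * g i y = 0 := by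
    intro y
    have h1 : ∀ i, fderiv ℝ ζ y (stdE i) = deriv β (‖y‖ ^ 2) * (2 * y i) := by
      intro i
      have hb : HasDerivAt β (deriv β (‖y‖ ^ 2)) (‖y‖ ^ 2) :=
        ((β.contDiff (n := 1)).differentiable (by norm_num) _).hasDerivAt
      have h2 := hb.comp_hasFDerivAt y (hasStrictFDerivAt_norm_sq y).hasFDerivAt
      rw [show ζ = β ∘ fun y : E3 => ‖y‖ ^ 2 from rfl, h2.fderiv]
      simp [stdE, EuclideanSpace.inner_single_right]
    have h2 : fderiv ℝ G y y = 0 := by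
      by_cases hd : DifferentiableAt ℝ G y
      · have h3 : HasDerivAt (fun t : ℝ => G (t • y)) (fderiv ℝ G y y) 1 := by
          have h4 : HasDerivAt (fun t : ℝ => t • y) ((1 : ℝ) • y) 1 :=
            (hasDerivAt_id (1 : ℝ)).smul_const y
          have h5 : HasFDerivAt G (fderiv ℝ G y) ((1 : ℝ) • y) := by
            rw [one_smul]; exact hd.hasFDerivAt
          simpa [Function.comp_def] using h5.comp_hasDerivAt (1 : ℝ) h4
        have h6 : HasDerivAt (fun t : ℝ => G (t • y)) 0 1 := by
          refine (hasDerivAt_const (1 : ℝ) (G y)).congr_of_eventuallyEq ?_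
          filter_upwards [lt_mem_nhds (one_pos (α := ℝ))] with t ht using hG t ht y
        exact h3.unique h6
      · rw [fderiv_zero_of_not_differentiableAt hd]; rfl
    have h3 : ∑ i, y i * g i y = fderiv ℝ G y y := by
      have : y = ∑ i, y i • stdE i := by
        ext j
        simp [stdE, Pi.single_apply]
      calc ∑ i, y i * g i y = fderiv ℝ G y (∑ i, y i • stdE i) := by simp [hg]
        _ = fderiv ℝ G y y := by rw [← this]
    calc ∑ i, fderiv ℝ ζ y (stdE i) * g i y
        = 2 * deriv β (‖y‖ ^ 2) * ∑ i, y i * g i y := by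
          rw [Finset.mul_sum]
          exact Finset.sum_congr rfl fun i _ => by rw [h1]; ring
      _ = 0 := by rw [h3, h2, mul_zero]
  have ibp : ∀ i, ∫ y, ζ y * F y * fderiv ℝ (g i) y (stdE i) =
      -∫ y, (fderiv ℝ ζ y (stdE i) * F y + ζ y * fderiv ℝ F y (stdE i)) * g i y := by
    intro i
    have h := integral_mul_fderiv_eq_neg_fderiv_mul_of_integrable (μ := (volume : Measure E3))
      (f := fun y => ζ y * F y) (g := g i) (v := stdE i) ?_ ?_ ?_ ?_ ?_
    · simpa only [hfζF] using h
    · have hc := hext F 1 le_rfl hFc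
      have hsup : ∀ y, y ∉ K → fderiv ℝ (fun y => ζ y * F y) y (stdE i) = 0 := fun y hy => by
        have e1 : (fun y => ζ y * F y) =ᶠ[𝓝 y] fun _ => 0 := by
          filter_upwards [hz0 y hy] with z hz
          rw [hz, zero_mul]
        rw [e1.fderiv_eq]; simp
      have hcont : Continuous fun y => fderiv ℝ (fun y => ζ y * F y) y (stdE i) * g i y := by
        rw [continuous_iff_continuousAt]
        intro y
        by_cases hy : y ∈ K
        · exact ((hc.continuous_fderiv (by norm_num)).clm_apply continuous_const).continuousAt.mul
            ((hgc i).continuousOn.continuousAt (hopen.mem_nhds (hK0 hy)))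
        · refine (continuousAt_const (y := (0 : ℝ))).congr ?_
          filter_upwards [hKc.isClosed.isOpen_compl.mem_nhds hy] with z hz
          rw [hsup z hz, zero_mul]
      exact hcont.integrable_of_hasCompactSupport (HasCompactSupport.intro hKc fun y hy => by
        simp only [hsup y hy, zero_mul])
    · simpa only [mul_assoc] using hint _ (hFc.continuousOn.fun_mul (hfg i))
    · simpa only [mul_assoc] using hint _ (hFc.continuousOn.fun_mul (hgc i).continuousOn)
    · exact fun y _ => (hext F 1 le_rfl hFc).differentiable (by norm_num) y
    · intro y hy
      have hyK : y ∈ K := by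
        by_contra hcon
        refine absurd hy (notMem_tsupport_iff_eventuallyEq.2 ?_)
        filter_upwards [hz0 y hcon] with z hz
        simp [hz]
      exact ((hgc i).contDiffAt (hopen.mem_nhds (hK0 hyK))).differentiableAt (by norm_num)
  have htot : ∫ y, ζ y * (F y * (∑ i, fderiv ℝ (g i) y (stdE i)) +
      ∑ i, fderiv ℝ F y (stdE i) * g i y) = 0 := by
    have i1 : ∀ i, Integrable fun y => ζ y * (F y * fderiv ℝ (g i) y (stdE i)) := fun i =>
      hint _ (hFc.continuousOn.fun_mul (hfg i))
    have i2 : ∀ i, Integrable fun y => ζ y * (fderiv ℝ F y (stdE i) * g i y) := fun i =>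
      hint _ ((hfF i).mul (hgc i).continuousOn)
    have i3 : ∀ i, Integrable fun y => fderiv ℝ ζ y (stdE i) * F y * g i y := by
      intro i
      have hsup : ∀ y, y ∉ K → fderiv ℝ ζ y (stdE i) = 0 := fun y hy => by
        rw [(hz0 y hy).fderiv_eq]; simp
      have hcont : Continuous fun y => fderiv ℝ ζ y (stdE i) * F y * g i y := by
        rw [continuous_iff_continuousAt]
        intro y
        by_cases hy : y ∈ K
        · exact (((hζc.continuous_fderiv (by norm_num)).clm_apply
            continuous_const).continuousAt.mul
            (hFc.continuousOn.continuousAt (hopen.mem_nhds (hK0 hy)))).mul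
            ((hgc i).continuousOn.continuousAt (hopen.mem_nhds (hK0 hy)))
        · refine (continuousAt_const (y := (0 : ℝ))).congr ?_
          filter_upwards [hKc.isClosed.isOpen_compl.mem_nhds hy] with z hz
          rw [hsup z hz, zero_mul, zero_mul]
      exact hcont.integrable_of_hasCompactSupport (HasCompactSupport.intro hKc fun y hy => by
        simp only [hsup y hy, zero_mul])
    have e : ∀ y, ζ y * (F y * (∑ i, fderiv ℝ (g i) y (stdE i)) +
        ∑ i, fderiv ℝ F y (stdE i) * g i y) =
        ∑ i, (ζ y * (F y * fderiv ℝ (g i) y (stdE i)) +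
          ζ y * (fderiv ℝ F y (stdE i) * g i y)) := by
      intro y
      simp only [Finset.sum_add_distrib, mul_add, Finset.mul_sum]
    simp only [e]
    rw [integral_finsetSum _ fun i _ => (i1 i).fun_add (i2 i)]
    have e2 : ∀ i, ∫ y, (ζ y * (F y * fderiv ℝ (g i) y (stdE i)) +
        ζ y * (fderiv ℝ F y (stdE i) * g i y)) = -∫ y, fderiv ℝ ζ y (stdE i) * F y * g i y := by
      intro i
      rw [integral_add (i1 i) (i2 i)]
      have h := ibp i
      simp only [mul_assoc, add_mul] at h
      rw [h, integral_add (by simpa only [mul_assoc] using i3 i)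
        (by simpa only [mul_assoc] using i2 i)]
      simp only [mul_assoc]
      ring
    simp only [e2]
    rw [Finset.sum_neg_distrib, ← integral_finsetSum _ fun i _ => i3 i]
    have e3 : ∀ y, ∑ i, fderiv ℝ ζ y (stdE i) * F y * g i y = 0 := by
      intro y
      have h := hrad y
      have h2 : ∑ i, fderiv ℝ ζ y (stdE i) * F y * g i y =
          F y * ∑ i, fderiv ℝ ζ y (stdE i) * g i y := by
        rw [Finset.mul_sum]; exact Finset.sum_congr rfl fun i _ => by ring
      rw [h2, h, mul_zero]
    simp [e3]
  have hFD : ∀ i (r : ℝ), 0 < r → ∀ y, fderiv ℝ F (r • y) (stdE i) =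
      r⁻¹ * fderiv ℝ F y (stdE i) := fun i r hr y => by
    have := fderiv_apply_smul_of_homogeneous (G := F) hr.ne' (n := 0)
      (fun y => by rw [hF r hr, zpow_zero, one_mul]) y (stdE i)
    simpa using this
  have hGD : ∀ i (r : ℝ), 0 < r → ∀ y, g i (r • y) = r⁻¹ * g i y := fun i r hr y => by
    have := fderiv_apply_smul_of_homogeneous (G := G) hr.ne' (n := 0)
      (fun y => by rw [hG r hr, zpow_zero, one_mul]) y (stdE i)
    simpa using this
  have hGDD : ∀ i (r : ℝ), 0 < r → ∀ y, fderiv ℝ (g i) (r • y) (stdE i) =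
      (r ^ 2)⁻¹ * fderiv ℝ (g i) y (stdE i) := fun i r hr y => by
    have := fderiv_apply_smul_of_homogeneous (G := g i) hr.ne' (n := -1)
      (fun y => by rw [hGD i r hr, zpow_neg_one]) y (stdE i)
    rw [this]
    norm_num [zpow_neg]
  have hnorm : ∀ (x : S2) (r : ℝ), 0 < r → ‖r • (x : E3)‖ ^ 2 = r ^ 2 := fun x r hr => by
    rw [norm_smul, norm_eq_of_mem_sphere x, mul_one, Real.norm_eq_abs, sq_abs]
  -- Apart from `ζ`, the integrand is homogeneous of degree `-2`, so it splits into the wanted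
  -- sphere integral and a radial factor.
  have hpol := integral_of_homogeneous (β := fun r => β (r ^ 2) * (r ^ 2)⁻¹)
    (H := fun y => ζ y * (F y * (∑ i, fderiv ℝ (g i) y (stdE i)) +
      ∑ i, fderiv ℝ F y (stdE i) * g i y))
    (k := fun x : S2 => F x * (∑ i, fderiv ℝ (g i) x (stdE i)) +
      ∑ i, fderiv ℝ F x (stdE i) * g i x) (fun x r hr => by
        simp only [hζ, hnorm x r hr, hF r hr, hFD _ r hr, hGD _ r hr, hGDD _ r hr,
          Fin.sum_univ_three]
        have := hr.ne'
        field_simp)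
  have hpol1 := integral_of_homogeneous (β := fun r => β (r ^ 2) * (r ^ 2)⁻¹)
    (H := fun y => ζ y * (‖y‖ ^ 2)⁻¹) (k := fun _ => 1) (fun x r hr => by
        simp only [hζ, hnorm x r hr, one_mul])
  rw [htot] at hpol
  -- A positive integral with the same radial factor. It rules out that the vanishing of the product
  -- is due to that factor.
  have hpos : 0 < ∫ y, ζ y * (‖y‖ ^ 2)⁻¹ := by
    have hcont : Continuous fun y : E3 => ζ y * (‖y‖ ^ 2)⁻¹ :=
      (hext (fun y => (‖y‖ ^ 2)⁻¹) 0 (by norm_num) (contDiffOn_zero.2 (by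
        refine ContinuousOn.inv₀ (by fun_prop) fun y hy => ?_
        have : 0 < ‖y‖ := norm_pos_iff.2 hy
        positivity))).continuous
    refine hcont.integral_pos_of_hasCompactSupport_nonneg_nonzero
      (HasCompactSupport.intro hKc fun y hy => by simp only [hsupp y hy, zero_mul])
      (fun y => mul_nonneg β.nonneg (by positivity)) (x := stdE 0) ?_
    have h1 : ‖stdE 0‖ ^ 2 = 1 := by simp [stdE]
    simp only [hζ, h1]
    rw [β.one_of_mem_closedBall (by simp [β.rIn_pos.le])]
    norm_num
  rcases mul_eq_zero.1 hpol.symm with h | h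
  · exact h
  · rw [hpol1, h, mul_zero] at hpos
    exact absurd hpos (lt_irrefl _)

end SchwarzschildDeSitter

namespace SchwarzschildDeSitter

/-! ### Functions on the chart, extended along rays -/

noncomputable section

/-- The extension of a function on the chart that is constant along rays. -/
def rayExt (ψ : Point → ℝ) (z : ℝ × ℝ × E3) : ℝ := radialExt (fun x => ψ (z.1, z.2.1, x)) z.2.2

/-- The inclusion of the sphere factor into Euclidean space. -/
def incl (p : Point) : ℝ × ℝ × E3 := (p.1, p.2.1, (p.2.2 : E3))

/-- The inclusion of the `(u, v)` plane. -/
def planeIncl : ℝ × ℝ →L[ℝ] ℝ × ℝ × E3 :=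
  (ContinuousLinearMap.fst ℝ ℝ ℝ).prod ((ContinuousLinearMap.snd ℝ ℝ ℝ).prod 0)

/-- First derivatives, in terms of the extension along rays. -/
def D1 (ψ : Point → ℝ) (X : ℝ × ℝ × E3) (p : Point) : ℝ := fderiv ℝ (rayExt ψ) (incl p) X

/-- Second derivatives, in terms of the extension along rays. -/
def D2 (ψ : Point → ℝ) (X Y : ℝ × ℝ × E3) (p : Point) : ℝ :=
  fderiv ℝ (fun z => fderiv ℝ (rayExt ψ) z X) (incl p) Y

/-- The coordinate vector `∂_u`. -/
def eU : ℝ × ℝ × E3 := (1, 0, 0)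

/-- The coordinate vector `∂_v`. -/
def eV : ℝ × ℝ × E3 := (0, 1, 0)

/-- The standard basis of the Euclidean factor. -/
def eS (i : Fin 3) : ℝ × ℝ × E3 := (0, 0, stdE i)

/-- The part of the chart over a subset of the `(u, v)` plane. -/
def cyl (O : Set (ℝ × ℝ)) : Set Point := toQ ⁻¹' O

/-- The integral over the spheres. -/
def sphereInt (f : Point → ℝ) (q : ℝ × ℝ) : ℝ := ∫ x, f (q.1, q.2, x) ∂sphereMeasure

/-- `fu`, `fv` are the continuous partial derivatives of `f`. -/
structure HasPartials (O : Set (ℝ × ℝ)) (f fu fv : Point → ℝ) : Prop where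
  cont : ContinuousOn f (cyl O)
  cont_u : ContinuousOn fu (cyl O)
  cont_v : ContinuousOn fv (cyl O)
  deriv : ∀ p ∈ cyl O, HasFDerivAt (fun q : ℝ × ℝ => f (q.1, q.2, p.2.2))
    (fu p • ContinuousLinearMap.fst ℝ ℝ ℝ + fv p • ContinuousLinearMap.snd ℝ ℝ ℝ) (toQ p)

/-- `Fu`, `Fv` are the continuous partial derivatives of `F`. -/
structure HasPlanePartials (O : Set (ℝ × ℝ)) (F Fu Fv : ℝ × ℝ → ℝ) : Prop where
  cont : ContinuousOn F O
  cont_u : ContinuousOn Fu O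
  cont_v : ContinuousOn Fv O
  deriv : ∀ q ∈ O, HasFDerivAt F
    (Fu q • ContinuousLinearMap.fst ℝ ℝ ℝ + Fv q • ContinuousLinearMap.snd ℝ ℝ ℝ) q

end

theorem continuous_toQ : Continuous toQ := by unfold toQ; fun_prop

theorem continuous_incl : Continuous incl := by unfold incl; fun_prop

theorem radialExt_coe (φ : S2 → ℝ) (x : S2) : radialExt φ (x : E3) = φ x := by
  have hx : (x : E3) ≠ 0 := ne_zero_of_mem_unit_sphere x
  have h1 : ‖(x : E3)‖ = 1 := norm_eq_of_mem_sphere x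
  rw [radialExt, dif_pos hx]
  congr 1
  ext1
  simp [h1]

theorem radialExt_smul (φ : S2 → ℝ) {c : ℝ} (hc : 0 < c) (y : E3) :
    radialExt φ (c • y) = radialExt φ y := by
  unfold radialExt
  by_cases hy : y = 0
  · simp [hy]
  · rw [dif_pos hy, dif_pos (smul_ne_zero hc.ne' hy)]
    congr 1
    ext1
    simp only [norm_smul, Real.norm_eq_abs, abs_of_pos hc, smul_smul]
    congr 1
    field_simp

theorem rayExt_incl (ψ : Point → ℝ) (p : Point) : rayExt ψ (incl p) = ψ p := radialExt_coe _ _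

theorem rayExt_coe (ψ : Point → ℝ) (s t : ℝ) (x : S2) : rayExt ψ (s, t, (x : E3)) = ψ (s, t, x) :=
  radialExt_coe _ _

theorem rayExt_smul (ψ : Point → ℝ) (s t : ℝ) {c : ℝ} (hc : 0 < c) (y : E3) :
    rayExt ψ (s, t, c • y) = rayExt ψ (s, t, y) := radialExt_smul _ hc _

/-- The fixed dilation by `‖y‖⁻¹` leaves `F` unchanged and carries `y` to the unit sphere, so
regularity is transported from there by a linear map. -/
theorem contDiffOn_of_homogeneous {F : E3 → ℝ} {n : WithTop ℕ∞}
    (hF : ∀ c : ℝ, 0 < c → ∀ y, F (c • y) = F y) (h : ∀ x : S2, ContDiffAt ℝ n F (x : E3)) :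
    ContDiffOn ℝ n F {0}ᶜ := by
  intro y hy
  have hpos : 0 < ‖y‖ := norm_pos_iff.2 hy
  have hx := h ⟨‖y‖⁻¹ • y, by simp [norm_smul, hpos.ne']⟩
  have h2 : F = F ∘ fun y => ‖y‖⁻¹ • y := by
    funext z
    by_cases hz : z = 0
    · simp [hz]
    · exact (hF _ (inv_pos.2 (norm_pos_iff.2 hz)) z).symm
  have h3 : F = F ∘ fun z : E3 => ‖y‖⁻¹ • z := funext fun z => (hF _ (inv_pos.2 hpos) z).symm
  rw [h3]
  exact (hx.comp y (contDiffAt_id.const_smul _)).contDiffWithinAt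

section

variable {U : Set Point} {ψ : Point → ℝ} {p : Point}

theorem IsC2On.contDiffAt_rayExt (h : IsC2On U ψ) (hp : p ∈ U) :
    ContDiffAt ℝ 2 (rayExt ψ) (incl p) := h p hp

theorem IsC2On.mono {V : Set Point} (h : IsC2On U ψ) (hV : V ⊆ U) : IsC2On V ψ :=
  fun p hp => h p (hV hp)

theorem IsC2On.contDiffAt_fderiv (h : IsC2On U ψ) (hp : p ∈ U) (X : ℝ × ℝ × E3) :
    ContDiffAt ℝ 1 (fun z => fderiv ℝ (rayExt ψ) z X) (incl p) :=
  ((h.contDiffAt_rayExt hp).fderiv_right (by norm_num)).clm_apply contDiffAt_const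

theorem IsC2On.continuousOn (h : IsC2On U ψ) : ContinuousOn ψ U := fun p hp => by
  have h1 := (h.contDiffAt_rayExt hp).continuousAt.comp (f := incl) continuous_incl.continuousAt
  have h2 : rayExt ψ ∘ incl = ψ := funext (rayExt_incl ψ)
  rw [h2] at h1
  exact h1.continuousWithinAt

theorem IsC2On.continuousOn_D1 (h : IsC2On U ψ) (X : ℝ × ℝ × E3) : ContinuousOn (D1 ψ X) U :=
  fun _ hp => ((h.contDiffAt_fderiv hp X).continuousAt.comp (f := incl)
    continuous_incl.continuousAt).continuousWithinAt

theorem IsC2On.continuousOn_D2 (h : IsC2On U ψ) (X Y : ℝ × ℝ × E3) :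
    ContinuousOn (D2 ψ X Y) U := fun p hp => by
  have h1 : ContDiffAt ℝ 0 (fun z => fderiv ℝ (fun z => fderiv ℝ (rayExt ψ) z X) z Y) (incl p) :=
    ((h.contDiffAt_fderiv hp X).fderiv_right (by norm_num)).clm_apply contDiffAt_const
  exact (h1.continuousAt.comp (f := incl) continuous_incl.continuousAt).continuousWithinAt

theorem IsC2On.D2_symm (h : IsC2On U ψ) (hp : p ∈ U) (X Y : ℝ × ℝ × E3) :
    D2 ψ X Y p = D2 ψ Y X p := by
  have h1 := (h.contDiffAt_rayExt hp).isSymmSndFDerivAt (by simp)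
  have h2 : DifferentiableAt ℝ (fderiv ℝ (rayExt ψ)) (incl p) :=
    ((h.contDiffAt_rayExt hp).fderiv_right (m := 1) (by norm_num)).differentiableAt (by norm_num)
  have h3 : ∀ X Y, D2 ψ X Y p = fderiv ℝ (fderiv ℝ (rayExt ψ)) (incl p) Y X := fun X Y => by
    rw [D2, fderiv_clm_apply h2 (differentiableAt_const X)]
    simp
  rw [h3, h3, h1.eq]

theorem hasFDerivAt_planeIncl (q : ℝ × ℝ) (x : S2) :
    HasFDerivAt (fun q : ℝ × ℝ => ((q.1, q.2, (x : E3)) : ℝ × ℝ × E3)) planeIncl q :=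
  hasFDerivAt_fst.prodMk (hasFDerivAt_snd.prodMk (hasFDerivAt_const _ _))

theorem IsC2On.dU_eq (h : IsC2On U ψ) (hp : p ∈ U) : dU ψ p = D1 ψ eU p := by
  have h1 : HasFDerivAt (rayExt ψ) (fderiv ℝ (rayExt ψ) (incl p)) (incl p) :=
    ((h.contDiffAt_rayExt hp).differentiableAt (by norm_num)).hasFDerivAt
  have h2 : HasDerivAt (fun s : ℝ => ((s, p.2.1, (p.2.2 : E3)) : ℝ × ℝ × E3)) eU p.1 :=
    (hasDerivAt_id p.1).prodMk ((hasDerivAt_const _ _).prodMk (hasDerivAt_const _ _))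
  have h3 := h1.comp_hasDerivAt (f := fun s : ℝ => ((s, p.2.1, (p.2.2 : E3)) : ℝ × ℝ × E3)) p.1 h2
  have h4 : rayExt ψ ∘ (fun s : ℝ => ((s, p.2.1, (p.2.2 : E3)) : ℝ × ℝ × E3)) =
    fun s => ψ (s, p.2.1, p.2.2) := funext fun s => rayExt_coe ψ s _ _
  rw [h4] at h3
  exact h3.deriv

theorem IsC2On.dV_eq (h : IsC2On U ψ) (hp : p ∈ U) : dV ψ p = D1 ψ eV p := by
  have h1 : HasFDerivAt (rayExt ψ) (fderiv ℝ (rayExt ψ) (incl p)) (incl p) :=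
    ((h.contDiffAt_rayExt hp).differentiableAt (by norm_num)).hasFDerivAt
  have h2 : HasDerivAt (fun s : ℝ => ((p.1, s, (p.2.2 : E3)) : ℝ × ℝ × E3)) eV p.2.1 :=
    (hasDerivAt_const _ _).prodMk ((hasDerivAt_id p.2.1).prodMk (hasDerivAt_const _ _))
  have h3 := h1.comp_hasDerivAt (f := fun s : ℝ => ((p.1, s, (p.2.2 : E3)) : ℝ × ℝ × E3)) p.2.1 h2
  have h4 : rayExt ψ ∘ (fun s : ℝ => ((p.1, s, (p.2.2 : E3)) : ℝ × ℝ × E3)) =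
    fun s => ψ (p.1, s, p.2.2) := funext fun s => rayExt_coe ψ _ s _
  rw [h4] at h3
  exact h3.deriv

theorem hasFDerivAt_sphereIncl (s t : ℝ) (y : E3) :
    HasFDerivAt (fun y : E3 => ((s, t, y) : ℝ × ℝ × E3))
      ((0 : E3 →L[ℝ] ℝ).prod ((0 : E3 →L[ℝ] ℝ).prod (ContinuousLinearMap.id ℝ E3))) y :=
  (hasFDerivAt_const _ _).prodMk ((hasFDerivAt_const _ _).prodMk (hasFDerivAt_id _))

theorem contDiff_sphereIncl (s t : ℝ) {n : WithTop ℕ∞} :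
    ContDiff ℝ n (fun y : E3 => ((s, t, y) : ℝ × ℝ × E3)) := by fun_prop

theorem IsC2On.contDiffAt_radialExt (h : IsC2On U ψ) (hp : p ∈ U) :
    ContDiffAt ℝ 2 (radialExt fun x => ψ (p.1, p.2.1, x)) (p.2.2 : E3) :=
  (h.contDiffAt_rayExt hp).comp (p.2.2 : E3) (contDiff_sphereIncl p.1 p.2.1).contDiffAt

theorem IsC2On.fderiv_radialExt (h : IsC2On U ψ) (hp : p ∈ U) (i : Fin 3) :
    fderiv ℝ (radialExt fun x => ψ (p.1, p.2.1, x)) (p.2.2 : E3) (stdE i) = D1 ψ (eS i) p := by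
  have h1 : HasFDerivAt (rayExt ψ) (fderiv ℝ (rayExt ψ) (incl p)) (incl p) :=
    ((h.contDiffAt_rayExt hp).differentiableAt (by norm_num)).hasFDerivAt
  have h2 := h1.comp (p.2.2 : E3) (hasFDerivAt_sphereIncl p.1 p.2.1 _)
  have h3 : HasFDerivAt (radialExt fun x => ψ (p.1, p.2.1, x)) _ (p.2.2 : E3) := h2
  rw [h3.fderiv]
  simp [D1, eS]

theorem norm_sq_dual (L : E3 →L[ℝ] ℝ) : ‖L‖ ^ 2 = ∑ i, L (stdE i) ^ 2 := by
  obtain ⟨w, rfl⟩ := (InnerProductSpace.toDual ℝ E3).surjective L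
  rw [LinearIsometryEquiv.norm_map, EuclideanSpace.norm_sq_eq]
  refine Finset.sum_congr rfl fun i _ => ?_
  rw [InnerProductSpace.toDual_apply_apply, stdE, EuclideanSpace.inner_single_right]
  simp

theorem IsC2On.sphereGradSq_eq (h : IsC2On U ψ) (hp : p ∈ U) :
    sphereGradSq ψ p = ∑ i, D1 ψ (eS i) p ^ 2 := by
  rw [sphereGradSq, norm_sq_dual]
  exact Finset.sum_congr rfl fun i _ => by rw [h.fderiv_radialExt hp]

theorem planeIncl_one_zero : planeIncl (1, 0) = eU := by simp [planeIncl, eU]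

theorem planeIncl_zero_one : planeIncl (0, 1) = eV := by simp [planeIncl, eV]

theorem IsC2On.hasFDerivAt_fderiv (h : IsC2On U ψ) (hp : p ∈ U) (X : ℝ × ℝ × E3) :
    HasFDerivAt (fun y => fderiv ℝ (rayExt ψ) (p.1, p.2.1, y) X)
      ((fderiv ℝ (fun z => fderiv ℝ (rayExt ψ) z X) (incl p)).comp
        ((0 : E3 →L[ℝ] ℝ).prod ((0 : E3 →L[ℝ] ℝ).prod (ContinuousLinearMap.id ℝ E3))))
      (p.2.2 : E3) := by
  have h1 := ((h.contDiffAt_fderiv hp X).differentiableAt (by norm_num)).hasFDerivAt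
  exact h1.comp (p.2.2 : E3) (hasFDerivAt_sphereIncl p.1 p.2.1 _)

theorem IsC2On.eventually_differentiableAt (h : IsC2On U ψ) (hp : p ∈ U) :
    ∀ᶠ y in 𝓝 (p.2.2 : E3), DifferentiableAt ℝ (rayExt ψ) (p.1, p.2.1, y) := by
  have h1 : ∀ᶠ z in 𝓝 (incl p), DifferentiableAt ℝ (rayExt ψ) z := by
    filter_upwards [(h.contDiffAt_rayExt hp).eventually (by simp)] with z hz
    exact hz.differentiableAt (by norm_num)
  exact (contDiff_sphereIncl p.1 p.2.1 (n := 0)).continuous.continuousAt.eventually h1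

theorem IsC2On.fderiv_radialExt_eventuallyEq (h : IsC2On U ψ) (hp : p ∈ U) (i : Fin 3) :
    (fun y => fderiv ℝ (radialExt fun x => ψ (p.1, p.2.1, x)) y (stdE i)) =ᶠ[𝓝 (p.2.2 : E3)]
      fun y => fderiv ℝ (rayExt ψ) (p.1, p.2.1, y) (eS i) := by
  filter_upwards [h.eventually_differentiableAt hp] with y hy
  have h2 := hy.hasFDerivAt.comp y (hasFDerivAt_sphereIncl p.1 p.2.1 _)
  have h3 : HasFDerivAt (radialExt fun x => ψ (p.1, p.2.1, x)) _ y := h2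
  rw [h3.fderiv]
  simp [eS]

theorem IsC2On.fderiv_fderiv_radialExt (h : IsC2On U ψ) (hp : p ∈ U) (i j : Fin 3) :
    fderiv ℝ (fun y => fderiv ℝ (radialExt fun x => ψ (p.1, p.2.1, x)) y (stdE i))
      (p.2.2 : E3) (stdE j) = D2 ψ (eS i) (eS j) p := by
  rw [(h.fderiv_radialExt_eventuallyEq hp i).fderiv_eq,
    (h.hasFDerivAt_fderiv hp (eS i)).fderiv]
  simp [D2, eS]

open scoped Laplacian in
theorem IsC2On.sphereLaplacian_eq (h : IsC2On U ψ) (hp : p ∈ U) :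
    sphereLaplacian ψ p = ∑ i, D2 ψ (eS i) (eS i) p := by
  have h2 : DifferentiableAt ℝ (fderiv ℝ (radialExt fun x => ψ (p.1, p.2.1, x))) (p.2.2 : E3) :=
    ((h.contDiffAt_radialExt hp).fderiv_right (m := 1) (by norm_num)).differentiableAt
      (by norm_num)
  rw [sphereLaplacian, InnerProductSpace.laplacian_eq_iteratedFDeriv_orthonormalBasis _
    (EuclideanSpace.basisFun (Fin 3) ℝ)]
  refine Finset.sum_congr rfl fun i _ => ?_
  rw [← h.fderiv_fderiv_radialExt hp, fderiv_clm_apply h2 (differentiableAt_const _),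
    iteratedFDeriv_two_apply]
  simp [stdE]

/-- The divergence theorem on the sphere, for the derivative of a function in a direction of the
`(u, v)` plane. -/
theorem IsC2On.sphereInt_D1_mul_laplacian {φ : Point → ℝ} (hφ : IsC2On U φ) (hψ : IsC2On U ψ)
    (X : ℝ × ℝ) {q : ℝ × ℝ} (hq : ∀ x, (q.1, q.2, x) ∈ U) :
    sphereInt (fun p => D1 φ (planeIncl X) p * sphereLaplacian ψ p +
      ∑ i, D2 φ (planeIncl X) (eS i) p * D1 ψ (eS i) p) q = 0 := by
  -- A line derivative only sees `φ` along one line in the `(u, v)` plane, so it inherits constancy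
  -- along rays with no differentiability assumed. Near the sphere it agrees with `fderiv`.
  set F : E3 → ℝ := fun y => lineDeriv ℝ (rayExt φ) (q.1, q.2, y) (planeIncl X) with hF
  have hFe : ∀ x : S2, F =ᶠ[𝓝 (x : E3)]
      fun y => fderiv ℝ (rayExt φ) (q.1, q.2, y) (planeIncl X) := fun x => by
    filter_upwards [hφ.eventually_differentiableAt (hq x)] with y hy
    exact hy.lineDeriv_eq_fderiv
  have hFh : ∀ c : ℝ, 0 < c → ∀ y, F (c • y) = F y := by
    intro c hc y
    simp only [hF, lineDeriv]
    congr 1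
    funext t
    simpa [planeIncl] using rayExt_smul φ (q.1 + t * X.1) (q.2 + t * X.2) hc y
  have hFc : ContDiffOn ℝ 1 F {0}ᶜ := by
    refine contDiffOn_of_homogeneous hFh fun x => ContDiffAt.congr_of_eventuallyEq ?_ (hFe x)
    exact (hφ.contDiffAt_fderiv (hq x) (planeIncl X)).comp (x : E3)
      (contDiff_sphereIncl q.1 q.2).contDiffAt
  have hGh : ∀ c : ℝ, 0 < c → ∀ y, radialExt (fun x => ψ (q.1, q.2, x)) (c • y) =
      radialExt (fun x => ψ (q.1, q.2, x)) y := fun c hc y => radialExt_smul _ hc y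
  have hGc : ContDiffOn ℝ 2 (radialExt fun x => ψ (q.1, q.2, x)) {0}ᶜ :=
    contDiffOn_of_homogeneous hGh fun x => hψ.contDiffAt_radialExt (hq x)
  rw [← integral_sphere_mul_laplacian hFh hGh hFc hGc]
  refine integral_congr_ae (Eventually.of_forall fun x => ?_)
  have e1 : F x = D1 φ (planeIncl X) (q.1, q.2, x) := (hFe x).self_of_nhds
  have e2 : ∀ i, fderiv ℝ F x (stdE i) = D2 φ (planeIncl X) (eS i) (q.1, q.2, x) := fun i => by
    rw [(hFe x).fderiv_eq, (hφ.hasFDerivAt_fderiv (hq x) (planeIncl X)).fderiv]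
    simp [D2, eS]
  have e3 := fun i j => hψ.fderiv_fderiv_radialExt (hq x) i j
  have e4 := fun i => hψ.fderiv_radialExt (hq x) i
  simp only at e3 e4
  simp only [e1, e2, e3, e4, hψ.sphereLaplacian_eq (hq x)]

/-- The divergence theorem on the sphere. -/
theorem IsC2On.sphereInt_mul_laplacian {φ : Point → ℝ} (hφ : IsC2On U φ) (hψ : IsC2On U ψ)
    {q : ℝ × ℝ} (hq : ∀ x, (q.1, q.2, x) ∈ U) :
    sphereInt (fun p => φ p * sphereLaplacian ψ p + ∑ i, D1 φ (eS i) p * D1 ψ (eS i) p) q = 0 := by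
  have hFh : ∀ c : ℝ, 0 < c → ∀ y, radialExt (fun x => φ (q.1, q.2, x)) (c • y) =
      radialExt (fun x => φ (q.1, q.2, x)) y := fun c hc y => radialExt_smul _ hc y
  have hFc : ContDiffOn ℝ 1 (radialExt fun x => φ (q.1, q.2, x)) {0}ᶜ :=
    contDiffOn_of_homogeneous hFh fun x => (hφ.contDiffAt_radialExt (hq x)).of_le (by norm_num)
  have hGh : ∀ c : ℝ, 0 < c → ∀ y, radialExt (fun x => ψ (q.1, q.2, x)) (c • y) =
      radialExt (fun x => ψ (q.1, q.2, x)) y := fun c hc y => radialExt_smul _ hc y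
  have hGc : ContDiffOn ℝ 2 (radialExt fun x => ψ (q.1, q.2, x)) {0}ᶜ :=
    contDiffOn_of_homogeneous hGh fun x => hψ.contDiffAt_radialExt (hq x)
  rw [← integral_sphere_mul_laplacian hFh hGh hFc hGc]
  refine integral_congr_ae (Eventually.of_forall fun x => ?_)
  have e3 := fun i j => hψ.fderiv_fderiv_radialExt (hq x) i j
  have e4 := fun i => hψ.fderiv_radialExt (hq x) i
  have e5 := fun i => hφ.fderiv_radialExt (hq x) i
  simp only at e3 e4 e5
  simp only [e3, e4, e5, hψ.sphereLaplacian_eq (hq x), radialExt_coe]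

end

/-! ### Differentiation under the integral over the spheres -/

section

variable {O : Set (ℝ × ℝ)} {f fu fv g gu gv : Point → ℝ}

theorem continuousOn_slice {f : Point → ℝ} (hf : ContinuousOn f (cyl O)) {q : ℝ × ℝ}
    (hq : q ∈ O) : Continuous fun x : S2 => f (q.1, q.2, x) :=
  hf.comp_continuous (by fun_prop) fun _ => hq

theorem continuousOn_uncurry {β : Type*} [TopologicalSpace β] {f : Point → β}
    (hf : ContinuousOn f (cyl O)) :
    ContinuousOn (Function.uncurry fun (q : ℝ × ℝ) (x : S2) => f (q.1, q.2, x)) (O ×ˢ univ) :=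
  hf.comp (f := fun z : (ℝ × ℝ) × S2 => ((z.1.1, z.1.2, z.2) : Point))
    (by fun_prop) fun z hz => hz.1

theorem continuousOn_sphereInt (hf : ContinuousOn f (cyl O)) : ContinuousOn (sphereInt f) O :=
  continuousOn_integral_of_compact_support (k := univ) isCompact_univ (continuousOn_uncurry hf)
    fun _ _ _ h => absurd (mem_univ _) h

theorem integrable_slice (hf : ContinuousOn f (cyl O)) {q : ℝ × ℝ} (hq : q ∈ O) :
    Integrable (fun x : S2 => f (q.1, q.2, x)) sphereMeasure :=
  (continuousOn_slice hf hq).integrable_of_hasCompactSupport (HasCompactSupport.of_compactSpace _)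

/-- Compactness of the sphere bounds the partial derivatives uniformly near each point of the plane,
which is the domination required under the integral. -/
theorem HasPartials.sphereInt (hO : IsOpen O) (h : HasPartials O f fu fv) :
    HasPlanePartials O (sphereInt f) (sphereInt fu) (sphereInt fv) := by
  refine ⟨continuousOn_sphereInt h.cont, continuousOn_sphereInt h.cont_u,
    continuousOn_sphereInt h.cont_v, fun q hq => ?_⟩
  set f' : Point → ℝ × ℝ →L[ℝ] ℝ := fun p =>
    fu p • ContinuousLinearMap.fst ℝ ℝ ℝ + fv p • ContinuousLinearMap.snd ℝ ℝ ℝ with hf'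
  have hc : ContinuousOn f' (cyl O) := by
    have := h.cont_u; have := h.cont_v; fun_prop
  obtain ⟨ε, hε, hball⟩ := Metric.nhds_basis_closedBall.mem_iff.1 (hO.mem_nhds hq)
  have hK : IsCompact (Metric.closedBall q ε ×ˢ (univ : Set S2)) :=
    (isCompact_closedBall q ε).prod isCompact_univ
  obtain ⟨C, hC⟩ := hK.exists_bound_of_continuousOn
    ((continuousOn_uncurry hc).mono (prod_mono hball Subset.rfl))
  have key := hasFDerivAt_integral_of_dominated_of_fderiv_le (μ := sphereMeasure) (𝕜 := ℝ)
    (F := fun (q : ℝ × ℝ) (x : S2) => f (q.1, q.2, x))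
    (F' := fun (q : ℝ × ℝ) (x : S2) => f' (q.1, q.2, x)) (x₀ := q)
    (s := Metric.closedBall q ε) (bound := fun _ => C) (Metric.closedBall_mem_nhds q hε)
    (by
      filter_upwards [hO.mem_nhds hq] with q' hq'
      exact (continuousOn_slice h.cont hq').aestronglyMeasurable)
    (integrable_slice h.cont hq)
    (hc.comp_continuous (f := fun x : S2 => ((q.1, q.2, x) : Point)) (by fun_prop)
      fun _ => hq).aestronglyMeasurable
    (Eventually.of_forall fun x q' hq' => hC (q', x) ⟨hq', mem_univ _⟩)
    (integrable_const _)
    (Eventually.of_forall fun x q' hq' => h.deriv (q'.1, q'.2, x) (hball hq'))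
  refine key.congr_fderiv ?_
  simp only [hf']
  rw [integral_add, integral_smul_const, integral_smul_const]
  · rfl
  · exact (integrable_slice h.cont_u hq).smul_const _
  · exact (integrable_slice h.cont_v hq).smul_const _

theorem HasPartials.mul (hf : HasPartials O f fu fv) (hg : HasPartials O g gu gv) :
    HasPartials O (fun p => f p * g p) (fun p => fu p * g p + f p * gu p)
      (fun p => fv p * g p + f p * gv p) := by
  refine ⟨hf.cont.mul hg.cont, (hf.cont_u.mul hg.cont).add (hf.cont.mul hg.cont_u),
    (hf.cont_v.mul hg.cont).add (hf.cont.mul hg.cont_v), fun p hp => ?_⟩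
  refine ((hf.deriv p hp).mul (hg.deriv p hp)).congr_fderiv ?_
  ext <;> simp [toQ] <;> ring

theorem HasPartials.sum {ι : Type*} {s : Finset ι} {f fu fv : ι → Point → ℝ}
    (h : ∀ i, HasPartials O (f i) (fu i) (fv i)) :
    HasPartials O (fun p => ∑ i ∈ s, f i p) (fun p => ∑ i ∈ s, fu i p)
      (fun p => ∑ i ∈ s, fv i p) := by
  refine ⟨continuousOn_finsetSum _ fun i _ => (h i).cont,
    continuousOn_finsetSum _ fun i _ => (h i).cont_u,
    continuousOn_finsetSum _ fun i _ => (h i).cont_v, fun p hp => ?_⟩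
  refine (HasFDerivAt.fun_sum fun i _ => (h i).deriv p hp).congr_fderiv ?_
  ext <;> simp

theorem HasPartials.congr {f' fu' fv' : Point → ℝ} (hO : IsOpen O) (h : HasPartials O f fu fv)
    (hf : ∀ p ∈ cyl O, f' p = f p) (hu : ∀ p ∈ cyl O, fu' p = fu p)
    (hv : ∀ p ∈ cyl O, fv' p = fv p) : HasPartials O f' fu' fv' := by
  refine ⟨h.cont.congr hf, h.cont_u.congr hu, h.cont_v.congr hv, fun p hp => ?_⟩
  rw [hu p hp, hv p hp]
  refine (h.deriv p hp).congr_of_eventuallyEq ?_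
  filter_upwards [hO.mem_nhds hp] with q hq
  exact hf _ hq

theorem IsC2On.hasPartials {ψ : Point → ℝ} (h : IsC2On (cyl O) ψ) :
    HasPartials O ψ (D1 ψ eU) (D1 ψ eV) := by
  refine ⟨h.continuousOn, h.continuousOn_D1 _, h.continuousOn_D1 _, fun p hp => ?_⟩
  have h1 : HasFDerivAt (rayExt ψ) (fderiv ℝ (rayExt ψ) (incl p)) (incl p) :=
    ((h.contDiffAt_rayExt hp).differentiableAt (by norm_num)).hasFDerivAt
  have h2 := h1.comp (toQ p) (hasFDerivAt_planeIncl (toQ p) p.2.2)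
  have h4 : rayExt ψ ∘ (fun q : ℝ × ℝ => ((q.1, q.2, (p.2.2 : E3)) : ℝ × ℝ × E3)) =
    fun q => ψ (q.1, q.2, p.2.2) := funext fun q => rayExt_coe ψ _ _ _
  rw [h4] at h2
  refine h2.congr_fderiv ?_
  ext <;> simp [planeIncl_one_zero, planeIncl_zero_one, D1]

theorem IsC2On.hasPartials_D1 {ψ : Point → ℝ} (h : IsC2On (cyl O) ψ) (X : ℝ × ℝ × E3) :
    HasPartials O (D1 ψ X) (D2 ψ X eU) (D2 ψ X eV) := by
  refine ⟨h.continuousOn_D1 _, h.continuousOn_D2 _ _, h.continuousOn_D2 _ _, fun p hp => ?_⟩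
  have h1 := ((h.contDiffAt_fderiv hp X).differentiableAt (by norm_num)).hasFDerivAt
  have h2 := h1.comp (toQ p) (hasFDerivAt_planeIncl (toQ p) p.2.2)
  refine HasFDerivAt.congr_fderiv (f := fun q : ℝ × ℝ => D1 ψ X (q.1, q.2, p.2.2)) h2 ?_
  ext <;> simp [planeIncl_one_zero, planeIncl_zero_one, D2]

end

end SchwarzschildDeSitter

namespace SchwarzschildDeSitter

/-! ### Calculus in the `(u, v)` plane -/

section

variable {O : Set (ℝ × ℝ)} {F Fu Fv G Gu Gv : ℝ × ℝ → ℝ}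

theorem HasPlanePartials.mul (hF : HasPlanePartials O F Fu Fv) (hG : HasPlanePartials O G Gu Gv) :
    HasPlanePartials O (fun q => F q * G q) (fun q => Fu q * G q + F q * Gu q)
      (fun q => Fv q * G q + F q * Gv q) := by
  refine ⟨hF.cont.mul hG.cont, (hF.cont_u.mul hG.cont).add (hF.cont.mul hG.cont_u),
    (hF.cont_v.mul hG.cont).add (hF.cont.mul hG.cont_v), fun q hq => ?_⟩
  refine ((hF.deriv q hq).mul (hG.deriv q hq)).congr_fderiv ?_
  ext <;> simp <;> ring

theorem HasPlanePartials.add (hF : HasPlanePartials O F Fu Fv) (hG : HasPlanePartials O G Gu Gv) :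
    HasPlanePartials O (fun q => F q + G q) (fun q => Fu q + Gu q) (fun q => Fv q + Gv q) := by
  refine ⟨hF.cont.add hG.cont, hF.cont_u.add hG.cont_u, hF.cont_v.add hG.cont_v, fun q hq => ?_⟩
  refine ((hF.deriv q hq).fun_add (hG.deriv q hq)).congr_fderiv ?_
  ext <;> simp

theorem hasPlanePartials_const (c : ℝ) : HasPlanePartials O (fun _ => c) (fun _ => 0) fun _ => 0 := by
  refine ⟨continuousOn_const, continuousOn_const, continuousOn_const, fun q _ => ?_⟩
  refine (hasFDerivAt_const c q).congr_fderiv ?_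
  ext <;> simp

theorem HasPlanePartials.congr_deriv {Fu' Fv' : ℝ × ℝ → ℝ} (h : HasPlanePartials O F Fu Fv)
    (hu : ∀ q ∈ O, Fu' q = Fu q) (hv : ∀ q ∈ O, Fv' q = Fv q) : HasPlanePartials O F Fu' Fv' :=
  ⟨h.cont, h.cont_u.congr hu, h.cont_v.congr hv, fun q hq => by
    rw [hu q hq, hv q hq]; exact h.deriv q hq⟩

theorem HasPlanePartials.congr {F' : ℝ × ℝ → ℝ} (hO : IsOpen O) (h : HasPlanePartials O F Fu Fv)
    (hF : ∀ q ∈ O, F' q = F q) : HasPlanePartials O F' Fu Fv :=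
  ⟨h.cont.congr hF, h.cont_u, h.cont_v, fun q hq => (h.deriv q hq).congr_of_eventuallyEq (by
    filter_upwards [hO.mem_nhds hq] with q' hq' using hF q' hq')⟩

theorem hasPlanePartials_comp_mul {f f' : ℝ → ℝ} (hf' : ∀ q ∈ O, HasDerivAt f (f' (q.1 * q.2)) (q.1 * q.2))
    (hc : ContinuousOn (fun q : ℝ × ℝ => f' (q.1 * q.2)) O) :
    HasPlanePartials O (fun q => f (q.1 * q.2)) (fun q => f' (q.1 * q.2) * q.2)
      (fun q => f' (q.1 * q.2) * q.1) := by
  refine ⟨fun q hq => ?_, hc.mul continuousOn_snd, hc.mul continuousOn_fst, fun q hq => ?_⟩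
  · exact (hasFDerivAt_comp_mul_pair (hf' q hq)).continuousAt.continuousWithinAt
  · refine (hasFDerivAt_comp_mul_pair (hf' q hq)).congr_fderiv ?_
    ext <;> simp

end

namespace Subextremal

variable {Λ m : ℝ} (hS : Subextremal Λ m) {O : Set (ℝ × ℝ)}
include hS

theorem hasPlanePartials_radius (hO : ∀ q ∈ O, q.1 * q.2 < 1) :
    HasPlanePartials O (radius Λ m) (fun q => deriv (areaRadius Λ m) (q.1 * q.2) * q.2)
      (fun q => deriv (areaRadius Λ m) (q.1 * q.2) * q.1) :=
  hasPlanePartials_comp_mul (fun _ hq => hS.hasDerivAt_areaRadius' (hO _ hq))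
    (hS.contDiffOn_deriv_areaRadius.continuousOn.comp (by fun_prop) hO)

theorem hasPlanePartials_omegaSq (hO : ∀ q ∈ O, q.1 * q.2 < 1) :
    HasPlanePartials O (omegaSq Λ m)
      (fun q => omegaSq Λ m q * logDerivOmega Λ m (q.1 * q.2) * q.2)
      (fun q => omegaSq Λ m q * logDerivOmega Λ m (q.1 * q.2) * q.1) := by
  have h1 : ContinuousOn (omegaSq Λ m) O := fun q hq =>
    (hS.hasFDerivAt_omegaSq (hO q hq)).continuousAt.continuousWithinAt
  have h2 : ContinuousOn (fun q : ℝ × ℝ => logDerivOmega Λ m (q.1 * q.2)) O :=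
    hS.contDiffOn_logDerivOmega.continuousOn.comp (by fun_prop) hO
  refine ⟨h1, (h1.mul h2).mul continuousOn_snd, (h1.mul h2).mul continuousOn_fst, fun q hq => ?_⟩
  refine (hS.hasFDerivAt_omegaSq (hO q hq)).congr_fderiv ?_
  ext <;> simp

end Subextremal

/-! ### The energies of the spheres -/

noncomputable section

/-- The integral of `(∂_u ψ) ^ 2` over the spheres. -/
def intUU (ψ : Point → ℝ) : ℝ × ℝ → ℝ := sphereInt fun p => dU ψ p ^ 2

/-- The integral of `(∂_v ψ) ^ 2` over the spheres. -/
def intVV (ψ : Point → ℝ) : ℝ × ℝ → ℝ := sphereInt fun p => dV ψ p ^ 2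

/-- The integral of `∂_u ψ ∂_v ψ` over the spheres. -/
def intUV (ψ : Point → ℝ) : ℝ × ℝ → ℝ := sphereInt fun p => dU ψ p * dV ψ p

/-- The integral of `|∇ψ| ^ 2` over the spheres. -/
def intSS (ψ : Point → ℝ) : ℝ × ℝ → ℝ := sphereInt (sphereGradSq ψ)

end

section

variable {O : Set (ℝ × ℝ)} {ψ : Point → ℝ}

theorem IsC2On.continuousOn_dU (h : IsC2On (cyl O) ψ) : ContinuousOn (dU ψ) (cyl O) :=
  (h.continuousOn_D1 eU).congr fun _ hp => h.dU_eq hp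

theorem IsC2On.continuousOn_dV (h : IsC2On (cyl O) ψ) : ContinuousOn (dV ψ) (cyl O) :=
  (h.continuousOn_D1 eV).congr fun _ hp => h.dV_eq hp

theorem IsC2On.continuousOn_sphereGradSq (h : IsC2On (cyl O) ψ) :
    ContinuousOn (sphereGradSq ψ) (cyl O) :=
  (continuousOn_finsetSum Finset.univ fun i _ => (h.continuousOn_D1 (eS i)).pow 2).congr
    fun _ hp => h.sphereGradSq_eq hp

theorem IsC2On.continuousOn_sphereLaplacian (h : IsC2On (cyl O) ψ) :
    ContinuousOn (sphereLaplacian ψ) (cyl O) :=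
  (continuousOn_finsetSum Finset.univ fun i _ => h.continuousOn_D2 (eS i) (eS i)).congr
    fun _ hp => h.sphereLaplacian_eq hp

theorem IsC2On.hasPartials_dU (hO : IsOpen O) (h : IsC2On (cyl O) ψ) :
    HasPartials O (dU ψ) (D2 ψ eU eU) (D2 ψ eU eV) :=
  (h.hasPartials_D1 eU).congr hO (fun _ hp => h.dU_eq hp) (fun _ _ => rfl) fun _ _ => rfl

theorem IsC2On.hasPartials_dV (hO : IsOpen O) (h : IsC2On (cyl O) ψ) :
    HasPartials O (dV ψ) (D2 ψ eU eV) (D2 ψ eV eV) :=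
  (h.hasPartials_D1 eV).congr hO (fun _ hp => h.dV_eq hp) (fun _ hp => h.D2_symm hp _ _)
    fun _ _ => rfl

theorem IsC2On.hasPlanePartials_intUU (hO : IsOpen O) (h : IsC2On (cyl O) ψ) :
    HasPlanePartials O (intUU ψ) (sphereInt fun p => 2 * (dU ψ p * D2 ψ eU eU p))
      (sphereInt fun p => 2 * (dU ψ p * D2 ψ eU eV p)) :=
  (((h.hasPartials_dU hO).mul (h.hasPartials_dU hO)).congr hO (fun _ _ => sq _)
    (fun _ _ => by ring) fun _ _ => by ring).sphereInt hO

theorem IsC2On.hasPlanePartials_intVV (hO : IsOpen O) (h : IsC2On (cyl O) ψ) :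
    HasPlanePartials O (intVV ψ) (sphereInt fun p => 2 * (dV ψ p * D2 ψ eU eV p))
      (sphereInt fun p => 2 * (dV ψ p * D2 ψ eV eV p)) :=
  (((h.hasPartials_dV hO).mul (h.hasPartials_dV hO)).congr hO (fun _ _ => sq _)
    (fun _ _ => by ring) fun _ _ => by ring).sphereInt hO

theorem sphereInt_congr {f g : Point → ℝ} {q : ℝ × ℝ}
    (h : ∀ x, f (q.1, q.2, x) = g (q.1, q.2, x)) : sphereInt f q = sphereInt g q :=
  integral_congr_ae (Eventually.of_forall h)

theorem sphereInt_const_mul (c : ℝ) (f : Point → ℝ) (q : ℝ × ℝ) :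
    sphereInt (fun p => c * f p) q = c * sphereInt f q := integral_const_mul _ _

theorem sphereInt_add {f g : Point → ℝ} (hf : ContinuousOn f (cyl O)) (hg : ContinuousOn g (cyl O))
    {q : ℝ × ℝ} (hq : q ∈ O) :
    sphereInt (fun p => f p + g p) q = sphereInt f q + sphereInt g q :=
  integral_add (integrable_slice hf hq) (integrable_slice hg hq)

/-- Symmetry of second derivatives lets the plane derivative act first. The remaining angular
derivative is then moved by the divergence theorem on the sphere, which costs only one derivative of
`∂_X ψ`. -/
theorem IsC2On.sphereInt_gradient (h : IsC2On (cyl O) ψ) (X : ℝ × ℝ) {q : ℝ × ℝ}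
    (hq : q ∈ O) :
    sphereInt (fun p => ∑ i, (D2 ψ (eS i) (planeIncl X) p * D1 ψ (eS i) p +
      D1 ψ (eS i) p * D2 ψ (eS i) (planeIncl X) p)) q =
      sphereInt (fun p => -2 * (D1 ψ (planeIncl X) p * sphereLaplacian ψ p)) q := by
  have h1 := h.sphereInt_D1_mul_laplacian h X (q := q) fun x => hq
  have c1 : ContinuousOn (fun p => D1 ψ (planeIncl X) p * sphereLaplacian ψ p) (cyl O) :=
    (h.continuousOn_D1 _).mul h.continuousOn_sphereLaplacian
  have c2 : ContinuousOn (fun p => ∑ i, D2 ψ (planeIncl X) (eS i) p * D1 ψ (eS i) p) (cyl O) :=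
    continuousOn_finsetSum _ fun i _ => (h.continuousOn_D2 _ _).mul (h.continuousOn_D1 _)
  rw [sphereInt_add c1 c2 hq] at h1
  rw [sphereInt_const_mul]
  calc _ = sphereInt (fun p => 2 * ∑ i, D2 ψ (planeIncl X) (eS i) p * D1 ψ (eS i) p) q := by
        refine sphereInt_congr fun x => ?_
        rw [Finset.mul_sum]
        refine Finset.sum_congr rfl fun i _ => ?_
        rw [h.D2_symm (p := (q.1, q.2, x)) hq (eS i) (planeIncl X)]
        ring
    _ = _ := by rw [sphereInt_const_mul]; linarith

/-- Written with the spherical Laplacian, the derivatives have the shape in which the wave equation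
can replace them. No third derivative of `ψ` appears. -/
theorem IsC2On.hasPlanePartials_intSS (hO : IsOpen O) (h : IsC2On (cyl O) ψ) :
    HasPlanePartials O (intSS ψ) (sphereInt fun p => -2 * (dU ψ p * sphereLaplacian ψ p))
      (sphereInt fun p => -2 * (dV ψ p * sphereLaplacian ψ p)) := by
  have h1 : HasPartials O (sphereGradSq ψ) _ _ := ((HasPartials.sum (s := Finset.univ) fun i =>
    (h.hasPartials_D1 (eS i)).mul (h.hasPartials_D1 (eS i))).congr hO
      (f' := sphereGradSq ψ) (fun p hp => by simp only [h.sphereGradSq_eq hp, sq])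
      (fun _ _ => rfl) fun _ _ => rfl)
  refine (h1.sphereInt hO).congr_deriv (fun q hq => ?_) fun q hq => ?_
  · rw [← planeIncl_one_zero, h.sphereInt_gradient _ hq, planeIncl_one_zero]
    exact sphereInt_congr fun x => by rw [h.dU_eq (p := (q.1, q.2, x)) hq]
  · rw [← planeIncl_zero_one, h.sphereInt_gradient _ hq, planeIncl_zero_one]
    exact sphereInt_congr fun x => by rw [h.dV_eq (p := (q.1, q.2, x)) hq]

theorem intUU_nonneg (ψ : Point → ℝ) (q : ℝ × ℝ) : 0 ≤ intUU ψ q :=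
  integral_nonneg fun _ => sq_nonneg _

theorem intVV_nonneg (ψ : Point → ℝ) (q : ℝ × ℝ) : 0 ≤ intVV ψ q :=
  integral_nonneg fun _ => sq_nonneg _

theorem intSS_nonneg (ψ : Point → ℝ) (q : ℝ × ℝ) : 0 ≤ intSS ψ q :=
  integral_nonneg fun _ => sphereGradSq_nonneg _ _

theorem IsC2On.sphereInt_quadratic (h : IsC2On (cyl O) ψ) {q : ℝ × ℝ} (hq : q ∈ O) (a b c : ℝ) :
    sphereInt (fun p => a * dU ψ p ^ 2 + b * dV ψ p ^ 2 + c * (dU ψ p * dV ψ p)) q =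
      a * intUU ψ q + b * intVV ψ q + c * intUV ψ q := by
  have cu := h.continuousOn_dU
  have cv := h.continuousOn_dV
  rw [sphereInt_add (O := O) (by fun_prop) (by fun_prop) hq,
    sphereInt_add (O := O) (by fun_prop) (by fun_prop) hq, sphereInt_const_mul,
    sphereInt_const_mul, sphereInt_const_mul]
  rfl

/-- A quadratic form in `∂_u ψ`, `∂_v ψ` that is nonnegative stays so after integration. -/
theorem IsC2On.quadratic_int_nonneg (h : IsC2On (cyl O) ψ) {q : ℝ × ℝ} (hq : q ∈ O) {a b c : ℝ}
    (hp : ∀ x y : ℝ, 0 ≤ a * x ^ 2 + b * y ^ 2 + c * (x * y)) :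
    0 ≤ a * intUU ψ q + b * intVV ψ q + c * intUV ψ q := by
  rw [← h.sphereInt_quadratic hq]
  exact integral_nonneg fun x => hp _ _

end

/-! ### The wave equation for the energies of the spheres -/

/-- The differential identities for the energies of the spheres of a solution of the wave
equation. -/
structure IsWaveEnergy (Λ m : ℝ) (O : Set (ℝ × ℝ))
    (UU VV UV SS UUu UUv VVu VVv SSu SSv : ℝ × ℝ → ℝ) : Prop where
  partials_UU : HasPlanePartials O UU UUu UUv
  partials_VV : HasPlanePartials O VV VVu VVv
  partials_SS : HasPlanePartials O SS SSu SSv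
  transport_v : ∀ q ∈ O, radius Λ m q ^ 2 * UUv q + omegaSq Λ m q / 4 * SSu q =
    -2 * radius Λ m q * deriv (areaRadius Λ m) (q.1 * q.2) * (q.2 * UV q + q.1 * UU q)
  transport_u : ∀ q ∈ O, radius Λ m q ^ 2 * VVu q + omegaSq Λ m q / 4 * SSv q =
    -2 * radius Λ m q * deriv (areaRadius Λ m) (q.1 * q.2) * (q.2 * VV q + q.1 * UV q)

/-- Clearing denominators exposes `box` as a linear expression in derivatives of `ψ`. Both the
energy identities and the superposition of solutions are read off from it. -/
theorem Subextremal.box_eq {Λ m : ℝ} (hS : Subextremal Λ m) {O : Set (ℝ × ℝ)} (hO : IsOpen O)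
    (hO1 : ∀ q ∈ O, q.1 * q.2 < 1) {ψ : Point → ℝ} (h : IsC2On (cyl O) ψ) {p : Point}
    (hp : p ∈ cyl O) :
    omegaSq Λ m (toQ p) * radius Λ m (toQ p) ^ 2 * box Λ m ψ p =
      omegaSq Λ m (toQ p) * sphereLaplacian ψ p - 4 * radius Λ m (toQ p) ^ 2 * D2 ψ eU eV p -
      4 * radius Λ m (toQ p) * deriv (areaRadius Λ m) (p.1 * p.2.1) *
        (p.2.1 * dV ψ p + p.1 * dU ψ p) := by
  have hr := hS.hasPlanePartials_radius hO1
  have hr2 := hr.mul hr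
  have du : dU (fun q => radius Λ m (toQ q) ^ 2 * dV ψ q) p =
      2 * radius Λ m (toQ p) * deriv (areaRadius Λ m) (p.1 * p.2.1) * p.2.1 * dV ψ p +
        radius Λ m (toQ p) ^ 2 * D2 ψ eU eV p := by
    have h1 := (hr2.deriv (toQ p) hp).mul ((h.hasPartials_dV hO).deriv p hp)
    have h2 : HasDerivAt (fun s : ℝ => (s, p.2.1)) ((1 : ℝ), (0 : ℝ)) p.1 :=
      (hasDerivAt_id p.1).prodMk (hasDerivAt_const _ _)
    have h3 := h1.comp_hasDerivAt (f := fun s : ℝ => (s, p.2.1)) p.1 h2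
    have h4 : (fun s : ℝ => radius Λ m (toQ (s, p.2.1, p.2.2)) ^ 2 * dV ψ (s, p.2.1, p.2.2)) =
      ((fun q => radius Λ m q * radius Λ m q) * fun q : ℝ × ℝ => dV ψ (q.1, q.2, p.2.2)) ∘
        fun s : ℝ => (s, p.2.1) := by
      funext s; simp [toQ, sq]
    rw [dU, h4, h3.deriv]
    simp [toQ]
    ring
  have dv : dV (fun q => radius Λ m (toQ q) ^ 2 * dU ψ q) p =
      2 * radius Λ m (toQ p) * deriv (areaRadius Λ m) (p.1 * p.2.1) * p.1 * dU ψ p +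
        radius Λ m (toQ p) ^ 2 * D2 ψ eU eV p := by
    have h1 := (hr2.deriv (toQ p) hp).mul ((h.hasPartials_dU hO).deriv p hp)
    have h2 : HasDerivAt (fun s : ℝ => (p.1, s)) ((0 : ℝ), (1 : ℝ)) p.2.1 :=
      (hasDerivAt_const _ _).prodMk (hasDerivAt_id p.2.1)
    have h3 := h1.comp_hasDerivAt (f := fun s : ℝ => (p.1, s)) p.2.1 h2
    have h4 : (fun s : ℝ => radius Λ m (toQ (p.1, s, p.2.2)) ^ 2 * dU ψ (p.1, s, p.2.2)) =
      ((fun q => radius Λ m q * radius Λ m q) * fun q : ℝ × ℝ => dU ψ (q.1, q.2, p.2.2)) ∘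
        fun s : ℝ => (p.1, s) := by
      funext s; simp [toQ, sq]
    rw [dV, h4, h3.deriv]
    simp [toQ]
    ring
  have hO' := (hS.omegaSq_pos (hO1 _ hp)).ne'
  have hR := (hS.radius_pos (hO1 _ hp)).ne'
  rw [box, du, dv]
  field_simp
  ring

/-- Multiply the wave equation by `∂_u ψ`, respectively `∂_v ψ`, and integrate over the sphere; the
Laplacian term is a derivative of `intSS`. -/
theorem Subextremal.isWaveEnergy {Λ m : ℝ} (hS : Subextremal Λ m) {O : Set (ℝ × ℝ)}
    (hO : IsOpen O) (hO1 : ∀ q ∈ O, q.1 * q.2 < 1) {ψ : Point → ℝ}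
    (h : IsClassicalSolution Λ m (cyl O) ψ) :
    ∃ UUu UUv VVu VVv SSu SSv, IsWaveEnergy Λ m O (intUU ψ) (intVV ψ) (intUV ψ) (intSS ψ)
      UUu UUv VVu VVv SSu SSv := by
  obtain ⟨h, hbox⟩ := h
  have hw : ∀ p ∈ cyl O, 4 * radius Λ m (toQ p) ^ 2 * D2 ψ eU eV p -
      omegaSq Λ m (toQ p) * sphereLaplacian ψ p =
      -4 * radius Λ m (toQ p) * deriv (areaRadius Λ m) (p.1 * p.2.1) *
        (p.2.1 * dV ψ p + p.1 * dU ψ p) := by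
    intro p hp
    have h1 := hS.box_eq hO hO1 h hp
    rw [hbox p hp, mul_zero] at h1
    linarith
  have cu := h.continuousOn_dU
  have cv := h.continuousOn_dV
  have cl := h.continuousOn_sphereLaplacian
  have cd := h.continuousOn_D2 eU eV
  refine ⟨_, _, _, _, _, _, h.hasPlanePartials_intUU hO, h.hasPlanePartials_intVV hO,
    h.hasPlanePartials_intSS hO, fun q hq => ?_, fun q hq => ?_⟩
  · rw [← sphereInt_const_mul, ← sphereInt_const_mul, ← sphereInt_add (O := O) (by fun_prop)
      (by fun_prop) hq]
    have e := h.sphereInt_quadratic hq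
      (-2 * radius Λ m q * deriv (areaRadius Λ m) (q.1 * q.2) * q.1) 0
      (-2 * radius Λ m q * deriv (areaRadius Λ m) (q.1 * q.2) * q.2)
    have e2 : -2 * radius Λ m q * deriv (areaRadius Λ m) (q.1 * q.2) *
        (q.2 * intUV ψ q + q.1 * intUU ψ q) =
        -2 * radius Λ m q * deriv (areaRadius Λ m) (q.1 * q.2) * q.1 * intUU ψ q +
        0 * intVV ψ q +
        -2 * radius Λ m q * deriv (areaRadius Λ m) (q.1 * q.2) * q.2 * intUV ψ q := by ring
    rw [e2, ← e]
    refine sphereInt_congr fun x => ?_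
    have := hw (q.1, q.2, x) hq
    simp only [toQ] at this
    -- The factor arises from `2 ∂_u ψ ∂_u∂_v ψ` against the coefficient `4 r²` of the wave
    -- equation.
    linear_combination (1 / 2) * dU ψ (q.1, q.2, x) * this
  · rw [← sphereInt_const_mul, ← sphereInt_const_mul, ← sphereInt_add (O := O) (by fun_prop)
      (by fun_prop) hq]
    have e := h.sphereInt_quadratic hq 0
      (-2 * radius Λ m q * deriv (areaRadius Λ m) (q.1 * q.2) * q.2)
      (-2 * radius Λ m q * deriv (areaRadius Λ m) (q.1 * q.2) * q.1)
    have e2 : -2 * radius Λ m q * deriv (areaRadius Λ m) (q.1 * q.2) *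
        (q.2 * intVV ψ q + q.1 * intUV ψ q) = 0 * intUU ψ q +
        -2 * radius Λ m q * deriv (areaRadius Λ m) (q.1 * q.2) * q.2 * intVV ψ q +
        -2 * radius Λ m q * deriv (areaRadius Λ m) (q.1 * q.2) * q.1 * intUV ψ q := by ring
    rw [e2, ← e]
    refine sphereInt_congr fun x => ?_
    have := hw (q.1, q.2, x) hq
    simp only [toQ] at this
    linear_combination (1 / 2) * dV ψ (q.1, q.2, x) * this

/-- The divergence of the energy current of the multiplier `P ∂_u + Q ∂_v`. -/
theorem Subextremal.exists_divergence {Λ m : ℝ} (hS : Subextremal Λ m) {O : Set (ℝ × ℝ)}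
    (hO : IsOpen O) (hO1 : ∀ q ∈ O, q.1 * q.2 < 1) {ψ : Point → ℝ}
    (h : IsClassicalSolution Λ m (cyl O) ψ) {P Pu Pv Q Qu Qv : ℝ × ℝ → ℝ}
    (hP : HasPlanePartials O P Pu Pv) (hQ : HasPlanePartials O Q Qu Qv) :
    ∃ eu ev hu hv : ℝ × ℝ → ℝ,
      HasPlanePartials O (fun q => Q q * radius Λ m q ^ 2 * intVV ψ q +
        P q * (omegaSq Λ m q / 4) * intSS ψ q) eu ev ∧
      HasPlanePartials O (fun q => P q * radius Λ m q ^ 2 * intUU ψ q +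
        Q q * (omegaSq Λ m q / 4) * intSS ψ q) hu hv ∧
      ∀ q ∈ O, eu q + hv q =
        radius Λ m q ^ 2 * (Qu q * intVV ψ q + Pv q * intUU ψ q) -
        2 * radius Λ m q * deriv (areaRadius Λ m) (q.1 * q.2) * (q.1 * Q q + q.2 * P q) *
          intUV ψ q +
        omegaSq Λ m q / 4 * (Pu q + Qv q +
          logDerivOmega Λ m (q.1 * q.2) * (q.2 * P q + q.1 * Q q)) * intSS ψ q := by
  obtain ⟨UUu, UUv, VVu, VVv, SSu, SSv, hE⟩ := hS.isWaveEnergy hO hO1 h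
  have hr := hS.hasPlanePartials_radius hO1
  have hr2 := (hr.mul hr).congr hO (F' := fun q => radius Λ m q ^ 2) fun q _ => sq _
  have hΩ := ((hS.hasPlanePartials_omegaSq hO1).mul (hasPlanePartials_const (1 / 4))).congr hO
    (F' := fun q => omegaSq Λ m q / 4) fun q _ => by ring
  refine ⟨_, _, _, _, ((hQ.mul hr2).mul hE.partials_VV).add ((hP.mul hΩ).mul hE.partials_SS),
    ((hP.mul hr2).mul hE.partials_UU).add ((hQ.mul hΩ).mul hE.partials_SS), fun q hq => ?_⟩
  have t1 := hE.transport_v q hq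
  have t2 := hE.transport_u q hq
  -- The two transport identities, with weights `P` and `Q`, eliminate every derivative of the
  -- sphere energies. Only derivatives of `P`, `Q`, `r` and `Ω²` remain.
  linear_combination P q * t1 + Q q * t2

/-! ### The density of the fluxes -/

/-- Since `∂_v` is null, the terms with the transversal derivative `∂_u ψ` cancel, and the flux
involves only derivatives tangential to the cone. -/
theorem stress_cone {Λ m : ℝ} (ψ : Point → ℝ) (p : Point) (X : ℝ × ℝ)
    (hO : omegaSq Λ m (toQ p) ≠ 0) (hr : radius Λ m (toQ p) ≠ 0) :
    stress Λ m ψ p X (0, 1) * radius Λ m (toQ p) ^ 2 =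
      X.2 * radius Λ m (toQ p) ^ 2 * dV ψ p ^ 2 +
        X.1 * (omegaSq Λ m (toQ p) / 4) * sphereGradSq ψ p := by
  simp only [stress, gQ, gradSq]
  field_simp
  ring

theorem stress_horizon {Λ m : ℝ} (ψ : Point → ℝ) (p : Point) (X : ℝ × ℝ)
    (hO : omegaSq Λ m (toQ p) ≠ 0) (hr : radius Λ m (toQ p) ≠ 0) :
    stress Λ m ψ p X (1, 0) * radius Λ m (toQ p) ^ 2 =
      X.1 * radius Λ m (toQ p) ^ 2 * dU ψ p ^ 2 +
        X.2 * (omegaSq Λ m (toQ p) / 4) * sphereGradSq ψ p := by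
  simp only [stress, gQ, gradSq]
  field_simp
  ring

/-- The density of the flux through outgoing cones, integrated over the spheres. -/
noncomputable def coneDensity (Λ m : ℝ) (N : ℝ × ℝ → ℝ × ℝ) (ψ : Point → ℝ) (q : ℝ × ℝ) : ℝ :=
  (N q).2 * radius Λ m q ^ 2 * intVV ψ q + (N q).1 * (omegaSq Λ m q / 4) * intSS ψ q

/-- The density of the flux through the horizon, integrated over the spheres. -/
noncomputable def horizonDensity (Λ m : ℝ) (N : ℝ × ℝ → ℝ × ℝ) (ψ : Point → ℝ) (q : ℝ × ℝ) : ℝ :=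
  (N q).1 * radius Λ m q ^ 2 * intUU ψ q + (N q).2 * (omegaSq Λ m q / 4) * intSS ψ q

section

variable {Λ m : ℝ} (hS : Subextremal Λ m) {O : Set (ℝ × ℝ)} (hO1 : ∀ q ∈ O, q.1 * q.2 < 1)
  {ψ : Point → ℝ} (N : ℝ × ℝ → ℝ × ℝ)
include hS hO1

theorem integral_stress_cone (h : IsC2On (cyl O) ψ) {q : ℝ × ℝ} (hq : q ∈ O) :
    ∫ x : S2, stress Λ m ψ (q.1, q.2, x) (N q) (0, 1) * radius Λ m q ^ 2 ∂sphereMeasure =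
      coneDensity Λ m N ψ q := by
  have c1 := h.continuousOn_dV
  have c2 := h.continuousOn_sphereGradSq
  rw [coneDensity, intVV, intSS, ← sphereInt_const_mul, ← sphereInt_const_mul,
    ← sphereInt_add (O := O) (by fun_prop) (by fun_prop) hq]
  refine integral_congr_ae (Eventually.of_forall fun x => ?_)
  exact stress_cone ψ (q.1, q.2, x) (N q) (hS.omegaSq_pos (hO1 q hq)).ne'
    (hS.radius_pos (hO1 q hq)).ne'

theorem integral_stress_horizon (h : IsC2On (cyl O) ψ) {q : ℝ × ℝ} (hq : q ∈ O) :
    ∫ x : S2, stress Λ m ψ (q.1, q.2, x) (N q) (1, 0) * radius Λ m q ^ 2 ∂sphereMeasure =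
      horizonDensity Λ m N ψ q := by
  have c1 := h.continuousOn_dU
  have c2 := h.continuousOn_sphereGradSq
  rw [horizonDensity, intUU, intSS, ← sphereInt_const_mul, ← sphereInt_const_mul,
    ← sphereInt_add (O := O) (by fun_prop) (by fun_prop) hq]
  refine integral_congr_ae (Eventually.of_forall fun x => ?_)
  exact stress_horizon ψ (q.1, q.2, x) (N q) (hS.omegaSq_pos (hO1 q hq)).ne'
    (hS.radius_pos (hO1 q hq)).ne'

end

end SchwarzschildDeSitter

namespace SchwarzschildDeSitter

/-! ### The coordinates `(τ, u v)` -/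

noncomputable section

/-- The `(u, v)` coordinates of a point with coordinates `(τ, u v)`. -/
def tauCoord (Λ m u₀ τ₀ : ℝ) (z : ℝ × ℝ) : ℝ × ℝ :=
  (horizonU Λ m u₀ τ₀ z.1, z.2 / horizonU Λ m u₀ τ₀ z.1)

/-- The density in `τ` of the flux through the horizon. -/
def horizonRate (Λ m : ℝ) (N : ℝ × ℝ → ℝ × ℝ) (u₀ τ₀ : ℝ) (ψ : Point → ℝ) (τ : ℝ) : ℝ :=
  kappa Λ m * horizonU Λ m u₀ τ₀ τ * horizonDensity Λ m N ψ (horizonU Λ m u₀ τ₀ τ, 0)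

end

theorem horizonU_pos (Λ m : ℝ) {u₀ : ℝ} (hu : 0 < u₀) (τ₀ τ : ℝ) : 0 < horizonU Λ m u₀ τ₀ τ := by
  unfold horizonU; positivity

theorem continuous_horizonU (Λ m u₀ τ₀ : ℝ) : Continuous (horizonU Λ m u₀ τ₀) := by
  unfold horizonU; fun_prop

theorem Subextremal.horizonU_lt_iff {Λ m : ℝ} (hS : Subextremal Λ m) {u₀ : ℝ} (hu : 0 < u₀)
    (τ₀ : ℝ) {s t : ℝ} : horizonU Λ m u₀ τ₀ s < horizonU Λ m u₀ τ₀ t ↔ s < t := by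
  unfold horizonU
  rw [mul_lt_mul_iff_right₀ hu, Real.exp_lt_exp, mul_lt_mul_iff_right₀ hS.kappa_pos,
    sub_lt_sub_iff_right]

theorem continuous_tauCoord (Λ m : ℝ) {u₀ : ℝ} (hu : 0 < u₀) (τ₀ : ℝ) :
    Continuous (tauCoord Λ m u₀ τ₀) := by
  have h := continuous_horizonU Λ m u₀ τ₀
  unfold tauCoord
  refine (h.comp continuous_fst).prodMk (continuous_snd.div (h.comp continuous_fst) fun z => ?_)
  exact (horizonU_pos Λ m hu τ₀ _).ne'

/-- At fixed `w`, differentiation in `τ` is the action of the Killing field `T`; at fixed `τ`, `∂_w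
= u⁻¹ ∂_v`. -/
theorem HasPlanePartials.comp_tauCoord {Λ m u₀ τ₀ : ℝ} (hu : 0 < u₀) {O : Set (ℝ × ℝ)}
    {F Fu Fv : ℝ × ℝ → ℝ} (hF : HasPlanePartials O F Fu Fv) :
    HasPlanePartials (tauCoord Λ m u₀ τ₀ ⁻¹' O) (fun z => F (tauCoord Λ m u₀ τ₀ z))
      (fun z => kappa Λ m * ((tauCoord Λ m u₀ τ₀ z).1 * Fu (tauCoord Λ m u₀ τ₀ z) -
        (tauCoord Λ m u₀ τ₀ z).2 * Fv (tauCoord Λ m u₀ τ₀ z)))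
      (fun z => Fv (tauCoord Λ m u₀ τ₀ z) / horizonU Λ m u₀ τ₀ z.1) := by
  have hc := continuous_tauCoord Λ m hu τ₀
  have hm : MapsTo (tauCoord Λ m u₀ τ₀) (tauCoord Λ m u₀ τ₀ ⁻¹' O) O := fun _ h => h
  have c1 := hF.cont.comp hc.continuousOn hm
  have c2 := hF.cont_u.comp hc.continuousOn hm
  have c3 := hF.cont_v.comp hc.continuousOn hm
  have hpos : ∀ z : ℝ × ℝ, horizonU Λ m u₀ τ₀ z.1 ≠ 0 := fun z => (horizonU_pos Λ m hu τ₀ _).ne'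
  have hU := (continuous_horizonU Λ m u₀ τ₀).comp (continuous_fst (X := ℝ) (Y := ℝ))
  refine ⟨c1, ?_, c3.div hU.continuousOn fun z _ => hpos z, fun z hz => ?_⟩
  · exact continuousOn_const.mul ((((continuous_fst.comp hc).continuousOn).mul c2).sub
      (((continuous_snd.comp hc).continuousOn).mul c3))
  · have h1 : HasFDerivAt (fun z : ℝ × ℝ => horizonU Λ m u₀ τ₀ z.1)
        ((kappa Λ m * horizonU Λ m u₀ τ₀ z.1) • ContinuousLinearMap.fst ℝ ℝ ℝ) z :=
      (hasDerivAt_horizonU Λ m u₀ τ₀ z.1).comp_hasFDerivAt z hasFDerivAt_fst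
    have hi : HasFDerivAt (fun z : ℝ × ℝ => (horizonU Λ m u₀ τ₀ z.1)⁻¹)
        (-(horizonU Λ m u₀ τ₀ z.1 ^ 2)⁻¹ •
          ((kappa Λ m * horizonU Λ m u₀ τ₀ z.1) • ContinuousLinearMap.fst ℝ ℝ ℝ)) z :=
      (hasDerivAt_inv (hpos z)).comp_hasFDerivAt z h1
    have h2 : HasFDerivAt (tauCoord Λ m u₀ τ₀) _ z := h1.prodMk (hasFDerivAt_snd.mul hi)
    refine ((hF.deriv _ hz).comp z h2).congr_fderiv ?_
    have := hpos z
    ext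
    · simp [tauCoord]; field_simp; ring
    · simp [tauCoord]; field_simp

/-! ### The energy inequality for classical solutions -/

section

variable {Λ m σ δ b r₀ u₀ τ₀ : ℝ} {a c : ℝ → ℝ} {O : Set (ℝ × ℝ)}

theorem IsRedshiftProfile.hasDerivAt_fst (h : IsRedshiftProfile Λ m σ δ a c) {w : ℝ}
    (hw : w ∈ Ioo (-δ) δ) : HasDerivAt a (deriv a w) w :=
  ((h.smooth_fst.contDiffAt (isOpen_Ioo.mem_nhds hw)).differentiableAt (by simp)).hasDerivAt

theorem IsRedshiftProfile.hasDerivAt_snd (h : IsRedshiftProfile Λ m σ δ a c) {w : ℝ}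
    (hw : w ∈ Ioo (-δ) δ) : HasDerivAt c (deriv c w) w :=
  ((h.smooth_snd.contDiffAt (isOpen_Ioo.mem_nhds hw)).differentiableAt (by simp)).hasDerivAt

theorem IsRedshiftProfile.hasPlanePartials_fst (h : IsRedshiftProfile Λ m σ δ a c)
    (hO : IsOpen O) (hO1 : ∀ q ∈ O, 0 < q.1 ∧ q.1 * q.2 ∈ Ioo (-δ) δ) :
    HasPlanePartials O (fun q => (fieldN Λ m (profileField a c) q).1)
      (fun q => kappa Λ m + a (q.1 * q.2) + q.1 * q.2 * deriv a (q.1 * q.2))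
      (fun q => q.1 ^ 2 * deriv a (q.1 * q.2)) := by
  have hid : HasPlanePartials O (fun q => q.1) (fun _ => 1) fun _ => 0 :=
    ⟨continuousOn_fst, continuousOn_const, continuousOn_const, fun q _ =>
      hasFDerivAt_fst.congr_fderiv (by ext <;> simp)⟩
  have hA : HasPlanePartials O (fun q => a (q.1 * q.2)) _ _ :=
    hasPlanePartials_comp_mul (fun q hq => h.hasDerivAt_fst (hO1 q hq).2)
      ((h.smooth_fst.continuousOn_deriv_of_isOpen isOpen_Ioo (by simp)).comp
        (f := fun q : ℝ × ℝ => q.1 * q.2) (by fun_prop) fun q hq => (hO1 q hq).2)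
  refine ((hid.mul ((hasPlanePartials_const (kappa Λ m)).add hA)).congr hO
    fun q hq => ?_).congr_deriv (fun q _ => ?_) fun q _ => ?_
  · rw [fieldN_profileField (hO1 q hq).1.ne']; rfl
  · ring
  · ring

theorem IsRedshiftProfile.hasPlanePartials_snd (h : IsRedshiftProfile Λ m σ δ a c)
    (hO : IsOpen O) (hO1 : ∀ q ∈ O, 0 < q.1 ∧ q.1 * q.2 ∈ Ioo (-δ) δ) :
    HasPlanePartials O (fun q => (fieldN Λ m (profileField a c) q).2)
      (fun q => (q.1 * q.2 * (deriv c (q.1 * q.2) - kappa Λ m) -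
        (c (q.1 * q.2) - kappa Λ m * (q.1 * q.2))) / q.1 ^ 2)
      (fun q => deriv c (q.1 * q.2) - kappa Λ m) := by
  have hinv : HasPlanePartials O (fun q => q.1⁻¹) (fun q => -(q.1 ^ 2)⁻¹) fun _ => 0 := by
    refine ⟨continuousOn_fst.inv₀ fun q hq => (hO1 q hq).1.ne',
      ((continuousOn_fst.pow 2).inv₀ fun q hq => (pow_pos (hO1 q hq).1 2).ne').neg,
      continuousOn_const, fun q hq => ?_⟩
    refine ((hasDerivAt_inv (hO1 q hq).1.ne').comp_hasFDerivAt q hasFDerivAt_fst).congr_fderiv ?_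
    ext <;> simp
  have hB : HasPlanePartials O (fun q => c (q.1 * q.2) - kappa Λ m * (q.1 * q.2)) _ _ :=
    hasPlanePartials_comp_mul (f := fun w => c w - kappa Λ m * w)
      (f' := fun w => deriv c w - kappa Λ m)
      (fun q hq => (h.hasDerivAt_snd (hO1 q hq).2).sub
        (((hasDerivAt_id' _).const_mul (kappa Λ m)).congr_deriv (mul_one _)))
      (ContinuousOn.sub ((h.smooth_snd.continuousOn_deriv_of_isOpen isOpen_Ioo (by simp)).comp
        (f := fun q : ℝ × ℝ => q.1 * q.2) (by fun_prop) fun q hq => (hO1 q hq).2)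
        continuousOn_const)
  refine ((hB.mul hinv).congr hO fun q hq => ?_).congr_deriv (fun q hq => ?_) fun q hq => ?_
  · rw [fieldN_profileField (hO1 q hq).1.ne']; rfl
  · have := (hO1 q hq).1.ne'
    field_simp; ring
  · have := (hO1 q hq).1.ne'
    field_simp; ring

/-- The energy current of the redshift multiplier dissipates at the rate `b`. -/
theorem IsRedshiftProfile.exists_dissipation (hS : Subextremal Λ m)
    (h : IsRedshiftProfile Λ m σ δ a c) (hδ1 : δ < 1)
    (hco : ∀ w ∈ Ioo (-δ) δ, IsCoerciveAt Λ m b w (kappa Λ m + a w) (c w - kappa Λ m * w)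
      (deriv a w) (deriv c w - kappa Λ m))
    (hO : IsOpen O) (hO1 : ∀ q ∈ O, 0 < q.1 ∧ q.1 * q.2 ∈ Ioo (-δ) δ) {ψ : Point → ℝ}
    (hψ : IsClassicalSolution Λ m (cyl O) ψ) :
    ∃ eu ev hu hv : ℝ × ℝ → ℝ,
      HasPlanePartials O (coneDensity Λ m (fieldN Λ m (profileField a c)) ψ) eu ev ∧
      HasPlanePartials O (horizonDensity Λ m (fieldN Λ m (profileField a c)) ψ) hu hv ∧
      ∀ q ∈ O, b * coneDensity Λ m (fieldN Λ m (profileField a c)) ψ q / q.1 +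
        kappa Λ m * (eu q + hv q) ≤ 0 := by
  have hO2 : ∀ q ∈ O, q.1 * q.2 < 1 := fun q hq => (hO1 q hq).2.2.trans hδ1
  obtain ⟨eu, ev, hu, hv, h1, h2, h3⟩ := hS.exists_divergence hO hO2 hψ
    (h.hasPlanePartials_fst hO hO1) (h.hasPlanePartials_snd hO hO1)
  refine ⟨eu, ev, hu, hv, h1, h2, fun q hq => ?_⟩
  rw [h3 q hq, coneDensity, fieldN_profileField (hO1 q hq).1.ne']
  have hw := hco _ (hO1 q hq).2
  have hq0 := (hO1 q hq).1
  have hR := hS.radius_pos (hO2 q hq)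
  have hΩ := hS.omegaSq_pos (hO2 q hq)
  have e1 : radius Λ m q = areaRadius Λ m (q.1 * q.2) := rfl
  -- The pointwise coercivity is stated for `x = u ∂_u ψ` and `y = u⁻¹ ∂_v ψ`. Undoing this scaling
  -- moves the powers of `u` into the coefficients before integration over the sphere.
  have hquad := hψ.1.quadratic_int_nonneg hq
    (a := -kappa Λ m * deriv a (q.1 * q.2) * q.1 ^ 2)
    (b := (kappa Λ m * (c (q.1 * q.2) - kappa Λ m * (q.1 * q.2) -
      q.1 * q.2 * (deriv c (q.1 * q.2) - kappa Λ m)) -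
      b * (c (q.1 * q.2) - kappa Λ m * (q.1 * q.2))) / q.1 ^ 2)
    (c := kappa Λ m * 2 * (q.1 * q.2 * (kappa Λ m + a (q.1 * q.2)) +
      (c (q.1 * q.2) - kappa Λ m * (q.1 * q.2))) *
      (deriv (areaRadius Λ m) (q.1 * q.2) / areaRadius Λ m (q.1 * q.2)))
    (fun x y => by
      have := hw.quadratic (q.1 * x) (y / q.1)
      have e : ∀ s t p : ℝ, s * (q.1 * x) ^ 2 + t * (y / q.1) ^ 2 + p * (q.1 * x * (y / q.1)) =
        s * q.1 ^ 2 * x ^ 2 + t / q.1 ^ 2 * y ^ 2 + p * (x * y) := by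
        intro s t p; field_simp
      rw [← e]
      linarith)
  have hang := mul_nonneg (sub_nonneg.2 hw.angular)
    (mul_nonneg (div_nonneg hΩ.le (by norm_num : (0 : ℝ) ≤ 4)) (intSS_nonneg ψ q))
  have hquad' := mul_nonneg (sq_nonneg (radius Λ m q)) hquad
  simp only [profileField]
  rw [← e1] at hquad'
  have hq1 := hq0.ne'
  have hR1 := hR.ne'
  set L := logDerivOmega Λ m (q.1 * q.2)
  set R' := deriv (areaRadius Λ m) (q.1 * q.2)
  set a' := deriv a (q.1 * q.2)
  set c' := deriv c (q.1 * q.2)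
  set A := a (q.1 * q.2)
  set C := c (q.1 * q.2)
  set R := radius Λ m q
  set k := kappa Λ m
  -- The dissipation expression is exactly minus the integrated quadratic form minus the angular
  -- surplus, both of which are nonnegative.
  have key : b * ((C - k * (q.1 * q.2)) / q.1 * R ^ 2 * intVV ψ q +
        q.1 * (k + A) * (omegaSq Λ m q / 4) * intSS ψ q) / q.1 +
      k * (R ^ 2 * ((q.1 * q.2 * (c' - k) - (C - k * (q.1 * q.2))) / q.1 ^ 2 * intVV ψ q +
        q.1 ^ 2 * a' * intUU ψ q) - 2 * R * R' * (q.1 * ((C - k * (q.1 * q.2)) / q.1) +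
          q.2 * (q.1 * (k + A))) * intUV ψ q +
        omegaSq Λ m q / 4 * (k + A + q.1 * q.2 * a' + (c' - k) + L * (q.2 * (q.1 * (k + A)) +
          q.1 * ((C - k * (q.1 * q.2)) / q.1))) * intSS ψ q) =
      -(R ^ 2 * (-k * a' * q.1 ^ 2 * intUU ψ q +
          (k * (C - k * (q.1 * q.2) - q.1 * q.2 * (c' - k)) - b * (C - k * (q.1 * q.2))) /
            q.1 ^ 2 * intVV ψ q +
          k * 2 * (q.1 * q.2 * (k + A) + (C - k * (q.1 * q.2))) * (R' / R) * intUV ψ q)) -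
      (-k * (L * (q.1 * q.2 * (k + A) + (C - k * (q.1 * q.2))) + (k + A) + q.1 * q.2 * a' +
        (c' - k)) - b * (k + A)) * (omegaSq Λ m q / 4 * intSS ψ q) := by
    field_simp
    ring
  rw [key]
  linarith

end

end SchwarzschildDeSitter

/-! ### The divergence theorem on rectangles and the integrated energy inequality -/

namespace SchwarzschildDeSitter

theorem intervalIntegral_nonpos {f : ℝ → ℝ} {s t : ℝ} (hst : s ≤ t) (hf : ∀ x ∈ Icc s t, f x ≤ 0) :
    ∫ x in s..t, f x ≤ 0 := by
  have := intervalIntegral.integral_nonneg (μ := volume) (f := fun x => -f x) hst fun x hx =>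
    neg_nonneg.2 (hf x hx)
  rw [intervalIntegral.integral_neg] at this
  linarith

/-- The divergence theorem on rectangles. -/
theorem HasPlanePartials.integral_divergence {O : Set (ℝ × ℝ)} {F Fu Fv G Gu Gv : ℝ × ℝ → ℝ}
    (hF : HasPlanePartials O F Fu Fv) (hG : HasPlanePartials O G Gu Gv) {a₁ b₁ a₂ b₂ : ℝ}
    (h₁ : a₁ ≤ b₁) (h₂ : a₂ ≤ b₂) (hO : Icc a₁ b₁ ×ˢ Icc a₂ b₂ ⊆ O) :
    ∫ x in a₁..b₁, ∫ y in a₂..b₂, (Fu (x, y) + Gv (x, y)) =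
      (∫ x in a₁..b₁, G (x, b₂)) - (∫ x in a₁..b₁, G (x, a₂)) + (∫ y in a₂..b₂, F (b₁, y)) -
        ∫ y in a₂..b₂, F (a₁, y) := by
  have hI : Ioo (min a₁ b₁) (max a₁ b₁) ×ˢ Ioo (min a₂ b₂) (max a₂ b₂) ⊆ O := by
    rw [min_eq_left h₁, max_eq_right h₁, min_eq_left h₂, max_eq_right h₂]
    exact (Set.prod_mono Ioo_subset_Icc_self Ioo_subset_Icc_self).trans hO
  have hO' : uIcc a₁ b₁ ×ˢ uIcc a₂ b₂ ⊆ O := by rwa [uIcc_of_le h₁, uIcc_of_le h₂]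
  have key := integral2_divergence_prod_of_hasFDerivAt F G _ _ a₁ a₂ b₁ b₂ (hF.cont.mono hO')
    (hG.cont.mono hO') (fun x hx => hF.deriv x (hI hx)) (fun x hx => hG.deriv x (hI hx)) (by
      refine ContinuousOn.integrableOn_compact (isCompact_uIcc.prod isCompact_uIcc) ?_
      have h1 := hF.cont_u.mono hO'
      have h2 := hG.cont_v.mono hO'
      simpa using h1.fun_add h2)
  simpa using key

section

variable {Λ m σ δ b r₀ u₀ τ₀ : ℝ} {a c : ℝ → ℝ} {O : Set (ℝ × ℝ)} {ψ : Point → ℝ}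

theorem Subextremal.coneDensity_nonneg (hS : Subextremal Λ m) (ψ : Point → ℝ)
    {N : ℝ × ℝ → ℝ × ℝ} {q : ℝ × ℝ} (hq : q.1 * q.2 < 1) (h1 : 0 ≤ (N q).1) (h2 : 0 ≤ (N q).2) :
    0 ≤ coneDensity Λ m N ψ q := by
  have := hS.omegaSq_pos hq
  have := intVV_nonneg ψ q
  have := intSS_nonneg ψ q
  unfold coneDensity
  positivity

theorem Subextremal.horizonDensity_nonneg (hS : Subextremal Λ m) (ψ : Point → ℝ)
    {N : ℝ × ℝ → ℝ × ℝ} {q : ℝ × ℝ} (hq : q.1 * q.2 < 1) (h1 : 0 ≤ (N q).1) (h2 : 0 ≤ (N q).2) :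
    0 ≤ horizonDensity Λ m N ψ q := by
  have := hS.omegaSq_pos hq
  have := intUU_nonneg ψ q
  have := intSS_nonneg ψ q
  unfold horizonDensity
  positivity

theorem Subextremal.coneFlux_eq (hS : Subextremal Λ m) (hO1 : ∀ q ∈ O, q.1 * q.2 < 1)
    (h : IsC2On (cyl O) ψ) (N : ℝ × ℝ → ℝ × ℝ) {u : ℝ} (hw : 0 ≤ uvOfRadius Λ m r₀ / u)
    (hu : ∀ v ∈ Icc 0 (uvOfRadius Λ m r₀ / u), (u, v) ∈ O) :
    coneFlux Λ m N r₀ u ψ =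
      ∫ v in (0 : ℝ)..(uvOfRadius Λ m r₀ / u), coneDensity Λ m N ψ (u, v) := by
  refine intervalIntegral.integral_congr fun v hv => ?_
  rw [uIcc_of_le hw] at hv
  exact integral_stress_cone hS hO1 N h (hu v hv)

theorem Subextremal.horizonFlux_eq (hS : Subextremal Λ m) (hO1 : ∀ q ∈ O, q.1 * q.2 < 1)
    (h : IsC2On (cyl O) ψ) (N : ℝ × ℝ → ℝ × ℝ) {u₁ u₂ : ℝ} (hu : u₁ ≤ u₂)
    (hO : ∀ u ∈ Icc u₁ u₂, (u, 0) ∈ O) :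
    horizonFlux Λ m N u₁ u₂ ψ = ∫ u in u₁..u₂, horizonDensity Λ m N ψ (u, 0) := by
  refine intervalIntegral.integral_congr fun u hu' => ?_
  rw [uIcc_of_le hu] at hu'
  exact integral_stress_horizon hS hO1 N h (hO u hu')

theorem Subextremal.horizonU_le_iff (hS : Subextremal Λ m) (hu : 0 < u₀)
    (τ₀ : ℝ) {s t : ℝ} : horizonU Λ m u₀ τ₀ s ≤ horizonU Λ m u₀ τ₀ t ↔ s ≤ t := by
  rw [← not_lt, hS.horizonU_lt_iff hu, not_lt]

theorem Subextremal.image_horizonU (hS : Subextremal Λ m) (hu : 0 < u₀) (τ₀ τ₁ τ₂ : ℝ) :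
    horizonU Λ m u₀ τ₀ '' Icc τ₁ τ₂ ⊆ Icc (horizonU Λ m u₀ τ₀ τ₁) (horizonU Λ m u₀ τ₀ τ₂) := by
  rintro _ ⟨t, ht, rfl⟩
  exact ⟨(hS.horizonU_le_iff hu τ₀).2 ht.1, (hS.horizonU_le_iff hu τ₀).2 ht.2⟩

/-- The substitution `u = horizonU τ`, with `du = κ u dτ`; the Jacobian is built into `horizonRate`.
-/
theorem Subextremal.horizonFlux_eq_integral_rate (hS : Subextremal Λ m)
    (hO1 : ∀ q ∈ O, q.1 * q.2 < 1) (h : IsC2On (cyl O) ψ) (N : ℝ × ℝ → ℝ × ℝ) (hu : 0 < u₀)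
    {τ₁ τ₂ : ℝ} (hτ : τ₁ ≤ τ₂)
    (hc : ContinuousOn (horizonDensity Λ m N ψ) O)
    (hO : ∀ u ∈ Icc (horizonU Λ m u₀ τ₀ τ₁) (horizonU Λ m u₀ τ₀ τ₂), (u, 0) ∈ O) :
    horizonFlux Λ m N (horizonU Λ m u₀ τ₀ τ₁) (horizonU Λ m u₀ τ₀ τ₂) ψ =
      ∫ τ in τ₁..τ₂, horizonRate Λ m N u₀ τ₀ ψ τ := by
  rw [hS.horizonFlux_eq hO1 h N ((hS.horizonU_le_iff hu τ₀).2 hτ) hO,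
    ← intervalIntegral.integral_comp_mul_deriv' (f := horizonU Λ m u₀ τ₀)
      (f' := fun τ => kappa Λ m * horizonU Λ m u₀ τ₀ τ)
      (g := fun u => horizonDensity Λ m N ψ (u, 0)) (fun x _ => hasDerivAt_horizonU _ _ _ _ _)
      (continuous_const.mul (continuous_horizonU _ _ _ _)).continuousOn]
  · refine intervalIntegral.integral_congr fun τ _ => ?_
    simp only [horizonRate, Function.comp_apply]
    ring
  · rw [uIcc_of_le hτ]
    refine ContinuousOn.mono ?_ (hS.image_horizonU hu τ₀ τ₁ τ₂)
    exact hc.comp (f := fun u : ℝ => (u, (0 : ℝ))) (by fun_prop) hO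

/-- The energy inequality for classical solutions. -/
theorem IsRedshiftProfile.energy_le (hS : Subextremal Λ m)
    (h : IsRedshiftProfile Λ m σ δ a c) (hδ1 : δ < 1)
    (hco : ∀ w ∈ Ioo (-δ) δ, IsCoerciveAt Λ m b w (kappa Λ m + a w) (c w - kappa Λ m * w)
      (deriv a w) (deriv c w - kappa Λ m))
    (hO : IsOpen O) (hO1 : ∀ q ∈ O, 0 < q.1 ∧ q.1 * q.2 ∈ Ioo (-δ) δ)
    (hψ : IsClassicalSolution Λ m (cyl O) ψ) (hu : 0 < u₀) (hr₀ : 0 ≤ uvOfRadius Λ m r₀)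
    {τ₁ τ₂ : ℝ} (hτ : τ₁ ≤ τ₂)
    (hrect : ∀ τ ∈ Icc τ₁ τ₂, ∀ w ∈ Icc 0 (uvOfRadius Λ m r₀), tauCoord Λ m u₀ τ₀ (τ, w) ∈ O) :
    Real.exp (b * τ₂) * coneFlux Λ m (fieldN Λ m (profileField a c)) r₀
        (horizonU Λ m u₀ τ₀ τ₂) ψ ≤
      Real.exp (b * τ₁) * coneFlux Λ m (fieldN Λ m (profileField a c)) r₀
        (horizonU Λ m u₀ τ₀ τ₁) ψ +
      ∫ τ in τ₁..τ₂, Real.exp (b * τ) *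
        horizonRate Λ m (fieldN Λ m (profileField a c)) u₀ τ₀ ψ τ := by
  obtain ⟨eu, ev, hu', hv', he, hh, hdiv⟩ := h.exists_dissipation hS hδ1 hco hO hO1 hψ
  set N := fieldN Λ m (profileField a c) with hN
  set w₀ := uvOfRadius Λ m r₀ with hw₀
  set T := tauCoord Λ m u₀ τ₀ with hT
  have hO2 : ∀ q ∈ O, q.1 * q.2 < 1 := fun q hq => (hO1 q hq).2.2.trans hδ1
  have hUpos : ∀ τ, 0 < horizonU Λ m u₀ τ₀ τ := horizonU_pos Λ m hu τ₀
  have hUc := continuous_horizonU Λ m u₀ τ₀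
  -- The substitution `v = w / u` gives all cones the same parameter interval `[0, w₀]`, at the
  -- price of the Jacobian `u⁻¹`.
  have hcone : ∀ τ ∈ Icc τ₁ τ₂, coneFlux Λ m N r₀ (horizonU Λ m u₀ τ₀ τ) ψ =
      ∫ w in (0 : ℝ)..w₀, coneDensity Λ m N ψ (T (τ, w)) * (horizonU Λ m u₀ τ₀ τ)⁻¹ := by
    intro τ hτ'
    have hp := hUpos τ
    rw [hS.coneFlux_eq hO2 hψ.1 N (div_nonneg hr₀ hp.le)]
    · have e := intervalIntegral.integral_comp_div (a := 0) (b := w₀)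
        (fun v => coneDensity Λ m N ψ (horizonU Λ m u₀ τ₀ τ, v)) hp.ne'
      simp only [zero_div, smul_eq_mul] at e
      rw [intervalIntegral.integral_mul_const]
      change _ = (∫ w in (0 : ℝ)..w₀, coneDensity Λ m N ψ
        (horizonU Λ m u₀ τ₀ τ, w / horizonU Λ m u₀ τ₀ τ)) * _
      rw [e]
      field_simp
      rfl
    · intro v hv
      have := hrect τ hτ' (v * horizonU Λ m u₀ τ₀ τ)
        ⟨mul_nonneg hv.1 hp.le, (le_div_iff₀ hp).1 hv.2⟩
      simpa [T, tauCoord, hp.ne'] using this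
  have pexp : HasPlanePartials (T ⁻¹' O) (fun z => Real.exp (b * z.1))
      (fun z => b * Real.exp (b * z.1)) fun _ => 0 := by
    refine ⟨by fun_prop, by fun_prop, by fun_prop, fun z _ => ?_⟩
    have := ((hasFDerivAt_fst (𝕜 := ℝ) (p := z)).const_mul b).exp
    refine this.congr_fderiv ?_
    ext <;> simp <;> ring
  have pU : HasPlanePartials (T ⁻¹' O) (fun z => horizonU Λ m u₀ τ₀ z.1)
      (fun z => kappa Λ m * horizonU Λ m u₀ τ₀ z.1) fun _ => 0 := by
    refine ⟨by fun_prop, by fun_prop, by fun_prop, fun z _ => ?_⟩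
    refine ((hasDerivAt_horizonU Λ m u₀ τ₀ z.1).comp_hasFDerivAt z hasFDerivAt_fst).congr_fderiv ?_
    ext <;> simp
  have pI : HasPlanePartials (T ⁻¹' O) (fun z => (horizonU Λ m u₀ τ₀ z.1)⁻¹)
      (fun z => -(kappa Λ m * (horizonU Λ m u₀ τ₀ z.1)⁻¹)) fun _ => 0 := by
    have hci : Continuous fun z : ℝ × ℝ => (horizonU Λ m u₀ τ₀ z.1)⁻¹ :=
      (hUc.comp continuous_fst).inv₀ fun z => (hUpos _).ne'
    refine ⟨hci.continuousOn, (continuous_const.mul hci).neg.continuousOn, by fun_prop, fun z _ => ?_⟩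
    have h1 := (hasDerivAt_horizonU Λ m u₀ τ₀ z.1).fun_inv (hUpos z.1).ne'
    refine (h1.comp_hasFDerivAt z hasFDerivAt_fst).congr_fderiv ?_
    have := (hUpos z.1).ne'
    ext <;> simp
    field_simp
  have pw : HasPlanePartials (T ⁻¹' O) (fun z : ℝ × ℝ => z.2) (fun _ => 0) fun _ => 1 :=
    ⟨by fun_prop, by fun_prop, by fun_prop, fun q _ =>
      hasFDerivAt_snd.congr_fderiv (by ext <;> simp)⟩
  -- The weighted current in the coordinates `(τ, w)`: `F = e^{bτ} e / u` and `G = e^{bτ} κ (u h + w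
  -- e / u)`, with `e`, `h` the cone and horizon densities. The second term of `G` appears because
  -- `w = u v` varies along lines of constant `v`.
  have pF := pexp.mul ((he.comp_tauCoord (Λ := Λ) (m := m) (τ₀ := τ₀) hu).mul pI)
  have pG := (pexp.mul (hasPlanePartials_const (kappa Λ m))).mul
    ((pU.mul (hh.comp_tauCoord (Λ := Λ) (m := m) (τ₀ := τ₀) hu)).add
    ((pw.mul pI).mul (he.comp_tauCoord (Λ := Λ) (m := m) (τ₀ := τ₀) hu)))
  have key := pF.integral_divergence pG hτ hr₀ (fun z hz => hrect z.1 hz.1 z.2 hz.2)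
  rw [hcone τ₂ ⟨hτ, le_rfl⟩, hcone τ₁ ⟨le_rfl, hτ⟩, ← intervalIntegral.integral_const_mul,
    ← intervalIntegral.integral_const_mul]
  -- The terms with `∂_v e` cancel, and the divergence is `e^{bτ} (b e / u + κ (∂_u e + ∂_v h))`,
  -- which is nonpositive by dissipation.
  have hle := key.ge.trans (intervalIntegral_nonpos hτ fun τ hτ' =>
    intervalIntegral_nonpos hr₀ fun w hw => by
      have h1 := hdiv _ (hrect τ hτ' w hw)
      have h2 : (T (τ, w)).1 = horizonU Λ m u₀ τ₀ τ := rfl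
      have h3 : (T (τ, w)).2 = w / horizonU Λ m u₀ τ₀ τ := rfl
      have h4 := (hUpos τ).ne'
      rw [h2] at h1
      refine le_of_eq_of_le ?_ (mul_nonpos_of_nonneg_of_nonpos (Real.exp_nonneg (b * τ)) h1)
      simp only [← hT, h2, h3]
      field_simp
      ring)
  have hNq : ∀ q ∈ O, 0 < (N q).1 ∧ 0 < (N q).2 := by
    intro q hq
    have h1 := hco _ (hO1 q hq).2
    have h2 := (hO1 q hq).1
    rw [hN, fieldN_profileField h2.ne']
    exact ⟨mul_pos h2 h1.fst_pos, div_pos h1.snd_pos h2⟩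
  -- The flux through `r = r₀`, that is the edge `w = w₀`. It leaves the region with a favourable
  -- sign and is dropped.
  have hpos : 0 ≤ ∫ τ in τ₁..τ₂, Real.exp (b * τ) * kappa Λ m *
      (horizonU Λ m u₀ τ₀ τ * horizonDensity Λ m N ψ (T (τ, w₀)) +
        w₀ * (horizonU Λ m u₀ τ₀ τ)⁻¹ * coneDensity Λ m N ψ (T (τ, w₀))) := by
    refine intervalIntegral.integral_nonneg hτ fun τ hτ' => ?_
    have hq := hrect τ hτ' w₀ ⟨hr₀, le_rfl⟩
    have h1 := hS.coneDensity_nonneg ψ (hO2 _ hq) (hNq _ hq).1.le (hNq _ hq).2.le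
    have h2 := hS.horizonDensity_nonneg ψ (hO2 _ hq) (hNq _ hq).1.le (hNq _ hq).2.le
    have h3 := hUpos τ
    have h4 := hS.kappa_pos
    positivity
  have hrate : ∫ τ in τ₁..τ₂, Real.exp (b * τ) * kappa Λ m *
      (horizonU Λ m u₀ τ₀ τ * horizonDensity Λ m N ψ (T (τ, 0)) +
        0 * (horizonU Λ m u₀ τ₀ τ)⁻¹ * coneDensity Λ m N ψ (T (τ, 0))) =
      ∫ τ in τ₁..τ₂, Real.exp (b * τ) * horizonRate Λ m N u₀ τ₀ ψ τ := by
    refine intervalIntegral.integral_congr fun τ _ => ?_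
    have h5 : T (τ, 0) = (horizonU Λ m u₀ τ₀ τ, 0) := by simp [hT, tauCoord]
    simp only [h5, horizonRate]
    ring
  rw [← hrate]
  simp only [← hT] at hle
  linarith

end

end SchwarzschildDeSitter

namespace SchwarzschildDeSitter

/-! ### Differences of solutions -/

section

variable {U : Set Point} {f g ψ : Point → ℝ} {p : Point} {O : Set (ℝ × ℝ)} {Λ m : ℝ}

theorem rayExt_sub (f g : Point → ℝ) :
    rayExt (fun q => f q - g q) = fun z => rayExt f z - rayExt g z := by
  funext z
  simp only [rayExt, radialExt]
  split <;> simp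

theorem IsC2On.sub (hf : IsC2On U f) (hg : IsC2On U g) : IsC2On U fun q => f q - g q := by
  intro p hp
  have := (hf.contDiffAt_rayExt hp).sub (hg.contDiffAt_rayExt hp)
  rw [← rayExt_sub] at this
  exact this

theorem IsC2On.D1_sub (hf : IsC2On U f) (hg : IsC2On U g) (hp : p ∈ U) (X : ℝ × ℝ × E3) :
    D1 (fun q => f q - g q) X p = D1 f X p - D1 g X p := by
  rw [D1, rayExt_sub, fderiv_fun_sub ((hf.contDiffAt_rayExt hp).differentiableAt (by norm_num))
    ((hg.contDiffAt_rayExt hp).differentiableAt (by norm_num))]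
  rfl

theorem IsC2On.eventually_differentiableAt' (h : IsC2On U ψ) (hp : p ∈ U) :
    ∀ᶠ z in 𝓝 (incl p), DifferentiableAt ℝ (rayExt ψ) z := by
  filter_upwards [(h.contDiffAt_rayExt hp).eventually (by simp)] with z hz
  exact hz.differentiableAt (by norm_num)

theorem IsC2On.D2_sub (hf : IsC2On U f) (hg : IsC2On U g) (hp : p ∈ U) (X Y : ℝ × ℝ × E3) :
    D2 (fun q => f q - g q) X Y p = D2 f X Y p - D2 g X Y p := by
  have h1 : (fun z => fderiv ℝ (rayExt fun q => f q - g q) z X) =ᶠ[𝓝 (incl p)]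
      fun z => fderiv ℝ (rayExt f) z X - fderiv ℝ (rayExt g) z X := by
    filter_upwards [hf.eventually_differentiableAt' hp, hg.eventually_differentiableAt' hp]
      with z h1 h2
    rw [rayExt_sub, fderiv_fun_sub h1 h2]
    rfl
  rw [D2, h1.fderiv_eq, fderiv_fun_sub ((hf.contDiffAt_fderiv hp X).differentiableAt (by norm_num))
    ((hg.contDiffAt_fderiv hp X).differentiableAt (by norm_num))]
  rfl

theorem IsC2On.dU_sub (hf : IsC2On U f) (hg : IsC2On U g) (hp : p ∈ U) :
    dU (fun q => f q - g q) p = dU f p - dU g p := by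
  rw [(hf.sub hg).dU_eq hp, hf.dU_eq hp, hg.dU_eq hp, hf.D1_sub hg hp]

theorem IsC2On.dV_sub (hf : IsC2On U f) (hg : IsC2On U g) (hp : p ∈ U) :
    dV (fun q => f q - g q) p = dV f p - dV g p := by
  rw [(hf.sub hg).dV_eq hp, hf.dV_eq hp, hg.dV_eq hp, hf.D1_sub hg hp]

/-- Linearity is taken from `box_eq`, as `box` itself is built from iterated one-variable
derivatives, which are additive only by virtue of the regularity. -/
theorem Subextremal.isClassicalSolution_sub (hS : Subextremal Λ m) (hO : IsOpen O)
    (hO1 : ∀ q ∈ O, q.1 * q.2 < 1) (hf : IsClassicalSolution Λ m (cyl O) f)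
    (hg : IsClassicalSolution Λ m (cyl O) g) :
    IsClassicalSolution Λ m (cyl O) fun q => f q - g q := by
  have hd := hf.1.sub hg.1
  refine ⟨hd, fun p hp => ?_⟩
  have e1 := hS.box_eq hO hO1 hf.1 hp
  have e2 := hS.box_eq hO hO1 hg.1 hp
  have e3 := hS.box_eq hO hO1 hd hp
  rw [hf.2 p hp] at e1
  rw [hg.2 p hp] at e2
  rw [hf.1.dU_sub hg.1 hp, hf.1.dV_sub hg.1 hp, hd.sphereLaplacian_eq hp,
    hf.1.D2_sub hg.1 hp] at e3
  rw [hf.1.sphereLaplacian_eq hp] at e1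
  rw [hg.1.sphereLaplacian_eq hp] at e2
  simp only [hf.1.D2_sub hg.1 hp, Finset.sum_sub_distrib] at e3
  have h1 := hS.omegaSq_pos (hO1 _ hp)
  have h2 := hS.radius_pos (hO1 _ hp)
  have : omegaSq Λ m (toQ p) * radius Λ m (toQ p) ^ 2 * box Λ m (fun q => f q - g q) p = 0 := by
    linear_combination e3 - e1 + e2
  have h3 : omegaSq Λ m (toQ p) * radius Λ m (toQ p) ^ 2 ≠ 0 := by positivity
  exact (mul_eq_zero.1 this).resolve_left h3

/-! ### The energy of the spheres -/

/-- The energy density integrated over the spheres. -/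
noncomputable def sphereEnergy (ψ : Point → ℝ) (q : ℝ × ℝ) : ℝ :=
  intUU ψ q + intVV ψ q + intSS ψ q

theorem sphereEnergy_nonneg (ψ : Point → ℝ) (q : ℝ × ℝ) : 0 ≤ sphereEnergy ψ q :=
  add_nonneg (add_nonneg (intUU_nonneg ψ q) (intVV_nonneg ψ q)) (intSS_nonneg ψ q)

theorem IsC2On.continuousOn_sphereEnergy (hO : IsOpen O) (h : IsC2On (cyl O) ψ) :
    ContinuousOn (sphereEnergy ψ) O :=
  ((h.hasPlanePartials_intUU hO).cont.add (h.hasPlanePartials_intVV hO).cont).add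
    (h.hasPlanePartials_intSS hO).cont

theorem IsC2On.abs_intUV_le (h : IsC2On (cyl O) ψ) {q : ℝ × ℝ} (hq : q ∈ O) :
    |intUV ψ q| ≤ intUU ψ q + intVV ψ q := by
  have h1 := h.quadratic_int_nonneg hq (a := 1) (b := 1) (c := 1) fun x y => by
    nlinarith [sq_nonneg (x + y), sq_nonneg x, sq_nonneg y]
  have h2 := h.quadratic_int_nonneg hq (a := 1) (b := 1) (c := -1) fun x y => by
    nlinarith [sq_nonneg (x - y), sq_nonneg x, sq_nonneg y]
  rw [abs_le]
  constructor <;> linarith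

end

/-! ### Rectangles -/

/-- The weights used for traces and for Green's formula vanish on edges of a rectangle and are
bounded below only inside. The estimates are made on a slightly larger rectangle for this reason. -/
theorem exists_thickened_rectangle {O : Set (ℝ × ℝ)} (hO : IsOpen O) {u₁ u₂ v₁ v₂ : ℝ}
    (hu : u₁ ≤ u₂) (hv : v₁ ≤ v₂) (h : Icc u₁ u₂ ×ˢ Icc v₁ v₂ ⊆ O) :
    ∃ ε > 0, Icc (u₁ - ε) (u₂ + ε) ×ˢ Icc (v₁ - ε) (v₂ + ε) ⊆ O := by
  obtain ⟨ε, hε, hsub⟩ := (isCompact_Icc.prod isCompact_Icc).exists_cthickening_subset_open hO h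
  refine ⟨ε, hε, fun q hq => hsub ?_⟩
  have key : ∀ {s t x : ℝ}, s ≤ t → x ∈ Icc (s - ε) (t + ε) →
      max s (min x t) ∈ Icc s t ∧ |x - max s (min x t)| ≤ ε := by
    intro s t x hst hx
    refine ⟨⟨le_max_left _ _, max_le hst (min_le_right _ _)⟩, ?_⟩
    rcases le_total x t with h1 | h1
    · rw [min_eq_left h1]
      rcases le_total s x with h2 | h2
      · rw [max_eq_right h2]; simpa using hε.le
      · rw [max_eq_left h2, abs_le]; constructor <;> linarith [hx.1]
    · rw [min_eq_right h1, max_eq_right hst, abs_le]; constructor <;> linarith [hx.2]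
  have hq1 := key hu hq.1
  have hq2 := key hv hq.2
  refine Metric.mem_cthickening_of_dist_le q (max u₁ (min q.1 u₂), max v₁ (min q.2 v₂)) _ _
    ⟨hq1.1, hq2.1⟩ ?_
  rw [Prod.dist_eq, max_le_iff, Real.dist_eq, Real.dist_eq]
  exact ⟨hq1.2, hq2.2⟩

section

variable {Λ m : ℝ} {O : Set (ℝ × ℝ)}

theorem continuousOn_integral_rectangle_eq {F : ℝ × ℝ → ℝ} {u₁ u₂ v₁ v₂ : ℝ} (hu : u₁ ≤ u₂)
    (hv : v₁ ≤ v₂) (hF : ContinuousOn F (Icc u₁ u₂ ×ˢ Icc v₁ v₂)) :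
    ∫ x in u₁..u₂, ∫ y in v₁..v₂, F (x, y) = ∫ q in Icc u₁ u₂ ×ˢ Icc v₁ v₂, F q := by
  have hi : IntegrableOn F (Icc u₁ u₂ ×ˢ Icc v₁ v₂) :=
    hF.integrableOn_compact (isCompact_Icc.prod isCompact_Icc)
  rw [Measure.volume_eq_prod, setIntegral_prod _ hi, intervalIntegral.integral_of_le hu,
    integral_Icc_eq_integral_Ioc]
  refine setIntegral_congr_fun measurableSet_Ioc fun x _ => ?_
  rw [intervalIntegral.integral_of_le hv, integral_Icc_eq_integral_Ioc]

/-- The fluxes through the two past edges of a rectangle are bounded by the energy in it. -/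
theorem Subextremal.exists_trace_bound (hS : Subextremal Λ m) (hO : IsOpen O)
    (hO1 : ∀ q ∈ O, q.1 * q.2 < 1) {N : ℝ × ℝ → ℝ × ℝ} {Pu Pv Qu Qv : ℝ × ℝ → ℝ}
    (hP : HasPlanePartials O (fun q => (N q).1) Pu Pv)
    (hQ : HasPlanePartials O (fun q => (N q).2) Qu Qv)
    (hN : ∀ q ∈ O, 0 ≤ (N q).1 ∧ 0 ≤ (N q).2) {u₁ u₂ v₁ v₂ : ℝ} (hu : u₁ < u₂) (hv : v₁ < v₂)
    (hR : Icc u₁ u₂ ×ˢ Icc v₁ v₂ ⊆ O) :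
    ∃ C : ℝ, ∀ ψ : Point → ℝ, IsClassicalSolution Λ m (cyl O) ψ →
      (v₂ - v₁) * (∫ u in u₁..u₂, (u₂ - u) * horizonDensity Λ m N ψ (u, v₁)) ≤
        C * ∫ q in Icc u₁ u₂ ×ˢ Icc v₁ v₂, sphereEnergy ψ q ∧
      (u₂ - u₁) * (∫ v in v₁..v₂, (v₂ - v) * coneDensity Λ m N ψ (u₁, v)) ≤
        C * ∫ q in Icc u₁ u₂ ×ˢ Icc v₁ v₂, sphereEnergy ψ q := by
  -- This weight is nonnegative and vanishes on both future edges, so in the divergence theorem only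
  -- the past edges survive.
  have hχ : HasPlanePartials O (fun q => (u₂ - q.1) * (v₂ - q.2)) (fun q => -(v₂ - q.2))
      fun q => -(u₂ - q.1) := by
    refine ⟨by fun_prop, by fun_prop, by fun_prop, fun q _ => ?_⟩
    have := ((hasFDerivAt_fst (𝕜 := ℝ) (p := q)).const_sub u₂).mul
      ((hasFDerivAt_snd (𝕜 := ℝ) (p := q)).const_sub v₂)
    refine this.congr_fderiv ?_
    ext <;> simp
  have hP' := hχ.mul hP
  have hQ' := hχ.mul hQ
  have hr := (hS.hasPlanePartials_radius hO1).cont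
  have hr' : ContinuousOn (fun q : ℝ × ℝ => deriv (areaRadius Λ m) (q.1 * q.2)) O :=
    hS.contDiffOn_deriv_areaRadius.continuousOn.comp (by fun_prop) hO1
  have hl : ContinuousOn (fun q : ℝ × ℝ => logDerivOmega Λ m (q.1 * q.2)) O :=
    hS.contDiffOn_logDerivOmega.continuousOn.comp (by fun_prop) hO1
  have hΩ := (hS.hasPlanePartials_omegaSq hO1).cont
  have hK : IsCompact (Icc u₁ u₂ ×ˢ Icc v₁ v₂) := isCompact_Icc.prod isCompact_Icc
  -- `M₁`, `M₂`, `M₃`, `M₄` bound the coefficients of `intVV`, `intUU`, `intUV` and `intSS` in the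
  -- divergence of the weighted current. They depend on the rectangle and `N`, not on `ψ`.
  obtain ⟨M₁, hM₁⟩ := hK.exists_bound_of_continuousOn
    (((hr.pow 2).mul hQ'.cont_u).mono hR)
  obtain ⟨M₂, hM₂⟩ := hK.exists_bound_of_continuousOn
    (((hr.pow 2).mul hP'.cont_v).mono hR)
  obtain ⟨M₃, hM₃⟩ := hK.exists_bound_of_continuousOn
    ((((continuousOn_const (c := (2 : ℝ))).mul hr).mul hr' |>.mul
      ((continuousOn_fst.mul hQ'.cont).add (continuousOn_snd.mul hP'.cont))).mono hR)
  obtain ⟨M₄, hM₄⟩ := hK.exists_bound_of_continuousOn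
    (((hΩ.div_const 4).mul ((hP'.cont_u.add hQ'.cont_v).add (hl.mul
      ((continuousOn_snd.mul hP'.cont).add (continuousOn_fst.mul hQ'.cont))))).mono hR)
  refine ⟨|M₁| + |M₂| + |M₃| + |M₄|, fun ψ hψ => ?_⟩
  obtain ⟨eu, ev, hu', hv', he, hh, hdiv⟩ := hS.exists_divergence hO hO1 hψ hP' hQ'
  have key := he.integral_divergence hh hu.le hv.le hR
  have hcont : ContinuousOn (fun q => eu q + hv' q) (Icc u₁ u₂ ×ˢ Icc v₁ v₂) :=
    (he.cont_u.add hh.cont_v).mono hR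
  have hen : IntegrableOn (sphereEnergy ψ) (Icc u₁ u₂ ×ˢ Icc v₁ v₂) :=
    ((hψ.1.continuousOn_sphereEnergy hO).mono hR).integrableOn_compact hK
  rw [continuousOn_integral_rectangle_eq (F := fun q => eu q + hv' q) hu.le hv.le hcont] at key
  have hle : -∫ q in Icc u₁ u₂ ×ˢ Icc v₁ v₂, (eu q + hv' q) ≤
      (|M₁| + |M₂| + |M₃| + |M₄|) * ∫ q in Icc u₁ u₂ ×ˢ Icc v₁ v₂, sphereEnergy ψ q := by
    rw [← integral_neg, ← integral_const_mul]
    refine setIntegral_mono_on (hcont.integrableOn_compact hK).neg (hen.const_mul _)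
      hK.measurableSet fun q hq => ?_
    rw [hdiv q (hR hq)]
    have b1 := (hM₁ q hq).trans (le_abs_self M₁)
    have b2 := (hM₂ q hq).trans (le_abs_self M₂)
    have b3 := (hM₃ q hq).trans (le_abs_self M₃)
    have b4 := (hM₄ q hq).trans (le_abs_self M₄)
    have n1 := intUU_nonneg ψ q
    have n2 := intVV_nonneg ψ q
    have n3 := intSS_nonneg ψ q
    have n4 := hψ.1.abs_intUV_le (hR hq)
    simp only [Pi.add_apply, Pi.mul_apply, Pi.pow_apply, Real.norm_eq_abs] at b1 b2 b3 b4
    have a1 := mul_le_mul_of_nonneg_right ((neg_le_abs _).trans b1) n2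
    have a2 := mul_le_mul_of_nonneg_right ((neg_le_abs _).trans b2) n1
    have a4 := mul_le_mul_of_nonneg_right ((neg_le_abs _).trans b4) n3
    have a3 := (le_abs_self _).trans ((abs_mul _ _).le.trans
      (mul_le_mul b3 n4 (abs_nonneg (intUV ψ q)) (abs_nonneg M₃)))
    have e1 := mul_nonneg (abs_nonneg M₁) (add_nonneg n1 n3)
    have e2 := mul_nonneg (abs_nonneg M₂) (add_nonneg n2 n3)
    have e3 := mul_nonneg (abs_nonneg M₃) n3
    have e4 := mul_nonneg (abs_nonneg M₄) (add_nonneg n1 n2)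
    simp only [sphereEnergy]
    linarith
  have z1 : ∫ u in u₁..u₂, ((u₂ - u) * (v₂ - v₂) * (N (u, v₂)).1 * radius Λ m (u, v₂) ^ 2 *
      intUU ψ (u, v₂) + (u₂ - u) * (v₂ - v₂) * (N (u, v₂)).2 * (omegaSq Λ m (u, v₂) / 4) *
      intSS ψ (u, v₂)) = 0 := by simp
  have z2 : ∫ v in v₁..v₂, ((u₂ - u₂) * (v₂ - v) * (N (u₂, v)).2 * radius Λ m (u₂, v) ^ 2 *
      intVV ψ (u₂, v) + (u₂ - u₂) * (v₂ - v) * (N (u₂, v)).1 * (omegaSq Λ m (u₂, v) / 4) *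
      intSS ψ (u₂, v)) = 0 := by simp
  have z3 : ∫ u in u₁..u₂, ((u₂ - u) * (v₂ - v₁) * (N (u, v₁)).1 * radius Λ m (u, v₁) ^ 2 *
      intUU ψ (u, v₁) + (u₂ - u) * (v₂ - v₁) * (N (u, v₁)).2 * (omegaSq Λ m (u, v₁) / 4) *
      intSS ψ (u, v₁)) = (v₂ - v₁) * ∫ u in u₁..u₂, (u₂ - u) * horizonDensity Λ m N ψ (u, v₁) := by
    rw [← intervalIntegral.integral_const_mul]
    refine intervalIntegral.integral_congr fun u _ => ?_
    simp only [horizonDensity]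
    ring
  have z4 : ∫ v in v₁..v₂, ((u₂ - u₁) * (v₂ - v) * (N (u₁, v)).2 * radius Λ m (u₁, v) ^ 2 *
      intVV ψ (u₁, v) + (u₂ - u₁) * (v₂ - v) * (N (u₁, v)).1 * (omegaSq Λ m (u₁, v) / 4) *
      intSS ψ (u₁, v)) = (u₂ - u₁) * ∫ v in v₁..v₂, (v₂ - v) * coneDensity Λ m N ψ (u₁, v) := by
    rw [← intervalIntegral.integral_const_mul]
    refine intervalIntegral.integral_congr fun v _ => ?_
    simp only [coneDensity]
    ring
  rw [z1, z2, z3, z4] at key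
  -- The estimate controls the sum of the two past fluxes; as both are nonnegative, it controls each
  -- of them.
  have p1 : 0 ≤ (v₂ - v₁) * ∫ u in u₁..u₂, (u₂ - u) * horizonDensity Λ m N ψ (u, v₁) := by
    refine mul_nonneg (sub_nonneg.2 hv.le) (intervalIntegral.integral_nonneg hu.le fun u hu' => ?_)
    have hq := hR (⟨hu', ⟨le_rfl, hv.le⟩⟩ : (u, v₁) ∈ Icc u₁ u₂ ×ˢ Icc v₁ v₂)
    exact mul_nonneg (sub_nonneg.2 hu'.2)
      (hS.horizonDensity_nonneg ψ (hO1 _ hq) (hN _ hq).1 (hN _ hq).2)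
  have p2 : 0 ≤ (u₂ - u₁) * ∫ v in v₁..v₂, (v₂ - v) * coneDensity Λ m N ψ (u₁, v) := by
    refine mul_nonneg (sub_nonneg.2 hu.le) (intervalIntegral.integral_nonneg hv.le fun v hv' => ?_)
    have hq := hR (⟨⟨le_rfl, hu.le⟩, hv'⟩ : (u₁, v) ∈ Icc u₁ u₂ ×ˢ Icc v₁ v₂)
    exact mul_nonneg (sub_nonneg.2 hv'.2)
      (hS.coneDensity_nonneg ψ (hO1 _ hq) (hN _ hq).1 (hN _ hq).2)
  constructor <;> linarith

end

end SchwarzschildDeSitter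

namespace SchwarzschildDeSitter

/-! ### Green's formula on cylinders over rectangles -/

noncomputable section

/-- A polynomial that is positive inside of a rectangle and vanishes on its boundary. -/
def cutoff (u₁ u₂ v₁ v₂ : ℝ) (q : ℝ × ℝ) : ℝ :=
  ((q.1 - u₁) * (u₂ - q.1)) * ((q.2 - v₁) * (v₂ - q.2))

/-- The polarization of the energy density. -/
def gradInner (f g : Point → ℝ) (p : Point) : ℝ :=
  D1 f eU p * D1 g eU p + D1 f eV p * D1 g eV p + ∑ i, D1 f (eS i) p * D1 g (eS i) p

/-- The divergence of the gradient of `g`, multiplied by the cutoff. -/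
def cutoffDiv (u₁ u₂ v₁ v₂ : ℝ) (g : Point → ℝ) (p : Point) : ℝ :=
  (u₁ + u₂ - 2 * p.1) * ((p.2.1 - v₁) * (v₂ - p.2.1)) * D1 g eU p +
    (p.1 - u₁) * (u₂ - p.1) * (v₁ + v₂ - 2 * p.2.1) * D1 g eV p +
    cutoff u₁ u₂ v₁ v₂ (toQ p) * (D2 g eU eU p + D2 g eV eV p + sphereLaplacian g p)

end

section

variable {O : Set (ℝ × ℝ)} {f g ψ : Point → ℝ} {u₁ u₂ v₁ v₂ : ℝ}

theorem continuous_cutoff (u₁ u₂ v₁ v₂ : ℝ) : Continuous (cutoff u₁ u₂ v₁ v₂) := by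
  unfold cutoff; fun_prop

theorem hasPlanePartials_cutoff (O : Set (ℝ × ℝ)) (u₁ u₂ v₁ v₂ : ℝ) :
    HasPlanePartials O (cutoff u₁ u₂ v₁ v₂)
      (fun q => (u₁ + u₂ - 2 * q.1) * ((q.2 - v₁) * (v₂ - q.2)))
      fun q => (q.1 - u₁) * (u₂ - q.1) * (v₁ + v₂ - 2 * q.2) := by
  refine ⟨(continuous_cutoff _ _ _ _).continuousOn, by fun_prop, by fun_prop, fun q _ => ?_⟩
  have h1 := (hasFDerivAt_fst (𝕜 := ℝ) (p := q))
  have h2 := (hasFDerivAt_snd (𝕜 := ℝ) (p := q))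
  have := ((h1.sub_const u₁).mul (h1.const_sub u₂)).mul ((h2.sub_const v₁).mul (h2.const_sub v₂))
  refine this.congr_fderiv ?_
  ext <;> simp <;> ring

theorem cutoff_nonneg {q : ℝ × ℝ} (hq : q ∈ Icc u₁ u₂ ×ˢ Icc v₁ v₂) :
    0 ≤ cutoff u₁ u₂ v₁ v₂ q :=
  mul_nonneg (mul_nonneg (sub_nonneg.2 hq.1.1) (sub_nonneg.2 hq.1.2))
    (mul_nonneg (sub_nonneg.2 hq.2.1) (sub_nonneg.2 hq.2.2))

theorem IsC2On.continuousOn_gradInner (hf : IsC2On (cyl O) f) (hg : IsC2On (cyl O) g) :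
    ContinuousOn (gradInner f g) (cyl O) := by
  have h1 := fun X => hf.continuousOn_D1 X
  have h2 := fun X => hg.continuousOn_D1 X
  exact (((h1 _).mul (h2 _)).add ((h1 _).mul (h2 _))).add
    (continuousOn_finsetSum _ fun i _ => (h1 _).mul (h2 _))

theorem IsC2On.continuousOn_cutoffDiv (hg : IsC2On (cyl O) g) :
    ContinuousOn (cutoffDiv u₁ u₂ v₁ v₂ g) (cyl O) := by
  have h1 := fun X => hg.continuousOn_D1 X
  have h2 := fun X => hg.continuousOn_D2 X X
  have h3 := hg.continuousOn_sphereLaplacian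
  have h4 : Continuous fun p => cutoff u₁ u₂ v₁ v₂ (toQ p) :=
    (continuous_cutoff _ _ _ _).comp continuous_toQ
  refine ContinuousOn.add (ContinuousOn.add ?_ ?_) ?_
  · exact ContinuousOn.mul (by fun_prop) (h1 _)
  · exact ContinuousOn.mul (by fun_prop) (h1 _)
  · exact h4.continuousOn.mul (((h2 _).add (h2 _)).add h3)

/-- Integration by parts in `u` and `v` on the rectangle and over each sphere, with the coordinate
Riemannian metric. It places all derivatives on `g`, which is what closability of the gradient rests
on. -/
theorem IsC2On.integral_cutoff_mul_gradInner (hO : IsOpen O) (hf : IsC2On (cyl O) f)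
    (hg : IsC2On (cyl O) g) (hu : u₁ ≤ u₂) (hv : v₁ ≤ v₂) (hR : Icc u₁ u₂ ×ˢ Icc v₁ v₂ ⊆ O) :
    ∫ q in Icc u₁ u₂ ×ˢ Icc v₁ v₂, cutoff u₁ u₂ v₁ v₂ q * sphereInt (gradInner f g) q =
      -∫ q in Icc u₁ u₂ ×ˢ Icc v₁ v₂, sphereInt (fun p => f p * cutoffDiv u₁ u₂ v₁ v₂ g p) q := by
  have hU := (hasPlanePartials_cutoff O u₁ u₂ v₁ v₂).mul
    ((hf.hasPartials.mul (hg.hasPartials_D1 eU)).sphereInt hO)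
  have hV := (hasPlanePartials_cutoff O u₁ u₂ v₁ v₂).mul
    ((hf.hasPartials.mul (hg.hasPartials_D1 eV)).sphereInt hO)
  have key := hU.integral_divergence hV hu hv hR
  have hcont := (hU.cont_u.add hV.cont_v).mono hR
  have hK : IsCompact (Icc u₁ u₂ ×ˢ Icc v₁ v₂) := isCompact_Icc.prod isCompact_Icc
  have k2 := (continuousOn_integral_rectangle_eq hu hv hcont).symm.trans key
  have z : ∀ t s : ℝ, cutoff u₁ u₂ v₁ v₂ (t, v₁) = 0 ∧ cutoff u₁ u₂ v₁ v₂ (t, v₂) = 0 ∧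
      cutoff u₁ u₂ v₁ v₂ (u₁, s) = 0 ∧ cutoff u₁ u₂ v₁ v₂ (u₂, s) = 0 := by
    intro t s; simp [cutoff]
  -- The cutoff vanishes on all four edges, so no boundary term remains.
  simp only [fun t => (z t 0).1, fun t => (z t 0).2.1, fun s => (z 0 s).2.2.1,
    fun s => (z 0 s).2.2.2, zero_mul, intervalIntegral.integral_zero, sub_zero, add_zero] at k2
  have hc1 := hf.continuousOn_gradInner hg
  have hc2 : ContinuousOn (fun p => f p * cutoffDiv u₁ u₂ v₁ v₂ g p) (cyl O) :=
    hf.continuousOn.mul hg.continuousOn_cutoffDiv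
  have i1 : IntegrableOn (fun q => cutoff u₁ u₂ v₁ v₂ q * sphereInt (gradInner f g) q)
      (Icc u₁ u₂ ×ˢ Icc v₁ v₂) :=
    (((continuous_cutoff _ _ _ _).continuousOn.mul (continuousOn_sphereInt hc1)).mono
      hR).integrableOn_compact hK
  have i2 : IntegrableOn (sphereInt fun p => f p * cutoffDiv u₁ u₂ v₁ v₂ g p)
      (Icc u₁ u₂ ×ˢ Icc v₁ v₂) :=
    ((continuousOn_sphereInt hc2).mono hR).integrableOn_compact hK
  rw [eq_neg_iff_add_eq_zero, ← integral_add i1 i2, ← k2]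
  refine setIntegral_congr_fun hK.measurableSet fun q hq => ?_
  have hq' := hR hq
  have hlap := hf.sphereInt_mul_laplacian hg (q := q) fun x => hq'
  have cf := hf.continuousOn
  have c1 := fun X => hg.continuousOn_D1 X
  have c2 := fun X => hg.continuousOn_D2 X X
  have c3 := hg.continuousOn_sphereLaplacian
  have c1f := fun X => hf.continuousOn_D1 X
  have cs : ContinuousOn (fun p => f p * sphereLaplacian g p +
      ∑ i, D1 f (eS i) p * D1 g (eS i) p) (cyl O) :=
    (cf.mul c3).add (continuousOn_finsetSum _ fun i _ => (c1f _).mul (c1 _))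
  have cu := (hf.hasPartials.mul (hg.hasPartials_D1 eU))
  have cv := (hf.hasPartials.mul (hg.hasPartials_D1 eV))
  have hlap' : cutoff u₁ u₂ v₁ v₂ q * sphereInt (fun p => f p * sphereLaplacian g p +
      ∑ i, D1 f (eS i) p * D1 g (eS i) p) q = 0 := by rw [hlap, mul_zero]
  simp only [Pi.add_apply]
  simp only [← sphereInt_const_mul] at hlap' ⊢
  have m : ∀ {F : Point → ℝ} (t : ℝ), ContinuousOn F (cyl O) →
    ContinuousOn (fun p => t * F p) (cyl O) := fun t h => continuousOn_const.mul h
  rw [← sphereInt_add (m _ hc1) hc2 hq', ← sphereInt_add (m _ cu.cont) (m _ cu.cont_u) hq',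
    ← sphereInt_add (m _ cv.cont) (m _ cv.cont_v) hq',
    ← sphereInt_add ((m _ cu.cont).fun_add (m _ cu.cont_u))
      ((m _ cv.cont).fun_add (m _ cv.cont_v)) hq']
  refine Eq.trans ?_ (add_zero _)
  rw [← hlap', ← sphereInt_add (((m _ cu.cont).fun_add (m _ cu.cont_u)).fun_add
      ((m _ cv.cont).fun_add (m _ cv.cont_v))) (m _ cs) hq']
  refine sphereInt_congr fun x => ?_
  simp only [gradInner, cutoffDiv, toQ]
  ring

theorem IsC2On.sphereEnergy_eq (hf : IsC2On (cyl O) f) {q : ℝ × ℝ} (hq : q ∈ O) :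
    sphereEnergy f q = sphereInt (gradInner f f) q := by
  rw [sphereEnergy, intUU, intVV, intSS, ← sphereInt_add (hf.continuousOn_dU.fun_pow 2)
    (hf.continuousOn_dV.fun_pow 2) hq, ← sphereInt_add ((hf.continuousOn_dU.fun_pow 2).fun_add
    (hf.continuousOn_dV.fun_pow 2)) hf.continuousOn_sphereGradSq hq]
  refine sphereInt_congr fun x => ?_
  have hx : (q.1, q.2, x) ∈ cyl O := hq
  rw [hf.dU_eq hx, hf.dV_eq hx, hf.sphereGradSq_eq hx, gradInner]
  simp only [sq]

theorem IsC2On.sphereEnergy_sub (hf : IsC2On (cyl O) f) (hg : IsC2On (cyl O) g) {q : ℝ × ℝ}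
    (hq : q ∈ O) : sphereEnergy (fun p => f p - g p) q =
      sphereEnergy f q + sphereEnergy g q - 2 * sphereInt (gradInner f g) q := by
  rw [(hf.sub hg).sphereEnergy_eq hq, hf.sphereEnergy_eq hq, hg.sphereEnergy_eq hq,
    eq_sub_iff_add_eq, ← sphereInt_const_mul,
    ← sphereInt_add ((hf.sub hg).continuousOn_gradInner (hf.sub hg))
      (continuousOn_const.fun_mul (hf.continuousOn_gradInner hg)) hq,
    ← sphereInt_add (hf.continuousOn_gradInner hf) (hg.continuousOn_gradInner hg) hq]
  refine sphereInt_congr fun x => ?_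
  have hx : (q.1, q.2, x) ∈ cyl O := hq
  simp only [gradInner, hf.D1_sub hg hx, Finset.mul_sum, mul_add]
  have : ∑ i, (D1 f (eS i) (q.1, q.2, x) - D1 g (eS i) (q.1, q.2, x)) *
      (D1 f (eS i) (q.1, q.2, x) - D1 g (eS i) (q.1, q.2, x)) =
      ∑ i, D1 f (eS i) (q.1, q.2, x) * D1 f (eS i) (q.1, q.2, x) +
      ∑ i, D1 g (eS i) (q.1, q.2, x) * D1 g (eS i) (q.1, q.2, x) -
      ∑ i, 2 * (D1 f (eS i) (q.1, q.2, x) * D1 g (eS i) (q.1, q.2, x)) := by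
    rw [← Finset.sum_add_distrib, ← Finset.sum_sub_distrib]
    exact Finset.sum_congr rfl fun i _ => by ring
  rw [this]
  ring

/-- The localized energy of `g` is controlled by the energy of `f - g`, up to a multiple of the
square integral of `f`. -/
theorem IsC2On.exists_energy_le (hO : IsOpen O) (hg : IsC2On (cyl O) g) (hu : u₁ ≤ u₂)
    (hv : v₁ ≤ v₂) (hR : Icc u₁ u₂ ×ˢ Icc v₁ v₂ ⊆ O) :
    ∃ M : ℝ, ∀ f : Point → ℝ, IsC2On (cyl O) f → ∀ η > 0,
      ∫ q in Icc u₁ u₂ ×ˢ Icc v₁ v₂, cutoff u₁ u₂ v₁ v₂ q * sphereEnergy g q ≤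
        (∫ q in Icc u₁ u₂ ×ˢ Icc v₁ v₂, cutoff u₁ u₂ v₁ v₂ q *
          sphereEnergy (fun p => f p - g p) q) +
        η * M + η⁻¹ * ∫ q in Icc u₁ u₂ ×ˢ Icc v₁ v₂, sphereInt (fun p => f p ^ 2) q := by
  have hK : IsCompact (Icc u₁ u₂ ×ˢ Icc v₁ v₂) := isCompact_Icc.prod isCompact_Icc
  have hχ := (continuous_cutoff u₁ u₂ v₁ v₂).continuousOn (s := O)
  have hH := hg.continuousOn_cutoffDiv (u₁ := u₁) (u₂ := u₂) (v₁ := v₁) (v₂ := v₂)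
  have int : ∀ {F : ℝ × ℝ → ℝ}, ContinuousOn F O → IntegrableOn F (Icc u₁ u₂ ×ˢ Icc v₁ v₂) :=
    fun h => (h.mono hR).integrableOn_compact hK
  refine ⟨∫ q in Icc u₁ u₂ ×ˢ Icc v₁ v₂,
    sphereInt (fun p => cutoffDiv u₁ u₂ v₁ v₂ g p ^ 2) q, fun f hf η hη => ?_⟩
  have green := hf.integral_cutoff_mul_gradInner hO hg hu hv hR
  have i1 := int (hχ.fun_mul (hg.continuousOn_sphereEnergy hO))
  have i2 := int (hχ.fun_mul (hf.continuousOn_sphereEnergy hO))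
  have i3 := int (hχ.fun_mul ((hf.sub hg).continuousOn_sphereEnergy hO))
  have i4 := int (hχ.fun_mul (continuousOn_sphereInt (hf.continuousOn_gradInner hg)))
  have e1 : ∫ q in Icc u₁ u₂ ×ˢ Icc v₁ v₂, cutoff u₁ u₂ v₁ v₂ q *
      sphereEnergy (fun p => f p - g p) q =
      (∫ q in Icc u₁ u₂ ×ˢ Icc v₁ v₂, cutoff u₁ u₂ v₁ v₂ q * sphereEnergy f q) +
      (∫ q in Icc u₁ u₂ ×ˢ Icc v₁ v₂, cutoff u₁ u₂ v₁ v₂ q * sphereEnergy g q) -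
      2 * ∫ q in Icc u₁ u₂ ×ˢ Icc v₁ v₂, cutoff u₁ u₂ v₁ v₂ q * sphereInt (gradInner f g) q := by
    rw [← integral_const_mul, ← integral_add i2 i1, ← integral_sub
      (f := fun q => cutoff u₁ u₂ v₁ v₂ q * sphereEnergy f q + cutoff u₁ u₂ v₁ v₂ q *
        sphereEnergy g q) (i2.add i1) (i4.const_mul 2)]
    refine setIntegral_congr_fun hK.measurableSet fun q hq => ?_
    simp only [hf.sphereEnergy_sub hg (hR hq)]
    ring
  have e2 : 0 ≤ ∫ q in Icc u₁ u₂ ×ˢ Icc v₁ v₂, cutoff u₁ u₂ v₁ v₂ q * sphereEnergy f q :=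
    setIntegral_nonneg hK.measurableSet fun q hq =>
      mul_nonneg (cutoff_nonneg hq) (sphereEnergy_nonneg f q)
  have c1 : ContinuousOn (fun p => cutoffDiv u₁ u₂ v₁ v₂ g p ^ 2) (cyl O) := hH.pow 2
  have c2 : ContinuousOn (fun p => f p ^ 2) (cyl O) := hf.continuousOn.pow 2
  have c3 : ContinuousOn (fun p => f p * cutoffDiv u₁ u₂ v₁ v₂ g p) (cyl O) :=
    hf.continuousOn.mul hH
  -- Young's inequality with parameter `η`. The factor of `η` depends on `g` alone and that of `η⁻¹`
  -- on `f` alone, so the limits in `f` and then in `η` can be taken in turn.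
  have e3 : -2 * ∫ q in Icc u₁ u₂ ×ˢ Icc v₁ v₂,
      sphereInt (fun p => f p * cutoffDiv u₁ u₂ v₁ v₂ g p) q ≤
      η * (∫ q in Icc u₁ u₂ ×ˢ Icc v₁ v₂, sphereInt (fun p => cutoffDiv u₁ u₂ v₁ v₂ g p ^ 2) q) +
      η⁻¹ * ∫ q in Icc u₁ u₂ ×ˢ Icc v₁ v₂, sphereInt (fun p => f p ^ 2) q := by
    have j1 := int (continuousOn_sphereInt c1)
    have j2 := int (continuousOn_sphereInt c2)
    have j3 := int (continuousOn_sphereInt c3)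
    rw [← integral_const_mul, ← integral_const_mul, ← integral_const_mul,
      ← integral_add (j1.const_mul η) (j2.const_mul η⁻¹)]
    refine setIntegral_mono_on (j3.const_mul _) ((j1.const_mul η).add (j2.const_mul η⁻¹))
      hK.measurableSet fun q hq => ?_
    simp only [← sphereInt_const_mul]
    rw [← sphereInt_add (continuousOn_const.fun_mul c1) (continuousOn_const.fun_mul c2) (hR hq)]
    refine integral_mono (integrable_slice (continuousOn_const.fun_mul c3) (hR hq)) (integrable_slice
      ((continuousOn_const.fun_mul c1).fun_add (continuousOn_const.fun_mul c2)) (hR hq)) fun x => ?_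
    have h0 : 0 ≤ η⁻¹ * (f (q.1, q.2, x) + η * cutoffDiv u₁ u₂ v₁ v₂ g (q.1, q.2, x)) ^ 2 := by
      positivity
    have h1 : η⁻¹ * (f (q.1, q.2, x) + η * cutoffDiv u₁ u₂ v₁ v₂ g (q.1, q.2, x)) ^ 2 =
        η * cutoffDiv u₁ u₂ v₁ v₂ g (q.1, q.2, x) ^ 2 + η⁻¹ * f (q.1, q.2, x) ^ 2 +
        2 * (f (q.1, q.2, x) * cutoffDiv u₁ u₂ v₁ v₂ g (q.1, q.2, x)) := by
      field_simp
      ring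
    simp only
    linarith
  linarith

/-- A sequence that converges to zero in `L ^ 2` and is a Cauchy sequence in energy converges to
zero in energy, away from the boundary. -/
theorem tendsto_cutoff_energy (hO : IsOpen O) (hu : u₁ ≤ u₂)
    (hv : v₁ ≤ v₂) (hR : Icc u₁ u₂ ×ˢ Icc v₁ v₂ ⊆ O) {d : ℕ → Point → ℝ}
    (hd : ∀ j, IsC2On (cyl O) (d j))
    (h0 : Tendsto (fun j => ∫ q in Icc u₁ u₂ ×ˢ Icc v₁ v₂, sphereInt (fun p => d j p ^ 2) q)
      atTop (𝓝 0))
    (hc : Tendsto (fun j : ℕ × ℕ => ∫ q in Icc u₁ u₂ ×ˢ Icc v₁ v₂,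
      sphereEnergy (fun p => d j.1 p - d j.2 p) q) atTop (𝓝 0)) :
    Tendsto (fun j => ∫ q in Icc u₁ u₂ ×ˢ Icc v₁ v₂,
      cutoff u₁ u₂ v₁ v₂ q * sphereEnergy (d j) q) atTop (𝓝 0) := by
  have hK : IsCompact (Icc u₁ u₂ ×ˢ Icc v₁ v₂) := isCompact_Icc.prod isCompact_Icc
  obtain ⟨C, hC⟩ := hK.exists_bound_of_continuousOn (continuous_cutoff u₁ u₂ v₁ v₂).continuousOn
  have hχ := (continuous_cutoff u₁ u₂ v₁ v₂).continuousOn (s := O)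
  have hnn : ∀ j, 0 ≤ ∫ q in Icc u₁ u₂ ×ˢ Icc v₁ v₂,
      cutoff u₁ u₂ v₁ v₂ q * sphereEnergy (d j) q := fun j =>
    setIntegral_nonneg hK.measurableSet fun q hq =>
      mul_nonneg (cutoff_nonneg hq) (sphereEnergy_nonneg _ q)
  have hle : ∀ j k, (∫ q in Icc u₁ u₂ ×ˢ Icc v₁ v₂, cutoff u₁ u₂ v₁ v₂ q *
      sphereEnergy (fun p => d j p - d k p) q) ≤ C * ∫ q in Icc u₁ u₂ ×ˢ Icc v₁ v₂,
      sphereEnergy (fun p => d j p - d k p) q := by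
    intro j k
    have hs := ((hd j).sub (hd k)).continuousOn_sphereEnergy hO
    rw [← integral_const_mul]
    exact setIntegral_mono_on (((hχ.mul hs).mono hR).integrableOn_compact hK)
      (((hs.mono hR).integrableOn_compact hK).const_mul C) hK.measurableSet fun q hq =>
      mul_le_mul_of_nonneg_right ((le_abs_self _).trans (hC q hq)) (sphereEnergy_nonneg _ q)
  have hc' : Tendsto (fun j : ℕ × ℕ => C * ∫ q in Icc u₁ u₂ ×ˢ Icc v₁ v₂,
      sphereEnergy (fun p => d j.1 p - d j.2 p) q) atTop (𝓝 0) := by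
    simpa using hc.const_mul C
  rw [Metric.tendsto_atTop]
  intro ε hε
  obtain ⟨⟨n₁, n₂⟩, hn⟩ := eventually_atTop.1 (hc'.eventually (gt_mem_nhds (half_pos hε)))
  refine ⟨max n₁ n₂, fun k hk => ?_⟩
  rw [Real.dist_eq, sub_zero, abs_of_nonneg (hnn k)]
  obtain ⟨M, hM⟩ := (hd k).exists_energy_le hO hu hv hR
  -- Here `k` is fixed, hence so is `M`. Letting `j → ∞` removes the `L²` term of `d j` for each
  -- `η`; afterwards `η → 0` removes `η M`.
  have step : ∀ η > 0, (∫ q in Icc u₁ u₂ ×ˢ Icc v₁ v₂,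
      cutoff u₁ u₂ v₁ v₂ q * sphereEnergy (d k) q) ≤ ε / 2 + η * M := by
    intro η hη
    have hlim : Tendsto (fun j => ε / 2 + η * M + η⁻¹ * ∫ q in Icc u₁ u₂ ×ˢ Icc v₁ v₂,
        sphereInt (fun p => d j p ^ 2) q) atTop (𝓝 (ε / 2 + η * M)) := by
      simpa using (h0.const_mul η⁻¹).const_add (ε / 2 + η * M)
    refine ge_of_tendsto hlim (eventually_atTop.2 ⟨n₁, fun j hj => ?_⟩)
    have h1 := hM (d j) (hd j) η hη
    have h2 := hn (j, k) ⟨hj, (le_max_right _ _).trans hk⟩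
    have h3 := hle j k
    simp only at h2
    linarith
  have hlim : Tendsto (fun η => ε / 2 + η * M) (𝓝[>] (0 : ℝ)) (𝓝 (ε / 2 + 0 * M)) :=
    ((tendsto_id.mono_left nhdsWithin_le_nhds).mul_const M).const_add _
  have := ge_of_tendsto hlim (eventually_nhdsWithin_of_forall fun η hη => step η hη)
  linarith

end

end SchwarzschildDeSitter

namespace SchwarzschildDeSitter

/-! ### Integrals over cylinders -/

section

variable {K O : Set (ℝ × ℝ)} {f g h ψ : Point → ℝ} {q : ℝ × ℝ}

theorem isCompact_cyl (hK : IsCompact K) : IsCompact (cyl K) := by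
  have h1 : cyl K = (Homeomorph.prodAssoc ℝ ℝ S2).symm ⁻¹' (K ×ˢ univ) := by
    ext p
    simp only [cyl, toQ, mem_preimage, mem_prod, mem_univ, and_true]
    rfl
  rw [h1, Homeomorph.isCompact_preimage]
  exact hK.prod isCompact_univ

theorem integrableOn_cyl (hK : IsCompact K) (hf : ContinuousOn f (cyl K)) :
    IntegrableOn f (cyl K) chartMeasure := by
  have : IsFiniteMeasureOnCompacts chartMeasure := by unfold chartMeasure; infer_instance
  exact hf.integrableOn_compact (isCompact_cyl hK)

theorem integral_cyl (hK : IsCompact K) (hf : ContinuousOn f (cyl K)) :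
    ∫ p in cyl K, f p ∂chartMeasure = ∫ q in K, sphereInt f q := by
  have hm := measurePreserving_prodAssoc (volume : Measure ℝ) (volume : Measure ℝ) sphereMeasure
  have he : (MeasurableEquiv.prodAssoc : (ℝ × ℝ) × S2 ≃ᵐ ℝ × ℝ × S2) ⁻¹' cyl K = K ×ˢ univ := by
    ext p
    simp only [cyl, toQ, mem_preimage, mem_prod, mem_univ, and_true]
    rfl
  have h1 := hm.setIntegral_preimage_emb MeasurableEquiv.prodAssoc.measurableEmbedding f (cyl K)
  have h2 : IntegrableOn (fun x => f (MeasurableEquiv.prodAssoc x)) _ _ :=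
    (hm.integrableOn_comp_preimage MeasurableEquiv.prodAssoc.measurableEmbedding).2
    (integrableOn_cyl hK hf)
  rw [he] at h1 h2
  rw [chartMeasure, ← h1, setIntegral_prod _ h2, Measure.volume_eq_prod]
  simp only [Measure.restrict_univ]
  rfl

theorem ofReal_integral_sphereInt (hK : IsCompact K) (hf : ContinuousOn f (cyl K))
    (h0 : ∀ p, 0 ≤ f p) :
    ENNReal.ofReal (∫ q in K, sphereInt f q) =
      ∫⁻ p in cyl K, ENNReal.ofReal (f p) ∂chartMeasure := by
  rw [← integral_cyl hK hf]
  exact ofReal_integral_eq_lintegral_ofReal (integrableOn_cyl hK hf) (Eventually.of_forall h0)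

theorem IsC2On.ofReal_integral_sphereEnergy (hK : IsCompact K) (hKO : K ⊆ O)
    (hf : IsC2On (cyl O) f) :
    ENNReal.ofReal (∫ q in K, sphereEnergy f q) =
      ∫⁻ p in cyl K, ENNReal.ofReal (energyDensity f p) ∂chartMeasure := by
  have hc : ContinuousOn (energyDensity f) (cyl O) :=
    ((hf.continuousOn_dU.pow 2).add (hf.continuousOn_dV.pow 2)).add hf.continuousOn_sphereGradSq
  rw [← ofReal_integral_sphereInt hK (hc.mono fun p hp => hKO hp) fun p =>
    add_nonneg (add_nonneg (sq_nonneg _) (sq_nonneg _)) (sq_nonneg _)]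
  congr 1
  refine setIntegral_congr_fun hK.measurableSet fun q hq => ?_
  simp only [sphereEnergy, intUU, intVV, intSS]
  rw [← sphereInt_add (hf.continuousOn_dU.fun_pow 2) (hf.continuousOn_dV.fun_pow 2) (hKO hq),
    ← sphereInt_add ((hf.continuousOn_dU.fun_pow 2).fun_add (hf.continuousOn_dV.fun_pow 2))
      hf.continuousOn_sphereGradSq (hKO hq)]
  rfl

/-! ### Quadratic densities of differences -/

theorem sphereInt_le_of_le {t : ℝ} (hf : ContinuousOn f (cyl O)) (hg : ContinuousOn g (cyl O))
    (hh : ContinuousOn h (cyl O)) (hq : q ∈ O) (hle : ∀ x, f (q.1, q.2, x) ≤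
      (1 + t) * g (q.1, q.2, x) + (1 + t⁻¹) * h (q.1, q.2, x)) :
    sphereInt f q ≤ (1 + t) * sphereInt g q + (1 + t⁻¹) * sphereInt h q := by
  have c1 : ContinuousOn (fun p => (1 + t) * g p) (cyl O) := continuousOn_const.mul hg
  have c2 : ContinuousOn (fun p => (1 + t⁻¹) * h p) (cyl O) := continuousOn_const.mul hh
  rw [← sphereInt_const_mul, ← sphereInt_const_mul, ← sphereInt_add c1 c2 hq]
  exact integral_mono (integrable_slice hf hq) (integrable_slice (c1.fun_add c2) hq) hle

/-- The weight matters: for small `t` the coefficient of the leading term is close to `1`, so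
quadratic densities of functions close in energy are close to each other and not just comparable. -/
theorem sub_sq_le_weighted {t : ℝ} (ht : 0 < t) (x y : ℝ) :
    (x - y) ^ 2 ≤ (1 + t) * x ^ 2 + (1 + t⁻¹) * y ^ 2 := by
  have h0 : 0 ≤ t⁻¹ * (t * x + y) ^ 2 := by positivity
  have h1 : t⁻¹ * (t * x + y) ^ 2 = t * x ^ 2 + t⁻¹ * y ^ 2 + 2 * (x * y) := by
    field_simp
    ring
  linarith

theorem IsC2On.intUU_sub_le (hf : IsC2On (cyl O) f) (hg : IsC2On (cyl O) g) (hq : q ∈ O) {t : ℝ}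
    (ht : 0 < t) :
    intUU (fun p => f p - g p) q ≤ (1 + t) * intUU f q + (1 + t⁻¹) * intUU g q := by
  refine sphereInt_le_of_le ((hf.sub hg).continuousOn_dU.pow 2) (hf.continuousOn_dU.pow 2)
    (hg.continuousOn_dU.pow 2) hq fun x => ?_
  rw [hf.dU_sub hg (show (q.1, q.2, x) ∈ cyl O from hq)]
  exact sub_sq_le_weighted ht _ _

theorem IsC2On.intVV_sub_le (hf : IsC2On (cyl O) f) (hg : IsC2On (cyl O) g) (hq : q ∈ O) {t : ℝ}
    (ht : 0 < t) :
    intVV (fun p => f p - g p) q ≤ (1 + t) * intVV f q + (1 + t⁻¹) * intVV g q := by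
  refine sphereInt_le_of_le ((hf.sub hg).continuousOn_dV.pow 2) (hf.continuousOn_dV.pow 2)
    (hg.continuousOn_dV.pow 2) hq fun x => ?_
  rw [hf.dV_sub hg (show (q.1, q.2, x) ∈ cyl O from hq)]
  exact sub_sq_le_weighted ht _ _

theorem IsC2On.intSS_sub_le (hf : IsC2On (cyl O) f) (hg : IsC2On (cyl O) g) (hq : q ∈ O) {t : ℝ}
    (ht : 0 < t) :
    intSS (fun p => f p - g p) q ≤ (1 + t) * intSS f q + (1 + t⁻¹) * intSS g q := by
  refine sphereInt_le_of_le (hf.sub hg).continuousOn_sphereGradSq hf.continuousOn_sphereGradSq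
    hg.continuousOn_sphereGradSq hq fun x => ?_
  have hx : (q.1, q.2, x) ∈ cyl O := hq
  rw [(hf.sub hg).sphereGradSq_eq hx, hf.sphereGradSq_eq hx, hg.sphereGradSq_eq hx,
    Finset.mul_sum, Finset.mul_sum, ← Finset.sum_add_distrib]
  refine Finset.sum_le_sum fun i _ => ?_
  rw [hf.D1_sub hg hx]
  exact sub_sq_le_weighted ht _ _

theorem IsC2On.sphereEnergy_sub_le (hf : IsC2On (cyl O) f) (hg : IsC2On (cyl O) g) (hq : q ∈ O) :
    sphereEnergy (fun p => f p - g p) q ≤ 2 * (sphereEnergy f q + sphereEnergy g q) := by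
  have h1 := hf.intUU_sub_le hg hq one_pos
  have h2 := hf.intVV_sub_le hg hq one_pos
  have h3 := hf.intSS_sub_le hg hq one_pos
  simp only [sphereEnergy]
  norm_num at h1 h2 h3
  linarith

variable {Λ m : ℝ} {N : ℝ × ℝ → ℝ × ℝ}

theorem Subextremal.coneDensity_sub_le (hS : Subextremal Λ m) (hq1 : q.1 * q.2 < 1)
    (h1 : 0 ≤ (N q).1) (h2 : 0 ≤ (N q).2) (hf : IsC2On (cyl O) f) (hg : IsC2On (cyl O) g)
    (hq : q ∈ O) {t : ℝ} (ht : 0 < t) :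
    coneDensity Λ m N (fun p => f p - g p) q ≤
      (1 + t) * coneDensity Λ m N f q + (1 + t⁻¹) * coneDensity Λ m N g q := by
  have hΩ := hS.omegaSq_pos hq1
  have k1 := mul_le_mul_of_nonneg_left (hf.intVV_sub_le hg hq ht)
    (mul_nonneg h2 (sq_nonneg (radius Λ m q)))
  have k2 := mul_le_mul_of_nonneg_left (hf.intSS_sub_le hg hq ht)
    (mul_nonneg h1 (div_nonneg hΩ.le (by norm_num : (0 : ℝ) ≤ 4)))
  simp only [coneDensity]
  linarith

theorem Subextremal.horizonDensity_sub_le (hS : Subextremal Λ m) (hq1 : q.1 * q.2 < 1)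
    (h1 : 0 ≤ (N q).1) (h2 : 0 ≤ (N q).2) (hf : IsC2On (cyl O) f) (hg : IsC2On (cyl O) g)
    (hq : q ∈ O) {t : ℝ} (ht : 0 < t) :
    horizonDensity Λ m N (fun p => f p - g p) q ≤
      (1 + t) * horizonDensity Λ m N f q + (1 + t⁻¹) * horizonDensity Λ m N g q := by
  have hΩ := hS.omegaSq_pos hq1
  have k1 := mul_le_mul_of_nonneg_left (hf.intUU_sub_le hg hq ht)
    (mul_nonneg h1 (sq_nonneg (radius Λ m q)))
  have k2 := mul_le_mul_of_nonneg_left (hf.intSS_sub_le hg hq ht)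
    (mul_nonneg h2 (div_nonneg hΩ.le (by norm_num : (0 : ℝ) ≤ 4)))
  simp only [horizonDensity]
  linarith

theorem IsC2On.int_sub_comm (hf : IsC2On (cyl O) f) (hg : IsC2On (cyl O) g) (hq : q ∈ O) :
    intUU (fun p => f p - g p) q = intUU (fun p => g p - f p) q ∧
      intVV (fun p => f p - g p) q = intVV (fun p => g p - f p) q ∧
      intSS (fun p => f p - g p) q = intSS (fun p => g p - f p) q := by
  refine ⟨sphereInt_congr fun x => ?_, sphereInt_congr fun x => ?_, sphereInt_congr fun x => ?_⟩
  all_goals have hx : (q.1, q.2, x) ∈ cyl O := hq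
  · rw [hf.dU_sub hg hx, hg.dU_sub hf hx, sub_sq_comm]
  · rw [hf.dV_sub hg hx, hg.dV_sub hf hx, sub_sq_comm]
  · rw [(hf.sub hg).sphereGradSq_eq hx, (hg.sub hf).sphereGradSq_eq hx]
    exact Finset.sum_congr rfl fun i _ => by rw [hf.D1_sub hg hx, hg.D1_sub hf hx, sub_sq_comm]

end

/-! ### Convergence in energy of approximating sequences -/

section

variable {Λ m : ℝ} {U : Set Point} {ψ : Point → ℝ} {s s' : ℕ → Point → ℝ} {K O : Set (ℝ × ℝ)}

theorem tendsto_zero_of_ofReal {ι : Type*} {l : Filter ι} {x : ι → ℝ} (h0 : ∀ i, 0 ≤ x i)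
    (h : Tendsto (fun i => ENNReal.ofReal (x i)) l (𝓝 0)) : Tendsto x l (𝓝 0) := by
  have := (ENNReal.tendsto_toReal ENNReal.zero_ne_top).comp h
  simpa [Function.comp_def, ENNReal.toReal_ofReal (h0 _)] using this

theorem Approximates.isC2On (hs : Approximates Λ m U ψ s) (hOU : cyl O ⊆ U) (j : ℕ) :
    IsC2On (cyl O) (s j) := (hs.solution j).1.mono hOU

theorem Approximates.isClassicalSolution (hs : Approximates Λ m U ψ s) (hOU : cyl O ⊆ U) (j : ℕ) :
    IsClassicalSolution Λ m (cyl O) (s j) :=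
  ⟨hs.isC2On hOU j, fun p hp => (hs.solution j).2 p (hOU hp)⟩

theorem Approximates.tendsto_sphereEnergy (hs : Approximates Λ m U ψ s) (hOU : cyl O ⊆ U)
    (hK : IsCompact K) (hKO : K ⊆ O) :
    Tendsto (fun j : ℕ × ℕ => ∫ q in K, sphereEnergy (fun p => s j.1 p - s j.2 p) q) atTop
      (𝓝 0) := by
  refine tendsto_zero_of_ofReal (fun j => integral_nonneg fun q => sphereEnergy_nonneg _ q) ?_
  refine (hs.cauchy (cyl K) (fun p hp => hOU (hKO hp)) (isCompact_cyl hK)).congr fun j => ?_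
  exact (((hs.isC2On hOU j.1).sub (hs.isC2On hOU j.2)).ofReal_integral_sphereEnergy hK hKO).symm

/-- Both sequences tend to `ψ` in `L²`, and the triangle inequality applies. Measurability of `ψ`
enters through the additivity of the lower integral. -/
theorem Approximates.tendsto_sq_sub (hψ : AEStronglyMeasurable ψ (chartMeasure.restrict U))
    (hs : Approximates Λ m U ψ s) (hs' : Approximates Λ m U ψ s') (hOU : cyl O ⊆ U)
    (hK : IsCompact K) (hKO : K ⊆ O) :
    Tendsto (fun j => ∫ q in K, sphereInt (fun p => (s j p - s' j p) ^ 2) q) atTop (𝓝 0) := by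
  have hcyl : cyl K ⊆ U := fun p hp => hOU (hKO hp)
  refine tendsto_zero_of_ofReal (fun j => integral_nonneg fun q => integral_nonneg fun x =>
    sq_nonneg _) ?_
  have l1 := hs.tendsto (cyl K) hcyl (isCompact_cyl hK)
  have l2 := hs'.tendsto (cyl K) hcyl (isCompact_cyl hK)
  have l3 := ENNReal.Tendsto.const_mul (a := 2) (l1.add l2) (Or.inr (by simp))
  rw [add_zero, mul_zero] at l3
  refine tendsto_of_tendsto_of_tendsto_of_le_of_le tendsto_const_nhds l3 (fun _ => zero_le) fun j => ?_
  have c := ((hs.isC2On hOU j).sub (hs'.isC2On hOU j)).continuousOn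
  simp only
  rw [ofReal_integral_sphereInt hK ((c.fun_pow 2).mono fun p hp => hKO hp) fun p => sq_nonneg _]
  have hm : AEMeasurable (fun p => ENNReal.ofReal ((s j p - ψ p) ^ 2))
      (chartMeasure.restrict (cyl K)) := by
    have m1 : AEStronglyMeasurable (s j) (chartMeasure.restrict (cyl K)) :=
      (((hs.isC2On hOU j).continuousOn.mono fun p hp => hKO hp)).aestronglyMeasurable
        (isCompact_cyl hK).measurableSet
    have m2 := hψ.mono_measure (Measure.restrict_mono hcyl le_rfl)
    exact ((m1.sub m2).aemeasurable.pow_const 2).ennreal_ofReal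
  rw [← lintegral_add_left' hm, ← lintegral_const_mul' _ _ (by simp)]
  refine lintegral_mono fun p => ?_
  rw [← ENNReal.ofReal_add (sq_nonneg _) (sq_nonneg _),
    show (2 : ENNReal) = ENNReal.ofReal 2 by simp, ← ENNReal.ofReal_mul (by norm_num)]
  refine ENNReal.ofReal_le_ofReal ?_
  nlinarith [sq_nonneg (s j p - ψ p + (s' j p - ψ p))]

theorem cutoff_ge {u₁ u₂ v₁ v₂ ε : ℝ} (hε : 0 < ε) {q : ℝ × ℝ}
    (hq : q ∈ Icc u₁ u₂ ×ˢ Icc v₁ v₂) :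
    ε ^ 4 ≤ cutoff (u₁ - ε) (u₂ + ε) (v₁ - ε) (v₂ + ε) q := by
  obtain ⟨⟨h1, h2⟩, h3, h4⟩ := hq
  have a1 : ε ≤ q.1 - (u₁ - ε) := by linarith
  have a2 : ε ≤ u₂ + ε - q.1 := by linarith
  have a3 : ε ≤ q.2 - (v₁ - ε) := by linarith
  have a4 : ε ≤ v₂ + ε - q.2 := by linarith
  calc ε ^ 4 = (ε * ε) * (ε * ε) := by ring
    _ ≤ _ := mul_le_mul (mul_le_mul a1 a2 hε.le (hε.le.trans a1))
      (mul_le_mul a3 a4 hε.le (hε.le.trans a3)) (mul_self_nonneg ε)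
      (mul_nonneg (hε.le.trans a1) (hε.le.trans a2))

/-- Two sequences that approximate the same solution are close in energy. -/
theorem Approximates.tendsto_energy_sub (hψ : AEStronglyMeasurable ψ (chartMeasure.restrict U))
    (hs : Approximates Λ m U ψ s) (hs' : Approximates Λ m U ψ s') (hO : IsOpen O)
    (hOU : cyl O ⊆ U) {u₁ u₂ v₁ v₂ : ℝ} (hu : u₁ ≤ u₂) (hv : v₁ ≤ v₂)
    (hR : Icc u₁ u₂ ×ˢ Icc v₁ v₂ ⊆ O) :
    Tendsto (fun j : ℕ × ℕ => ∫ q in Icc u₁ u₂ ×ˢ Icc v₁ v₂,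
      sphereEnergy (fun p => s j.1 p - s' j.2 p) q) atTop (𝓝 0) := by
  obtain ⟨ε, hε, hR'⟩ := exists_thickened_rectangle hO hu hv hR
  have hsub : Icc u₁ u₂ ×ˢ Icc v₁ v₂ ⊆ Icc (u₁ - ε) (u₂ + ε) ×ˢ Icc (v₁ - ε) (v₂ + ε) :=
    Set.prod_mono (Icc_subset_Icc (by linarith) (by linarith))
      (Icc_subset_Icc (by linarith) (by linarith))
  have hK : ∀ {a b c d : ℝ}, IsCompact (Icc a b ×ˢ Icc c d) :=
    @fun a b c d => (isCompact_Icc (a := a) (b := b)).prod (isCompact_Icc (a := c) (b := d))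
  have hd := fun j => (hs.isC2On hOU j).sub (hs'.isC2On hOU j)
  have hint : ∀ {f : Point → ℝ} {K : Set (ℝ × ℝ)}, IsC2On (cyl O) f → IsCompact K → K ⊆ O →
      IntegrableOn (sphereEnergy f) K := fun hf hK hKO =>
    ((hf.continuousOn_sphereEnergy hO).mono hKO).integrableOn_compact hK
  have hnn : ∀ (f : Point → ℝ) (K : Set (ℝ × ℝ)), 0 ≤ ∫ q in K, sphereEnergy f q := fun f K =>
    integral_nonneg fun q => sphereEnergy_nonneg f q
  have hsubE : ∀ {f g : Point → ℝ} {K : Set (ℝ × ℝ)}, IsC2On (cyl O) f → IsC2On (cyl O) g →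
      IsCompact K → K ⊆ O → ∫ q in K, sphereEnergy (fun p => f p - g p) q ≤
        2 * ((∫ q in K, sphereEnergy f q) + ∫ q in K, sphereEnergy g q) := by
    intro f g K hf hg hK hKO
    rw [← integral_add (hint hf hK hKO) (hint hg hK hKO), ← integral_const_mul]
    exact setIntegral_mono_on (hint (hf.sub hg) hK hKO)
      (((hint hf hK hKO).add (hint hg hK hKO)).const_mul 2) hK.measurableSet fun q hq =>
      hf.sphereEnergy_sub_le hg (hKO hq)
  -- On the diagonal the differences tend to zero in `L²` and are Cauchy in energy, so their cut off
  -- energy on the enlarged rectangle tends to zero. On the original rectangle the cutoff is at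
  -- least `ε ^ 4`.
  have hdiag : Tendsto (fun j => ∫ q in Icc u₁ u₂ ×ˢ Icc v₁ v₂,
      sphereEnergy (fun p => s j p - s' j p) q) atTop (𝓝 0) := by
    have h1 := tendsto_cutoff_energy hO (by linarith) (by linarith) hR' hd
      (Approximates.tendsto_sq_sub hψ hs hs' hOU hK hR') (by
        have l1 := hs.tendsto_sphereEnergy hOU (hK (a := u₁ - ε) (b := u₂ + ε)) hR'
        have l2 := hs'.tendsto_sphereEnergy hOU (hK (a := u₁ - ε) (b := u₂ + ε)) hR'
        have l3 := (l1.add l2).const_mul 2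
        rw [add_zero, mul_zero] at l3
        refine squeeze_zero (fun j => hnn _ _) (fun j => ?_) l3
        have e : (fun p => s j.1 p - s' j.1 p - (s j.2 p - s' j.2 p)) =
          fun p => (s j.1 p - s j.2 p) - (s' j.1 p - s' j.2 p) := by funext p; ring
        rw [e]
        exact hsubE ((hs.isC2On hOU _).sub (hs.isC2On hOU _))
          ((hs'.isC2On hOU _).sub (hs'.isC2On hOU _)) hK hR')
    have h2 := h1.const_mul (ε ^ 4)⁻¹
    rw [mul_zero] at h2
    refine squeeze_zero (fun j => hnn _ _) (fun j => ?_) h2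
    rw [← integral_const_mul]
    have hc := ((continuous_cutoff (u₁ - ε) (u₂ + ε) (v₁ - ε) (v₂ + ε)).continuousOn.mul
      (((hd j).continuousOn_sphereEnergy hO).mono hR')).integrableOn_compact (μ := volume) hK
    refine (setIntegral_mono_on (hint (hd j) hK hR) ((hc.mono_set hsub).const_mul _)
      hK.measurableSet fun q hq => ?_).trans (setIntegral_mono_set (hc.const_mul _) ?_
        hsub.eventuallyLE)
    · rw [le_inv_mul_iff₀ (by positivity)]
      exact mul_le_mul_of_nonneg_right (cutoff_ge hε hq) (sphereEnergy_nonneg _ q)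
    · refine (ae_restrict_iff' hK.measurableSet).2 (Eventually.of_forall fun q hq => ?_)
      exact mul_nonneg (by positivity) (mul_nonneg (cutoff_nonneg hq) (sphereEnergy_nonneg _ q))
  have l1 := hs.tendsto_sphereEnergy hOU hK hR
  have l2 := hdiag.comp (tendsto_snd (f := atTop (α := ℕ)) (g := atTop (α := ℕ)))
  rw [prod_atTop_atTop_eq] at l2
  have hneg : ∀ k, ∫ q in Icc u₁ u₂ ×ˢ Icc v₁ v₂, sphereEnergy (fun p => s' k p - s k p) q =
      ∫ q in Icc u₁ u₂ ×ˢ Icc v₁ v₂, sphereEnergy (fun p => s k p - s' k p) q := by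
    intro k
    refine setIntegral_congr_fun hK.measurableSet fun q hq => ?_
    obtain ⟨e1, e2, e3⟩ := (hs.isC2On hOU k).int_sub_comm (hs'.isC2On hOU k) (hR hq)
    simp only [sphereEnergy, e1, e2, e3]
  have l3 := (l1.add l2).const_mul 2
  rw [add_zero, mul_zero] at l3
  refine squeeze_zero (fun j => hnn _ _) (fun j => ?_) l3
  -- Independent indices are reduced to the Cauchy property of `s` and the diagonal difference with
  -- index `j.2`.
  have e : (fun p => s j.1 p - s' j.2 p) =
    fun p => (s j.1 p - s j.2 p) - (s' j.2 p - s j.2 p) := by funext p; ring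
  rw [e]
  refine (hsubE ((hs.isC2On hOU _).sub (hs.isC2On hOU _))
    ((hs'.isC2On hOU _).sub (hs.isC2On hOU _)) hK hR).trans (le_of_eq ?_)
  rw [hneg]
  rfl

end

end SchwarzschildDeSitter

namespace SchwarzschildDeSitter

/-! ### Limits of quadratic densities -/

section

variable {X : Type*} [MeasurableSpace X] {μ : Measure X}

/-- Densities of quadratic functionals of two sequences are close in `L ^ 1` if the densities of the
differences tend to zero. -/
theorem tendsto_integral_abs_sub {F G : ℕ → X → ℝ} {D : ℕ × ℕ → X → ℝ}
    (hF : ∀ j, Integrable (F j) μ) (hG : ∀ j, Integrable (G j) μ) (hD : ∀ j, Integrable (D j) μ)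
    (hFG : ∀ j : ℕ × ℕ, ∀ t > 0, ∀ᵐ x ∂μ,
      F j.1 x ≤ (1 + t) * G j.2 x + (1 + t⁻¹) * D j x)
    (hGF : ∀ j : ℕ × ℕ, ∀ t > 0, ∀ᵐ x ∂μ,
      G j.2 x ≤ (1 + t) * F j.1 x + (1 + t⁻¹) * D j x)
    (hF0 : ∀ j, ∀ᵐ x ∂μ, 0 ≤ F j x) (hG0 : ∀ j, ∀ᵐ x ∂μ, 0 ≤ G j x)
    (hlim : Tendsto (fun j => ∫ x, D j x ∂μ) atTop (𝓝 0)) :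
    Tendsto (fun j : ℕ × ℕ => ∫ x, |F j.1 x - G j.2 x| ∂μ) atTop (𝓝 0) := by
  have key : ∀ j : ℕ × ℕ, ∀ t > 0, ∫ x, |F j.1 x - G j.2 x| ∂μ ≤
      t * ((∫ x, F j.1 x ∂μ) + ∫ x, G j.2 x ∂μ) + (1 + t⁻¹) * ∫ x, D j x ∂μ := by
    intro j t ht
    have hs : Integrable (fun x => F j.1 x + G j.2 x) μ := (hF _).add (hG _)
    rw [← integral_add (hF _) (hG _), ← integral_const_mul, ← integral_const_mul,
      ← integral_add (hs.const_mul t) ((hD j).const_mul _)]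
    refine integral_mono_ae ((hF _).sub (hG _)).abs
      ((hs.const_mul t).add ((hD j).const_mul _)) ?_
    filter_upwards [hFG j t ht, hGF j t ht, hF0 j.1, hG0 j.2] with x h1 h2 h3 h4
    have h5 := mul_nonneg ht.le h3
    have h6 := mul_nonneg ht.le h4
    rw [abs_le]
    constructor <;> linarith
  have mono : ∀ j : ℕ × ℕ, (∫ x, F j.1 x ∂μ) ≤ 2 * (∫ x, G j.2 x ∂μ) + 2 * ∫ x, D j x ∂μ ∧
      (∫ x, G j.2 x ∂μ) ≤ 2 * (∫ x, F j.1 x ∂μ) + 2 * ∫ x, D j x ∂μ := by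
    intro j
    constructor
    · rw [← integral_const_mul, ← integral_const_mul,
        ← integral_add ((hG _).const_mul _) ((hD j).const_mul _)]
      refine integral_mono_ae (hF _) (((hG _).const_mul _).add ((hD j).const_mul _)) ?_
      filter_upwards [hFG j 1 one_pos] with x h
      norm_num at h
      exact h
    · rw [← integral_const_mul, ← integral_const_mul,
        ← integral_add ((hF _).const_mul _) ((hD j).const_mul _)]
      refine integral_mono_ae (hG _) (((hF _).const_mul _).add ((hD j).const_mul _)) ?_
      filter_upwards [hGF j 1 one_pos] with x h
      norm_num at h
      exact h
  -- Comparison with one fixed pair of tail indices bounds the integrals of all later `F` and `G` by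
  -- `B`.
  obtain ⟨⟨n₁, n₂⟩, hn⟩ := eventually_atTop.1 (hlim.eventually (gt_mem_nhds one_pos))
  set B := (2 * (∫ x, G n₂ x ∂μ) + 2) + (2 * (∫ x, F n₁ x ∂μ) + 2) with hB
  have hbound : ∀ j : ℕ × ℕ, (n₁, n₂) ≤ j → (∫ x, F j.1 x ∂μ) + (∫ x, G j.2 x ∂μ) ≤ B := by
    intro j hj
    have h1 := (mono (j.1, n₂)).1
    have h2 := (mono (n₁, j.2)).2
    have h3 := hn (j.1, n₂) ⟨hj.1, le_rfl⟩
    have h4 := hn (n₁, j.2) ⟨le_rfl, hj.2⟩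
    simp only at h1 h2 h3 h4
    linarith
  have hB0 : 0 < |B| + 1 := by positivity
  rw [Metric.tendsto_nhds]
  intro ε hε
  -- Chosen so that the relative error `t B` is at most `ε / 2`; the `+ 1` keeps the denominator
  -- positive. With `t` fixed, the term with `D` tends to zero.
  set t := ε / (2 * (|B| + 1)) with ht
  have ht0 : 0 < t := by positivity
  have hl2 : Tendsto (fun j => (1 + t⁻¹) * ∫ x, D j x ∂μ) atTop (𝓝 0) := by
    simpa using hlim.const_mul (1 + t⁻¹)
  filter_upwards [hl2.eventually (gt_mem_nhds (half_pos hε)), eventually_ge_atTop (n₁, n₂)]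
    with j h1 h2
  rw [Real.dist_eq, sub_zero, abs_of_nonneg (integral_nonneg fun x => abs_nonneg _)]
  have h3 := key j t ht0
  have h4 := mul_le_mul_of_nonneg_left ((hbound j h2).trans (le_abs_self B)) ht0.le
  have h5 : t * |B| ≤ ε / 2 := by
    calc t * |B| ≤ t * (|B| + 1) := by gcongr; linarith
      _ = ε / 2 := by rw [ht]; field_simp
  linarith

/-- Completeness of `L ^ 1`. -/
theorem exists_tendsto_integral_abs_sub {F : ℕ → X → ℝ} (hF : ∀ j, Integrable (F j) μ)
    (hc : Tendsto (fun j : ℕ × ℕ => ∫ x, |F j.1 x - F j.2 x| ∂μ) atTop (𝓝 0)) :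
    ∃ L : X → ℝ, Integrable L μ ∧ Tendsto (fun j => ∫ x, |F j x - L x| ∂μ) atTop (𝓝 0) := by
  have hdist : ∀ f g : X → ℝ, ∀ (hf : Integrable f μ) (hg : Integrable g μ),
      dist (hf.toL1 f) (hg.toL1 g) = ∫ x, |f x - g x| ∂μ := by
    intro f g hf hg
    rw [dist_eq_norm, ← Integrable.toL1_sub, L1.norm_eq_integral_norm]
    refine integral_congr_ae ?_
    filter_upwards [Integrable.coeFn_toL1 (hf.sub hg)] with x hx
    rw [hx, Real.norm_eq_abs]
    rfl
  have hcs : CauchySeq fun j => (hF j).toL1 (F j) := by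
    rw [cauchySeq_iff_tendsto_dist_atTop_0]
    simpa only [hdist] using hc
  obtain ⟨L, hL⟩ := cauchySeq_tendsto_of_complete hcs
  have hLi := L1.integrable_coeFn L
  refine ⟨L, hLi, ?_⟩
  rw [tendsto_iff_dist_tendsto_zero] at hL
  refine hL.congr fun j => ?_
  rw [← hdist _ _ (hF j) hLi, Integrable.toL1_coeFn]

theorem tendsto_integral_of_abs_sub {F : ℕ → X → ℝ} {L : X → ℝ} (hF : ∀ j, Integrable (F j) μ)
    (hL : Integrable L μ) (h : Tendsto (fun j => ∫ x, |F j x - L x| ∂μ) atTop (𝓝 0)) :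
    Tendsto (fun j => ∫ x, F j x ∂μ) atTop (𝓝 (∫ x, L x ∂μ)) := by
  rw [tendsto_iff_dist_tendsto_zero]
  refine squeeze_zero (fun _ => dist_nonneg) (fun j => ?_) h
  rw [Real.dist_eq, ← integral_sub (hF j) hL]
  exact abs_integral_le_integral_abs

/-- A density that depends on the solution in a Cauchy continuous way has a limit that does not
depend on the approximating sequence. -/
theorem exists_density_limit {Λ m : ℝ} {U : Set Point} {ψ : Point → ℝ} {ρ : (Point → ℝ) → X → ℝ}
    (h0 : ∃ s, Approximates Λ m U ψ s)
    (hint : ∀ s, Approximates Λ m U ψ s → ∀ j, Integrable (ρ (s j)) μ)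
    (hdiff : ∀ s s', Approximates Λ m U ψ s → Approximates Λ m U ψ s' →
      Tendsto (fun j : ℕ × ℕ => ∫ x, |ρ (s j.1) x - ρ (s' j.2) x| ∂μ) atTop (𝓝 0)) :
    ∃ L : X → ℝ, Integrable L μ ∧ ∀ s, Approximates Λ m U ψ s →
      Tendsto (fun j => ∫ x, |ρ (s j) x - L x| ∂μ) atTop (𝓝 0) := by
  obtain ⟨s₀, hs₀⟩ := h0
  obtain ⟨L, hL, hlim⟩ := exists_tendsto_integral_abs_sub (hint s₀ hs₀) (hdiff s₀ s₀ hs₀ hs₀)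
  refine ⟨L, hL, fun s hs => ?_⟩
  have h1 := (hdiff s s₀ hs hs₀).comp tendsto_atTop_diagonal
  have h2 := h1.add hlim
  rw [add_zero] at h2
  refine squeeze_zero (fun j => integral_nonneg fun x => abs_nonneg _) (fun j => ?_) h2
  simp only [Function.comp_apply]
  have i1 : Integrable (fun x => ρ (s j) x - ρ (s₀ j) x) μ := (hint s hs j).sub (hint s₀ hs₀ j)
  have i2 : Integrable (fun x => ρ (s₀ j) x - L x) μ := (hint s₀ hs₀ j).sub hL
  rw [← integral_add i1.abs i2.abs]
  exact integral_mono ((hint s hs j).sub hL).abs (i1.abs.add i2.abs) fun x => abs_sub_le _ _ _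

end

end SchwarzschildDeSitter

namespace SchwarzschildDeSitter

/-! ### Fluxes of finite energy solutions -/

section

variable {Λ m : ℝ} {U : Set Point} {ψ : Point → ℝ} {s s' : ℕ → Point → ℝ} {O : Set (ℝ × ℝ)}
  {N : ℝ × ℝ → ℝ × ℝ} {Pu Pv Qu Qv : ℝ × ℝ → ℝ}

theorem continuousOn_coneDensity (hS : Subextremal Λ m) (hO : IsOpen O)
    (hO1 : ∀ q ∈ O, q.1 * q.2 < 1) (hP : HasPlanePartials O (fun q => (N q).1) Pu Pv)
    (hQ : HasPlanePartials O (fun q => (N q).2) Qu Qv) {f : Point → ℝ} (hf : IsC2On (cyl O) f) :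
    ContinuousOn (coneDensity Λ m N f) O :=
  ((hQ.cont.mul ((hS.hasPlanePartials_radius hO1).cont.pow 2)).mul
    (hf.hasPlanePartials_intVV hO).cont).add
    ((hP.cont.mul ((hS.hasPlanePartials_omegaSq hO1).cont.div_const 4)).mul
    (hf.hasPlanePartials_intSS hO).cont)

theorem continuousOn_horizonDensity (hS : Subextremal Λ m) (hO : IsOpen O)
    (hO1 : ∀ q ∈ O, q.1 * q.2 < 1) (hP : HasPlanePartials O (fun q => (N q).1) Pu Pv)
    (hQ : HasPlanePartials O (fun q => (N q).2) Qu Qv) {f : Point → ℝ} (hf : IsC2On (cyl O) f) :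
    ContinuousOn (horizonDensity Λ m N f) O :=
  ((hP.cont.mul ((hS.hasPlanePartials_radius hO1).cont.pow 2)).mul
    (hf.hasPlanePartials_intUU hO).cont).add
    ((hQ.cont.mul ((hS.hasPlanePartials_omegaSq hO1).cont.div_const 4)).mul
    (hf.hasPlanePartials_intSS hO).cont)

/-- An integral over a part of an edge, on which the weight is bounded below. -/
theorem mul_integral_le_of_weight {F : ℝ → ℝ} {a b ε : ℝ} (hab : a ≤ b) (hε : 0 < ε)
    (hc : ContinuousOn F (Icc a (b + ε))) (h0 : ∀ x ∈ Icc a (b + ε), 0 ≤ F x) :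
    ε * ∫ x in a..b, F x ≤ ∫ x in a..(b + ε), (b + ε - x) * F x := by
  have hb : b ≤ b + ε := by linarith
  have hc' : ContinuousOn (fun x => (b + ε - x) * F x) (Icc a (b + ε)) :=
    ContinuousOn.mul (by fun_prop) hc
  have i1 : IntervalIntegrable (fun x => (b + ε - x) * F x) volume a b :=
    (hc'.mono (Icc_subset_Icc_right hb)).intervalIntegrable_of_Icc hab
  have i2 : IntervalIntegrable (fun x => (b + ε - x) * F x) volume b (b + ε) :=
    (hc'.mono (Icc_subset_Icc_left hab)).intervalIntegrable_of_Icc hb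
  have i3 : IntervalIntegrable F volume a b :=
    (hc.mono (Icc_subset_Icc_right hb)).intervalIntegrable_of_Icc hab
  rw [← intervalIntegral.integral_add_adjacent_intervals i1 i2,
    ← intervalIntegral.integral_const_mul]
  have h1 : ∫ x in a..b, ε * F x ≤ ∫ x in a..b, (b + ε - x) * F x :=
    intervalIntegral.integral_mono_on hab (i3.const_mul ε) i1 fun x hx =>
      mul_le_mul_of_nonneg_right (by linarith [hx.2]) (h0 x ⟨hx.1, hx.2.trans hb⟩)
  have h2 : 0 ≤ ∫ x in b..(b + ε), (b + ε - x) * F x :=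
    intervalIntegral.integral_nonneg hb fun x hx =>
      mul_nonneg (by linarith [hx.2]) (h0 x ⟨hab.trans hx.1, hx.2⟩)
  linarith

/-- The densities of the fluxes of the difference of two approximating sequences tend to zero. -/
theorem Approximates.tendsto_flux_sub (hS : Subextremal Λ m) (hO : IsOpen O)
    (hO1 : ∀ q ∈ O, q.1 * q.2 < 1) (hOU : cyl O ⊆ U)
    (hP : HasPlanePartials O (fun q => (N q).1) Pu Pv)
    (hQ : HasPlanePartials O (fun q => (N q).2) Qu Qv) (hN : ∀ q ∈ O, 0 ≤ (N q).1 ∧ 0 ≤ (N q).2)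
    (hψ : AEStronglyMeasurable ψ (chartMeasure.restrict U)) (hs : Approximates Λ m U ψ s)
    (hs' : Approximates Λ m U ψ s') {u₁ u₂ v₁ v₂ : ℝ} (hu : u₁ ≤ u₂) (hv : v₁ ≤ v₂)
    (hR : Icc u₁ u₂ ×ˢ Icc v₁ v₂ ⊆ O) :
    Tendsto (fun j : ℕ × ℕ => ∫ u in u₁..u₂,
      horizonDensity Λ m N (fun p => s j.1 p - s' j.2 p) (u, v₁)) atTop (𝓝 0) ∧
    Tendsto (fun j : ℕ × ℕ => ∫ v in v₁..v₂,
      coneDensity Λ m N (fun p => s j.1 p - s' j.2 p) (u₁, v)) atTop (𝓝 0) := by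
  obtain ⟨ε, hε, hR'⟩ := exists_thickened_rectangle hO hu hv hR
  -- The enlargement is towards the future only: the past edges, where the fluxes are taken, must
  -- not move.
  have hR2 : Icc u₁ (u₂ + ε) ×ˢ Icc v₁ (v₂ + ε) ⊆ O :=
    (Set.prod_mono (Icc_subset_Icc_left (by linarith)) (Icc_subset_Icc_left (by linarith))).trans
      hR'
  have hu' : u₁ < u₂ + ε := by linarith
  have hv' : v₁ < v₂ + ε := by linarith
  obtain ⟨C, hC⟩ := hS.exists_trace_bound hO hO1 hP hQ hN hu' hv' hR2
  have hE := (Approximates.tendsto_energy_sub hψ hs hs' hO hOU hu'.le hv'.le hR2).const_mul C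
  rw [mul_zero] at hE
  have hcl := fun j : ℕ × ℕ => hS.isClassicalSolution_sub hO hO1 (hs.isClassicalSolution hOU j.1)
    (hs'.isClassicalSolution hOU j.2)
  have hmu : ∀ u ∈ Icc u₁ (u₂ + ε), (u, v₁) ∈ O := fun u hu => hR2 ⟨hu, le_rfl, hv'.le⟩
  have hmv : ∀ v ∈ Icc v₁ (v₂ + ε), (u₁, v) ∈ O := fun v hv => hR2 ⟨⟨le_rfl, hu'.le⟩, hv⟩
  constructor
  · have hE' := hE.const_mul ((v₂ + ε - v₁) * ε)⁻¹
    rw [mul_zero] at hE'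
    have h0 : ∀ (f : Point → ℝ), ∀ u ∈ Icc u₁ (u₂ + ε), 0 ≤ horizonDensity Λ m N f (u, v₁) :=
      fun f u hu => hS.horizonDensity_nonneg f (hO1 _ (hmu u hu)) (hN _ (hmu u hu)).1
        (hN _ (hmu u hu)).2
    refine squeeze_zero (fun j => intervalIntegral.integral_nonneg hu fun u hu1 =>
      h0 _ u ⟨hu1.1, hu1.2.trans (by linarith)⟩) (fun j => ?_) hE'
    have hvp : 0 < v₂ + ε - v₁ := by linarith
    rw [le_inv_mul_iff₀ (by positivity), mul_assoc]
    refine le_trans (mul_le_mul_of_nonneg_left (mul_integral_le_of_weight hu hε ?_ (h0 _)) hvp.le)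
      (hC _ (hcl j)).1
    exact (continuousOn_horizonDensity hS hO hO1 hP hQ (hcl j).1).comp
      (f := fun u : ℝ => (u, v₁)) (by fun_prop) hmu
  · have hE' := hE.const_mul ((u₂ + ε - u₁) * ε)⁻¹
    rw [mul_zero] at hE'
    have h0 : ∀ (f : Point → ℝ), ∀ v ∈ Icc v₁ (v₂ + ε), 0 ≤ coneDensity Λ m N f (u₁, v) :=
      fun f v hv => hS.coneDensity_nonneg f (hO1 _ (hmv v hv)) (hN _ (hmv v hv)).1
        (hN _ (hmv v hv)).2
    refine squeeze_zero (fun j => intervalIntegral.integral_nonneg hv fun v hv1 =>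
      h0 _ v ⟨hv1.1, hv1.2.trans (by linarith)⟩) (fun j => ?_) hE'
    have hup : 0 < u₂ + ε - u₁ := by linarith
    rw [le_inv_mul_iff₀ (by positivity), mul_assoc]
    refine le_trans (mul_le_mul_of_nonneg_left (mul_integral_le_of_weight hv hε ?_ (h0 _)) hup.le)
      (hC _ (hcl j)).2
    exact (continuousOn_coneDensity hS hO hO1 hP hQ (hcl j).1).comp
      (f := fun v : ℝ => (u₁, v)) (by fun_prop) hmv

/-- The flux through a cone exists. -/
theorem exists_hasFlux_cone (hS : Subextremal Λ m) (hO : IsOpen O)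
    (hO1 : ∀ q ∈ O, q.1 * q.2 < 1) (hOU : cyl O ⊆ U)
    (hP : HasPlanePartials O (fun q => (N q).1) Pu Pv)
    (hQ : HasPlanePartials O (fun q => (N q).2) Qu Qv) (hN : ∀ q ∈ O, 0 ≤ (N q).1 ∧ 0 ≤ (N q).2)
    (hψ : IsFiniteEnergySolution Λ m U ψ) {r₀ u : ℝ} (hw : 0 ≤ uvOfRadius Λ m r₀ / u)
    (hu : ∀ v ∈ Icc 0 (uvOfRadius Λ m r₀ / u), (u, v) ∈ O) :
    ∃ F, HasFlux Λ m U ψ (coneFlux Λ m N r₀ u) F := by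
  -- The cone is treated as a rectangle of zero width in `u`; the trace estimate thickens it inside
  -- `O`.
  have hR : Icc u u ×ˢ Icc 0 (uvOfRadius Λ m r₀ / u) ⊆ O := by
    rintro ⟨x, v⟩ ⟨hx, hv⟩
    obtain rfl : x = u := by simpa using hx
    exact hu v hv
  have hcont : ∀ {f : Point → ℝ}, IsC2On (cyl O) f →
      ContinuousOn (fun v => coneDensity Λ m N f (u, v)) (Icc 0 (uvOfRadius Λ m r₀ / u)) :=
    fun hf => (continuousOn_coneDensity hS hO hO1 hP hQ hf).comp
      (f := fun v : ℝ => (u, v)) (by fun_prop) hu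
  have hint : ∀ {f : Point → ℝ}, IsC2On (cyl O) f → Integrable
      (fun v => coneDensity Λ m N f (u, v))
      (volume.restrict (Ioc 0 (uvOfRadius Λ m r₀ / u))) :=
    fun hf => ((hcont hf).integrableOn_compact isCompact_Icc).mono_set Ioc_subset_Icc_self
  have hae : ∀ {p : ℝ → Prop}, (∀ v, (u, v) ∈ O → p v) →
      ∀ᵐ v ∂volume.restrict (Ioc 0 (uvOfRadius Λ m r₀ / u)), p v := fun hp =>
    (ae_restrict_iff' measurableSet_Ioc).2 (Eventually.of_forall fun v hv =>
      hp v (hu v (Ioc_subset_Icc_self hv)))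
  obtain ⟨L, hL, hlim⟩ := exists_density_limit (Λ := Λ) (m := m) (U := U) (ψ := ψ)
    (μ := volume.restrict (Ioc 0 (uvOfRadius Λ m r₀ / u)))
    (ρ := fun f v => coneDensity Λ m N f (u, v)) hψ.2
    (fun s hs j => hint (hs.isC2On hOU j)) (fun s s' hs hs' => by
      have hc := hs.isC2On (O := O) hOU
      have hc' := hs'.isC2On (O := O) hOU
      refine tendsto_integral_abs_sub (D := fun j v =>
        coneDensity Λ m N (fun p => s j.1 p - s' j.2 p) (u, v)) (fun j => hint (hc j))
        (fun j => hint (hc' j)) (fun j => hint ((hc _).sub (hc' _))) (fun j t ht => hae ?_)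
        (fun j t ht => hae ?_)
        (fun j => hae fun v hv => hS.coneDensity_nonneg _ (hO1 _ hv) (hN _ hv).1 (hN _ hv).2)
        (fun j => hae fun v hv => hS.coneDensity_nonneg _ (hO1 _ hv) (hN _ hv).1 (hN _ hv).2) ?_
      · intro v hv
        -- The inequality is applied to `s' - (s' - s) = s`; the density of `s' - s` equals that of
        -- `s - s'`.
        have h1 := hS.coneDensity_sub_le (hO1 _ hv) (hN _ hv).1 (hN _ hv).2 (hc' j.2)
          ((hc' j.2).sub (hc j.1)) hv ht
        obtain ⟨-, e2, e3⟩ := (hc j.1).int_sub_comm (hc' j.2) hv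
        simp only [sub_sub_cancel] at h1
        simp only [coneDensity] at h1 ⊢
        rwa [e2, e3]
      · intro v hv
        have h1 := hS.coneDensity_sub_le (hO1 _ hv) (hN _ hv).1 (hN _ hv).2 (hc j.1)
          ((hc j.1).sub (hc' j.2)) hv ht
        simpa only [sub_sub_cancel] using h1
      · have := (Approximates.tendsto_flux_sub hS hO hO1 hOU hP hQ hN hψ.1 hs hs' le_rfl hw hR).2
        simpa only [intervalIntegral.integral_of_le hw] using this)
  refine ⟨∫ v in Ioc 0 (uvOfRadius Λ m r₀ / u), L v, fun s hs => ?_⟩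
  have hc := hs.isC2On (O := O) hOU
  refine (tendsto_integral_of_abs_sub (fun j => hint (hc j)) hL (hlim s hs)).congr fun j => ?_
  rw [hS.coneFlux_eq hO1 (hc j) N hw hu, intervalIntegral.integral_of_le hw]

end

end SchwarzschildDeSitter

namespace SchwarzschildDeSitter

/-! ### The flux density along the horizon -/

theorem ae_hasDerivAt_of_eq_integral {F L : ℝ → ℝ} {a b c : ℝ} (hab : a ≤ b)
    (hL : IntervalIntegrable L volume a b) (hc : c ∈ Icc a b)
    (hF : ∀ x ∈ Ioo a b, F x = ∫ t in c..x, L t) :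
    ∀ᵐ x, x ∈ Ioo a b → HasDerivAt F (L x) x := by
  filter_upwards [hL.ae_hasDerivAt_integral] with x hx hxm
  rw [uIcc_of_le hab] at hx
  refine (hx (Ioo_subset_Icc_self hxm) c hc).congr_of_eventuallyEq ?_
  filter_upwards [isOpen_Ioo.mem_nhds hxm] with y hy using hF y hy

theorem ae_restrict_Ioc_of_Ioo {p : ℝ → Prop} {a b : ℝ} (h : ∀ᵐ x, x ∈ Ioo a b → p x) :
    ∀ᵐ x ∂volume.restrict (Ioc a b), p x := by
  rw [← restrict_Ioo_eq_restrict_Ioc]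
  exact (ae_restrict_iff' measurableSet_Ioo).2 h

/-- Convergence in `L ^ 1` implies convergence of the integrals against continuous weights. -/
theorem tendsto_integral_mul_of_abs_sub {F : ℕ → ℝ → ℝ} {L φ : ℝ → ℝ} {a b x y : ℝ}
    (hF : ∀ j, IntegrableOn (F j) (Ioc a b)) (hL : IntegrableOn L (Ioc a b))
    (hφ : Continuous φ) (hx : x ∈ Icc a b) (hy : y ∈ Icc a b)
    (h : Tendsto (fun j => ∫ t in Ioc a b, |F j t - L t|) atTop (𝓝 0)) :
    Tendsto (fun j => ∫ t in x..y, φ t * F j t) atTop (𝓝 (∫ t in x..y, φ t * L t)) := by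
  obtain ⟨C, hC⟩ := isCompact_Icc.exists_bound_of_continuousOn (hφ.continuousOn (s := Icc a b))
  have hsub : uIoc x y ⊆ Ioc a b := by
    rw [uIoc]
    exact Ioc_subset_Ioc (le_min hx.1 hy.1) (max_le hx.2 hy.2)
  have hbd : ∀ t ∈ Ioc a b, ‖φ t‖ ≤ C := fun t ht => hC t (Ioc_subset_Icc_self ht)
  have hm : ∀ {G : ℝ → ℝ}, IntegrableOn G (Ioc a b) → IntegrableOn (fun t => φ t * G t) (Ioc a b) :=
    fun hG => hG.bdd_mul hφ.aestronglyMeasurable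
      ((ae_restrict_iff' measurableSet_Ioc).2 (Eventually.of_forall hbd))
  have hi : ∀ {G : ℝ → ℝ}, IntegrableOn G (Ioc a b) → IntervalIntegrable G volume x y :=
    fun hG => intervalIntegrable_iff.2 (hG.mono_set hsub)
  have h2 := h.const_mul C
  rw [mul_zero] at h2
  rw [tendsto_iff_dist_tendsto_zero]
  refine squeeze_zero (fun _ => dist_nonneg) (fun j => ?_) h2
  have hd : IntegrableOn (fun t => |F j t - L t|) (Ioc a b) := ((hF j).sub hL).abs
  rw [Real.dist_eq, ← intervalIntegral.integral_sub (hi (hm (hF j))) (hi (hm hL)),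
    ← Real.norm_eq_abs, ← integral_const_mul]
  refine intervalIntegral.norm_integral_le_integral_norm_uIoc.trans ?_
  refine (setIntegral_mono_set (((hm (hF j)).sub (hm hL)).norm)
    (Eventually.of_forall fun t => norm_nonneg _) hsub.eventuallyLE).trans ?_
  refine setIntegral_mono_on ((hm (hF j)).sub (hm hL)).norm (hd.const_mul C) measurableSet_Ioc
    fun t ht => ?_
  simp only [Pi.sub_apply]
  rw [← mul_sub, norm_mul]
  exact mul_le_mul_of_nonneg_right (hbd t ht) (abs_nonneg _)

section

variable {Λ m u₀ τ₀ : ℝ} {U : Set Point} {ψ : Point → ℝ} {s : ℕ → Point → ℝ} {O : Set (ℝ × ℝ)}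
  {N : ℝ × ℝ → ℝ × ℝ} {Pu Pv Qu Qv : ℝ × ℝ → ℝ}

theorem Subextremal.lt_horizonU (hS : Subextremal Λ m) (hu : 0 < u₀) {τ : ℝ} (h : τ₀ < τ) :
    u₀ < horizonU Λ m u₀ τ₀ τ := by
  have := (hS.horizonU_lt_iff hu τ₀).2 h
  rwa [horizonU_base] at this

theorem horizonRate_sub_le (hS : Subextremal Λ m) (hu : 0 < u₀) {τ : ℝ} {f g : Point → ℝ}
    (hO1 : ∀ q ∈ O, q.1 * q.2 < 1) (hN : ∀ q ∈ O, 0 ≤ (N q).1 ∧ 0 ≤ (N q).2)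
    (hq : (horizonU Λ m u₀ τ₀ τ, 0) ∈ O) (hf : IsC2On (cyl O) f) (hg : IsC2On (cyl O) g) {t : ℝ}
    (ht : 0 < t) :
    horizonRate Λ m N u₀ τ₀ (fun p => f p - g p) τ ≤
      (1 + t) * horizonRate Λ m N u₀ τ₀ f τ + (1 + t⁻¹) * horizonRate Λ m N u₀ τ₀ g τ := by
  have h1 := hS.horizonDensity_sub_le (hO1 _ hq) (hN _ hq).1 (hN _ hq).2 hf hg hq ht
  have h2 := mul_le_mul_of_nonneg_left h1
    (mul_pos hS.kappa_pos (horizonU_pos Λ m hu τ₀ τ)).le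
  simp only [horizonRate]
  linarith

theorem continuousOn_horizonRate (hS : Subextremal Λ m) (hO : IsOpen O)
    (hO1 : ∀ q ∈ O, q.1 * q.2 < 1) (hP : HasPlanePartials O (fun q => (N q).1) Pu Pv)
    (hQ : HasPlanePartials O (fun q => (N q).2) Qu Qv) {f : Point → ℝ} (hf : IsC2On (cyl O) f)
    {A : Set ℝ} (hA : ∀ τ ∈ A, (horizonU Λ m u₀ τ₀ τ, 0) ∈ O) :
    ContinuousOn (horizonRate Λ m N u₀ τ₀ f) A := by
  have hU := continuous_horizonU Λ m u₀ τ₀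
  refine ContinuousOn.mul (by fun_prop) ?_
  exact (continuousOn_horizonDensity hS hO hO1 hP hQ hf).comp
    (f := fun τ : ℝ => (horizonU Λ m u₀ τ₀ τ, (0 : ℝ))) (by fun_prop) hA

/-- Convergence of the total flux would not suffice, as the energy inequality integrates the rate
against `e^{bτ}`. The quadratic comparison upgrades smallness of the flux of differences to `L¹`
convergence of the rates. -/
theorem exists_rate_limit (hS : Subextremal Λ m) (hO : IsOpen O)
    (hO1 : ∀ q ∈ O, q.1 * q.2 < 1) (hOU : cyl O ⊆ U)
    (hP : HasPlanePartials O (fun q => (N q).1) Pu Pv)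
    (hQ : HasPlanePartials O (fun q => (N q).2) Qu Qv) (hN : ∀ q ∈ O, 0 ≤ (N q).1 ∧ 0 ≤ (N q).2)
    (hψ : IsFiniteEnergySolution Λ m U ψ) (hu : 0 < u₀) {τ₁ τ₂ : ℝ} (hτ : τ₁ ≤ τ₂)
    (hH : ∀ u ∈ Icc (horizonU Λ m u₀ τ₀ τ₁) (horizonU Λ m u₀ τ₀ τ₂), (u, 0) ∈ O) :
    ∃ L : ℝ → ℝ, IntegrableOn L (Ioc τ₁ τ₂) ∧ ∀ s, Approximates Λ m U ψ s →
      (∀ j, IntegrableOn (horizonRate Λ m N u₀ τ₀ (s j)) (Ioc τ₁ τ₂)) ∧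
      Tendsto (fun j => ∫ τ in Ioc τ₁ τ₂, |horizonRate Λ m N u₀ τ₀ (s j) τ - L τ|) atTop
        (𝓝 0) := by
  have hA : ∀ τ ∈ Icc τ₁ τ₂, (horizonU Λ m u₀ τ₀ τ, 0) ∈ O := fun τ hτ =>
    hH _ (hS.image_horizonU hu τ₀ τ₁ τ₂ ⟨τ, hτ, rfl⟩)
  have hint : ∀ {f : Point → ℝ}, IsC2On (cyl O) f →
      IntegrableOn (horizonRate Λ m N u₀ τ₀ f) (Ioc τ₁ τ₂) := fun hf =>
    ((continuousOn_horizonRate hS hO hO1 hP hQ hf hA).integrableOn_compact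
      isCompact_Icc).mono_set Ioc_subset_Icc_self
  have hae : ∀ {p : ℝ → Prop}, (∀ τ, (horizonU Λ m u₀ τ₀ τ, 0) ∈ O → p τ) →
      ∀ᵐ τ ∂volume.restrict (Ioc τ₁ τ₂), p τ := fun hp =>
    (ae_restrict_iff' measurableSet_Ioc).2 (Eventually.of_forall fun τ hτ =>
      hp τ (hA τ (Ioc_subset_Icc_self hτ)))
  have h0 : ∀ (f : Point → ℝ) (τ : ℝ), (horizonU Λ m u₀ τ₀ τ, 0) ∈ O →
      0 ≤ horizonRate Λ m N u₀ τ₀ f τ := fun f τ hq =>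
    mul_nonneg (mul_pos hS.kappa_pos (horizonU_pos Λ m hu τ₀ τ)).le
      (hS.horizonDensity_nonneg f (hO1 _ hq) (hN _ hq).1 (hN _ hq).2)
  obtain ⟨L, hL, hlim⟩ := exists_density_limit (Λ := Λ) (m := m) (U := U) (ψ := ψ)
    (μ := volume.restrict (Ioc τ₁ τ₂)) (ρ := fun f τ => horizonRate Λ m N u₀ τ₀ f τ) hψ.2
    (fun s hs j => hint (hs.isC2On hOU j)) (fun s s' hs hs' => by
      have hc := hs.isC2On (O := O) hOU
      have hc' := hs'.isC2On (O := O) hOU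
      refine tendsto_integral_abs_sub (D := fun j τ =>
        horizonRate Λ m N u₀ τ₀ (fun p => s j.1 p - s' j.2 p) τ) (fun j => hint (hc j))
        (fun j => hint (hc' j)) (fun j => hint ((hc _).sub (hc' _))) (fun j t ht => hae ?_)
        (fun j t ht => hae ?_) (fun j => hae (h0 _)) (fun j => hae (h0 _)) ?_
      · intro τ hv
        have h1 := horizonRate_sub_le hS hu hO1 hN hv (hc' j.2) ((hc' j.2).sub (hc j.1)) ht
        obtain ⟨e1, -, e3⟩ := (hc j.1).int_sub_comm (hc' j.2) hv
        simp only [sub_sub_cancel] at h1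
        simp only [horizonRate, horizonDensity] at h1 ⊢
        rwa [e1, e3]
      · intro τ hv
        have h1 := horizonRate_sub_le hS hu hO1 hN hv (hc j.1) ((hc j.1).sub (hc' j.2)) ht
        simpa only [sub_sub_cancel] using h1
      · have hR : Icc (horizonU Λ m u₀ τ₀ τ₁) (horizonU Λ m u₀ τ₀ τ₂) ×ˢ Icc (0 : ℝ) 0 ⊆ O := by
          rintro ⟨x, v⟩ ⟨hx, hv⟩
          obtain rfl : v = 0 := by simpa using hv
          exact hH x hx
        refine (Approximates.tendsto_flux_sub hS hO hO1 hOU hP hQ hN hψ.1 hs hs'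
          ((hS.horizonU_le_iff hu τ₀).2 hτ) le_rfl hR).1.congr fun j => ?_
        have hd := (hc j.1).sub (hc' j.2)
        rw [← hS.horizonFlux_eq hO1 hd N ((hS.horizonU_le_iff hu τ₀).2 hτ) hH,
          hS.horizonFlux_eq_integral_rate hO1 hd N hu hτ
            (continuousOn_horizonDensity hS hO hO1 hP hQ hd) hH,
          intervalIntegral.integral_of_le hτ])
  exact ⟨L, hL, fun s hs => ⟨fun j => hint (hs.isC2On hOU j), hlim s hs⟩⟩

/-- The flux through a segment of the horizon is the integral of the limit of the rates. -/
theorem hasFlux_horizon_of_rate_limit (hS : Subextremal Λ m) (hO : IsOpen O)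
    (hO1 : ∀ q ∈ O, q.1 * q.2 < 1) (hOU : cyl O ⊆ U)
    (hP : HasPlanePartials O (fun q => (N q).1) Pu Pv)
    (hQ : HasPlanePartials O (fun q => (N q).2) Qu Qv) (hu : 0 < u₀)
    (hH : ∀ u, u₀ < u → (u, 0) ∈ O) {α β : ℝ} {L : ℝ → ℝ}
    (hL : IntegrableOn L (Ioc α β)) (hlim : ∀ s, Approximates Λ m U ψ s →
      (∀ j, IntegrableOn (horizonRate Λ m N u₀ τ₀ (s j)) (Ioc α β)) ∧
      Tendsto (fun j => ∫ τ in Ioc α β, |horizonRate Λ m N u₀ τ₀ (s j) τ - L τ|) atTop (𝓝 0))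
    (hα : τ₀ < α) {τ₁ τ₂ : ℝ} (h1 : τ₁ ∈ Icc α β) (h2 : τ₂ ∈ Icc α β) (hτ : τ₁ ≤ τ₂) :
    HasFlux Λ m U ψ (horizonFlux Λ m N (horizonU Λ m u₀ τ₀ τ₁) (horizonU Λ m u₀ τ₀ τ₂))
      (∫ τ in τ₁..τ₂, L τ) := by
  intro s hs
  have hc := hs.isC2On (O := O) hOU
  have key := tendsto_integral_mul_of_abs_sub (φ := fun _ => 1) (hlim s hs).1 hL continuous_const
    h1 h2 (hlim s hs).2
  simp only [one_mul] at key
  refine key.congr fun j => (hS.horizonFlux_eq_integral_rate hO1 (hc j) N hu hτ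
    (continuousOn_horizonDensity hS hO hO1 hP hQ (hc j)) fun u hu' => hH u ?_).symm
  exact (hS.lt_horizonU hu (hα.trans_le h1.1)).trans_le hu'.1

/-- The `L¹` limits exist on compact segments and only up to null sets. A single density on the
whole horizon is obtained by differentiating a common primitive, which by Lebesgue's theorem
recovers each local limit almost everywhere. -/
theorem exists_isFluxDensity (hS : Subextremal Λ m) (hO : IsOpen O)
    (hO1 : ∀ q ∈ O, q.1 * q.2 < 1) (hOU : cyl O ⊆ U)
    (hP : HasPlanePartials O (fun q => (N q).1) Pu Pv)
    (hQ : HasPlanePartials O (fun q => (N q).2) Qu Qv) (hN : ∀ q ∈ O, 0 ≤ (N q).1 ∧ 0 ≤ (N q).2)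
    (hψ : IsFiniteEnergySolution Λ m U ψ) (hu : 0 < u₀) (hH : ∀ u, u₀ < u → (u, 0) ∈ O) :
    ∃ g : ℝ → ℝ, IsFluxDensity Λ m U N u₀ τ₀ ψ g := by
  obtain ⟨s₀, hs₀⟩ := hψ.2
  -- The primitive is based at the arbitrary point `τ₀ + 1` of the open half line and is defined
  -- from one fixed sequence.
  set F : ℝ → ℝ := fun τ =>
    limUnder atTop fun j => ∫ t in (τ₀ + 1)..τ, horizonRate Λ m N u₀ τ₀ (s₀ j) t with hF
  refine ⟨deriv F, fun τ₁ τ₂ h1 h2 => ?_⟩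
  -- The segment `[α, β]` has to contain both the given segment and the base point `τ₀ + 1`, and
  -- still lie to the future of `τ₀`.
  obtain ⟨α, hα0, hα⟩ := exists_between (lt_min h1 (lt_add_one τ₀))
  obtain ⟨hα1, hα2⟩ := lt_min_iff.1 hα
  set β := max τ₂ (τ₀ + 1) with hβ
  have hαβ : α ≤ β := hα2.le.trans (le_max_right _ _)
  obtain ⟨L, hL, hlim⟩ := exists_rate_limit (τ₀ := τ₀) hS hO hO1 hOU hP hQ hN hψ hu hαβ
    fun u hu' => hH u ((hS.lt_horizonU hu hα0).trans_le hu'.1)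
  have hmem : τ₀ + 1 ∈ Icc α β := ⟨hα2.le, le_max_right _ _⟩
  have hFL : ∀ x ∈ Ioo α β, F x = ∫ t in (τ₀ + 1)..x, L t := by
    intro x hx
    have key := tendsto_integral_mul_of_abs_sub (φ := fun _ => 1) (hlim s₀ hs₀).1 hL
      continuous_const hmem (Ioo_subset_Icc_self hx) (hlim s₀ hs₀).2
    simp only [one_mul] at key
    exact key.limUnder_eq
  have hLi : IntervalIntegrable L volume α β := (intervalIntegrable_iff_integrableOn_Ioc_of_le hαβ).2 hL
  have hae : ∀ᵐ x ∂volume.restrict (Ioc α β), L x = deriv F x :=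
    ae_restrict_Ioc_of_Ioo ((ae_hasDerivAt_of_eq_integral hαβ hLi hmem hFL).mono fun x hx hxm =>
      (hx hxm).deriv.symm)
  have hsub : Ioc τ₁ τ₂ ⊆ Ioc α β := Ioc_subset_Ioc hα1.le (le_max_left _ _)
  have hae' : ∀ᵐ x ∂volume.restrict (Ioc τ₁ τ₂), L x = deriv F x :=
    ae_mono (Measure.restrict_mono hsub le_rfl) hae
  constructor
  · rw [intervalIntegrable_iff_integrableOn_Ioc_of_le h2.le]
    exact (hL.mono_set hsub).congr hae'
  · have hI : ∫ τ in τ₁..τ₂, deriv F τ = ∫ τ in τ₁..τ₂, L τ := by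
      rw [intervalIntegral.integral_of_le h2.le, intervalIntegral.integral_of_le h2.le]
      exact (integral_congr_ae hae').symm
    rw [hI]
    exact hasFlux_horizon_of_rate_limit hS hO hO1 hOU hP hQ hu hH hL hlim hα0
      ⟨hα1.le, h2.le.trans (le_max_left _ _)⟩ ⟨(hα1.trans h2).le, le_max_left _ _⟩ h2.le

/-- The flux density is the limit of the rates. -/
theorem IsFluxDensity.ae_eq_rate_limit (hS : Subextremal Λ m) (hO : IsOpen O)
    (hO1 : ∀ q ∈ O, q.1 * q.2 < 1) (hOU : cyl O ⊆ U)
    (hP : HasPlanePartials O (fun q => (N q).1) Pu Pv)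
    (hQ : HasPlanePartials O (fun q => (N q).2) Qu Qv)
    (hψ : IsFiniteEnergySolution Λ m U ψ) (hu : 0 < u₀) (hH : ∀ u, u₀ < u → (u, 0) ∈ O)
    {g : ℝ → ℝ} (hg : IsFluxDensity Λ m U N u₀ τ₀ ψ g) {τ₁ τ₂ : ℝ} {L : ℝ → ℝ}
    (hL : IntegrableOn L (Ioc τ₁ τ₂)) (hlim : ∀ s, Approximates Λ m U ψ s →
      (∀ j, IntegrableOn (horizonRate Λ m N u₀ τ₀ (s j)) (Ioc τ₁ τ₂)) ∧
      Tendsto (fun j => ∫ τ in Ioc τ₁ τ₂, |horizonRate Λ m N u₀ τ₀ (s j) τ - L τ|) atTop (𝓝 0))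
    (h1 : τ₀ < τ₁) (h2 : τ₁ < τ₂) :
    ∀ᵐ τ ∂volume.restrict (Ioc τ₁ τ₂), L τ = g τ := by
  obtain ⟨s₀, hs₀⟩ := hψ.2
  have hLi := (intervalIntegrable_iff_integrableOn_Ioc_of_le h2.le).2 hL
  have hm : τ₁ ∈ Icc τ₁ τ₂ := ⟨le_rfl, h2.le⟩
  -- Both sides are the limit of the same fluxes along `s₀`. Equal primitives have equal densities
  -- almost everywhere.
  have heq : ∀ x ∈ Ioo τ₁ τ₂, ∫ t in τ₁..x, g t = ∫ t in τ₁..x, L t := fun x hx =>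
    tendsto_nhds_unique ((hg τ₁ x h1 hx.1).2 s₀ hs₀)
      (hasFlux_horizon_of_rate_limit hS hO hO1 hOU hP hQ hu hH hL hlim h1 hm
        (Ioo_subset_Icc_self hx) hx.1.le s₀ hs₀)
  refine ae_restrict_Ioc_of_Ioo ?_
  filter_upwards [ae_hasDerivAt_of_eq_integral h2.le hLi hm heq,
    ae_hasDerivAt_of_eq_integral h2.le (hg τ₁ τ₂ h1 h2).1 hm fun x _ => rfl] with x hx hx' hxm
  exact (hx hxm).unique (hx' hxm)

end

end SchwarzschildDeSitter

namespace SchwarzschildDeSitter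

/-! ### The energy inequality for finite energy solutions -/

section

variable {Λ m u₀ τ₀ : ℝ}

/-- The part of the `(u, v)` plane near the horizon over which the spheres lie in `U`. -/
def spheresIn (U : Set Point) (δ : ℝ) : Set (ℝ × ℝ) :=
  {q | (∀ x, (q.1, q.2, x) ∈ U) ∧ 0 < q.1 ∧ q.1 * q.2 ∈ Ioo (-δ) δ}

/-- The points whose sphere meets the complement of `U` form the projection of a closed set along
the compact sphere, hence a closed set. -/
theorem isOpen_spheresIn {U : Set Point} (hU : IsOpen U) (δ : ℝ) : IsOpen (spheresIn U δ) := by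
  have h1 : IsOpen {q : ℝ × ℝ | ∀ x, (q.1, q.2, x) ∈ U} := by
    have hc : IsClosed ((MeasurableEquiv.prodAssoc : (ℝ × ℝ) × S2 ≃ᵐ ℝ × ℝ × S2) ⁻¹' Uᶜ) :=
      hU.isClosed_compl.preimage (Homeomorph.prodAssoc ℝ ℝ S2).continuous
    have h2 := (isClosedMap_fst_of_compactSpace (X := ℝ × ℝ) (Y := S2)) _ hc
    convert h2.isOpen_compl using 1
    ext q
    simp only [mem_ofPred_eq, mem_compl_iff, mem_image, mem_preimage, not_exists, not_and]
    constructor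
    · rintro h ⟨q', x⟩ hx rfl
      exact hx (h x)
    · intro h x
      by_contra hx
      exact h (q, x) hx rfl
  have h3 : IsOpen {q : ℝ × ℝ | 0 < q.1} := isOpen_lt continuous_const continuous_fst
  have h4 : IsOpen {q : ℝ × ℝ | q.1 * q.2 ∈ Ioo (-δ) δ} :=
    isOpen_Ioo.preimage (continuous_fst.mul continuous_snd)
  exact h1.inter (h3.inter h4)

theorem cyl_spheresIn_subset (U : Set Point) (δ : ℝ) : cyl (spheresIn U δ) ⊆ U :=
  fun p hp => hp.1 p.2.2

/-- The classical inequality is applied to an approximating sequence over the open set of full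
spheres in `U`. Each of its terms converges, the horizon term by `L¹` convergence against the
bounded weight `e^{bτ}`. -/
theorem Subextremal.energy_decay (hS : Subextremal Λ m) {σ δ b : ℝ} {a c : ℝ → ℝ}
    (hδ1 : δ < 1) (h : IsRedshiftProfile Λ m σ δ a c)
    (hco : ∀ w ∈ Ioo (-δ) δ, IsCoerciveAt Λ m b w (kappa Λ m + a w) (c w - kappa Λ m * w)
      (deriv a w) (deriv c w - kappa Λ m))
    {r₀ : ℝ} (hr : rC Λ m < r₀) (hr' : r₀ < areaRadius Λ m δ) (hu : 0 < u₀) {U : Set Point}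
    (hU : IsOpen U) (hUr : {p ∈ redshiftRegion Λ m r₀ | u₀ < p.1} ⊆ U) {ψ : Point → ℝ}
    (hψ : IsFiniteEnergySolution Λ m U ψ) :
    ∃ f : ℝ → ℝ,
      (∀ τ : ℝ, τ₀ < τ → HasFlux Λ m U ψ
        (coneFlux Λ m (fieldN Λ m (profileField a c)) r₀ (horizonU Λ m u₀ τ₀ τ)) (f τ)) ∧
      (∃ g : ℝ → ℝ, IsFluxDensity Λ m U (fieldN Λ m (profileField a c)) u₀ τ₀ ψ g) ∧
      ∀ g : ℝ → ℝ, IsFluxDensity Λ m U (fieldN Λ m (profileField a c)) u₀ τ₀ ψ g →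
        ∀ τ₁ τ₂ : ℝ, τ₀ < τ₁ → τ₁ < τ₂ →
          f τ₂ ≤ f τ₁ * Real.exp (-b * (τ₂ - τ₁)) +
            ∫ τ in τ₁..τ₂, g τ * Real.exp (-b * (τ₂ - τ)) := by
  set O := spheresIn U δ with hOdef
  set N := fieldN Λ m (profileField a c) with hNdef
  set w₀ := uvOfRadius Λ m r₀ with hw₀
  have hrH : rH Λ m < r₀ := hS.rH_lt_rC.trans hr
  have hw0 : 0 < w₀ := by
    have := hS.strictMonoOn_uvOfRadius (mem_Ioi.2 hS.rH_lt_rC) (mem_Ioi.2 hrH) hr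
    rwa [Subextremal.uvOfRadius_rC] at this
  have hwδ : w₀ < δ := by
    have := hS.strictMonoOn_uvOfRadius (mem_Ioi.2 hrH) (mem_Ioi.2 (hS.rH_lt_areaRadius hδ1)) hr'
    rwa [hS.uvOfRadius_areaRadius hδ1] at this
  have hO : IsOpen O := isOpen_spheresIn hU δ
  have hOU : cyl O ⊆ U := cyl_spheresIn_subset U δ
  have hO1 : ∀ q ∈ O, 0 < q.1 ∧ q.1 * q.2 ∈ Ioo (-δ) δ := fun q hq => hq.2
  have hO2 : ∀ q ∈ O, q.1 * q.2 < 1 := fun q hq => hq.2.2.2.trans hδ1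
  -- The hypothesis on `U` contains all spheres with `u > u₀` up to `r = r₀`; monotonicity of
  -- `areaRadius` translates `r ≤ r₀` into `u v ≤ w₀`.
  have hmem : ∀ q : ℝ × ℝ, u₀ < q.1 → 0 ≤ q.2 → q.1 * q.2 ≤ w₀ → q ∈ O := by
    intro q h1 h2 h3
    have hq1 : 0 < q.1 := hu.trans h1
    have h4 : q.1 * q.2 < 1 := h3.trans_lt (hwδ.trans hδ1)
    refine ⟨fun x => hUr ⟨⟨hq1, h2, h4, ?_⟩, h1⟩, hq1, ?_, h3.trans_lt hwδ⟩
    · have := hS.strictMonoOn_areaRadius.monotoneOn (mem_Iio.2 h4)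
        (mem_Iio.2 (hwδ.trans hδ1)) h3
      rw [hS.areaRadius_uvOfRadius hrH] at this
      exact this
    · linarith [mul_nonneg hq1.le h2]
  have hP := h.hasPlanePartials_fst hO hO1
  have hQ := h.hasPlanePartials_snd hO hO1
  have hN : ∀ q ∈ O, 0 ≤ (N q).1 ∧ 0 ≤ (N q).2 := by
    intro q hq
    have h1 := hco _ (hO1 q hq).2
    have h2 := (hO1 q hq).1
    rw [hNdef, fieldN_profileField h2.ne']
    exact ⟨(mul_pos h2 h1.fst_pos).le, (div_pos h1.snd_pos h2).le⟩
  have hH : ∀ u, u₀ < u → (u, 0) ∈ O := fun u hu' => hmem (u, 0) hu' le_rfl (by simpa using hw0.le)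
  have hcone : ∀ τ, τ₀ < τ → ∃ F, HasFlux Λ m U ψ
      (coneFlux Λ m N r₀ (horizonU Λ m u₀ τ₀ τ)) F := by
    intro τ hτ
    have hp := horizonU_pos Λ m hu τ₀ τ
    refine exists_hasFlux_cone hS hO hO2 hOU hP hQ hN hψ (div_nonneg hw0.le hp.le) fun v hv => ?_
    exact hmem _ (hS.lt_horizonU hu hτ) hv.1 (by rw [mul_comm]; exact (le_div_iff₀ hp).1 hv.2)
  choose! f hf using hcone
  refine ⟨f, hf, exists_isFluxDensity hS hO hO2 hOU hP hQ hN hψ hu hH, fun g hg τ₁ τ₂ h1 h2 => ?_⟩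
  obtain ⟨L, hL, hlim⟩ := exists_rate_limit (τ₀ := τ₀) hS hO hO2 hOU hP hQ hN hψ hu h2.le
    fun u hu' => hH u ((hS.lt_horizonU hu h1).trans_le hu'.1)
  have hgL := hg.ae_eq_rate_limit hS hO hO2 hOU hP hQ hψ hu hH hL hlim h1 h2
  obtain ⟨s, hs⟩ := hψ.2
  have hineq := fun j => h.energy_le (τ₀ := τ₀) hS hδ1 hco hO hO1 (hs.isClassicalSolution hOU j) hu
    hw0.le h2.le fun τ hτ w hw => by
      have hp := horizonU_pos Λ m hu τ₀ τ
      refine hmem _ (hS.lt_horizonU hu (h1.trans_le hτ.1)) (div_nonneg hw.1 hp.le) ?_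
      simp only [tauCoord]
      rw [mul_div_cancel₀ _ hp.ne']
      exact hw.2
  have l1 := (hf τ₁ h1 s hs).const_mul (Real.exp (b * τ₁))
  have l2 := (hf τ₂ (h1.trans h2) s hs).const_mul (Real.exp (b * τ₂))
  have l3 := tendsto_integral_mul_of_abs_sub (φ := fun τ => Real.exp (b * τ)) (hlim s hs).1 hL
    (by fun_prop) ⟨le_rfl, h2.le⟩ ⟨h2.le, le_rfl⟩ (hlim s hs).2
  have key := le_of_tendsto_of_tendsto' l2 (l1.add l3) hineq
  have hI : ∫ τ in τ₁..τ₂, Real.exp (b * τ) * L τ = ∫ τ in τ₁..τ₂, Real.exp (b * τ) * g τ := by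
    rw [intervalIntegral.integral_of_le h2.le, intervalIntegral.integral_of_le h2.le]
    refine integral_congr_ae ?_
    filter_upwards [hgL] with τ hτ
    rw [hτ]
  have e1 : ∫ τ in τ₁..τ₂, g τ * Real.exp (-b * (τ₂ - τ)) =
      Real.exp (-(b * τ₂)) * ∫ τ in τ₁..τ₂, Real.exp (b * τ) * g τ := by
    rw [← intervalIntegral.integral_const_mul]
    refine intervalIntegral.integral_congr fun τ _ => ?_
    rw [← mul_assoc, ← Real.exp_add, mul_comm]
    ring_nf
  have e2 : Real.exp (-b * (τ₂ - τ₁)) = Real.exp (-(b * τ₂)) * Real.exp (b * τ₁) := by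
    rw [← Real.exp_add]
    ring_nf
  have e3 : Real.exp (-(b * τ₂)) * Real.exp (b * τ₂) = 1 := by
    rw [← Real.exp_add]
    simp
  -- Multiplication of the weighted inequality by `e^{-b τ₂}` gives the stated form.
  rw [e1, e2, ← hI]
  have := mul_le_mul_of_nonneg_left key (Real.exp_nonneg (-(b * τ₂)))
  rw [← mul_assoc, e3, one_mul, mul_add] at this
  linarith

end

end SchwarzschildDeSitter

/-! ### Assembly of the proposition -/

open SchwarzschildDeSitter
theorem mainTheorem11 (Λ m : ℝ) (hΛ : 0 < Λ) (hm : 0 < m) (hsub : 3 * m < 1 / √Λ) :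
    ∃ b : ℝ, 0 < b ∧
      ∀ σ : ℝ, (2 / rC Λ m) ^ 2 * (2 / kappa Λ m) < σ →
        ∃ (r₁ r₂ : ℝ) (Y : ℝ × ℝ → ℝ × ℝ),
          rH Λ m < r₁ ∧ r₁ < rC Λ m ∧ rC Λ m < r₂ ∧ IsRedshiftField Λ m σ r₁ r₂ Y ∧
          ∀ r₀ : ℝ, rC Λ m < r₀ → r₀ < r₂ →
            IsRedshiftRadius Λ m Y r₀ ∧
            ∀ (u₀ τ₀ : ℝ), 0 < u₀ →
              ∀ U : Set Point, IsOpen U → U ⊆ chart →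
                {p ∈ redshiftRegion Λ m r₀ | u₀ < p.1} ⊆ U →
                ∀ ψ : Point → ℝ, IsFiniteEnergySolution Λ m U ψ →
                  ∃ f : ℝ → ℝ,
                    (∀ τ : ℝ, τ₀ < τ → HasFlux Λ m U ψ
                      (coneFlux Λ m (fieldN Λ m Y) r₀ (horizonU Λ m u₀ τ₀ τ)) (f τ)) ∧
                    (∃ g : ℝ → ℝ, IsFluxDensity Λ m U (fieldN Λ m Y) u₀ τ₀ ψ g) ∧
                    ∀ g : ℝ → ℝ, IsFluxDensity Λ m U (fieldN Λ m Y) u₀ τ₀ ψ g →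
                      ∀ τ₁ τ₂ : ℝ, τ₀ < τ₁ → τ₁ < τ₂ →
                        f τ₂ ≤ f τ₁ * Real.exp (-b * (τ₂ - τ₁)) +
                          ∫ τ in τ₁..τ₂, g τ * Real.exp (-b * (τ₂ - τ)) := by
  have hS := subextremal_of_lt hΛ hm hsub
  -- The rate is fixed before `σ` is introduced; only the width `δ` of the neighbourhood depends on
  -- `σ`.
  refine ⟨decayRate Λ m, hS.decayRate_pos, fun σ hσ => ?_⟩
  obtain ⟨δ, hδ, hδ1, a, c, hp, hco⟩ := hS.exists_coercive_profile hσ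
  have hneg : areaRadius Λ m (-δ) < rC Λ m := by
    rw [← hS.areaRadius_zero]
    exact hS.strictMonoOn_areaRadius (mem_Iio.2 (by linarith)) (mem_Iio.2 one_pos) (by linarith)
  have hpos : rC Λ m < areaRadius Λ m δ := by
    rw [← hS.areaRadius_zero]
    exact hS.strictMonoOn_areaRadius (mem_Iio.2 one_pos) (mem_Iio.2 hδ1) hδ
  -- The radii `r₁` and `r₂` are the values of the area radius at `u v = -δ` and `u v = δ`.
  refine ⟨areaRadius Λ m (-δ), areaRadius Λ m δ, profileField a c,
    hS.rH_lt_areaRadius (by linarith), hneg, hpos, hS.isRedshiftField_of_profile hδ hδ1 hp,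
    fun r₀ hr hr' => ⟨hS.isRedshiftRadius hδ1 hp hS.decayRate_pos hco hr hr',
      fun u₀ τ₀ hu U hU _ hUr ψ hψ => ?_⟩⟩
  exact hS.energy_decay hδ1 hp hco hr hr' hu hU hUr hψ
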